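/- Let $n\ge 1$, $0<\alpha<2$, and let $\Omega\subseteq\mathbb{R}^n$ be a (bounded or unbounded) domain, or more generally an open set. Let $u:\mathbb{R}^n\to\mathbb{R}$ be measurable with $\int_{\mathbb{R}^n}\frac{|u(x)|}{1+|x|^{n+\alpha}}\,dx<\infty$, and suppose that, for some $\varepsilon>0$ with $\{\alpha\}+\varepsilon\le 1$, $u\in C^{[\alpha],\{\alpha\}+\varepsilon}_{loc}(\Omega)$, where $[\alpha]$ and $\{\alpha\}$ are the integer and fractional parts of $\alpha$. For $x\in\Omega$ put $$(-\Delta)^{\frac{\alpha}{2}}u(x)=c_{n,\alpha}\lim_{\delta\to0^+}\int_{|z-x|\ge\delta}\frac{u(x)-u(z)}{|x-z|^{n+\alpha}}\,dz,\qquad c_{n,\alpha}=\frac{\alpha\,2^{\alpha-1}\,\Gamma(\frac{n+\alpha}{2})}{\pi^{n/2}\,\Gamma(1-\frac{\alpha}{2})}>0,$$ and for $y\in\mathbb{R}^n$, $r>0$ let $\bar u(r)=\frac{1}{|\partial B_r(y)|}\int_{\partial B_r(y)}u\,d\sigma$ be the spherical average of $u$ with respect to $y$. Then the limit defining $(-\Delta)^{\frac{\alpha}{2}}u(x)$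 exists for every $x\in\Omega$; for every ball $B_R(y)$ with $R>0$ and $\overline{B_R(y)}\subset\Omega$, the average $\bar u(r)$ exists for almost every $r>R$, and the integral below converges absolutely. Moreover: 1. If $(-\Delta)^{\frac{\alpha}{2}}u\ge0$ (resp. $\le 0$) in $\Omega$, then for every ball $B_R(y)$ with $\overline{B_R(y)}\subset\Omega$, $$u(y)\ \ge\ (\text{resp. }\le)\ \frac{2}{\pi}\sin\frac{\pi\alpha}{2}\int_R^{\infty}\frac{R^{\alpha}}{r\,(r^2-R^2)^{\frac{\alpha}{2}}}\,\bar u(r)\,dr.$$ 2. $(-\Delta)^{\frac{\alpha}{2}}u=0$ in $\Omega$ if and only if $$u(y)=\frac{2}{\pi}\sin\frac{\pi\alpha}{2}\int_R^{\infty}\frac{R^{\alpha}}{r\,(r^2-R^2)^{\frac{\alpha}{2}}}\,\bar u(r)\,dr$$ for every ball $B_R(y)$ with $\overline{B_R(y)}\subset\Omega$. -/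

import Mathlib

open MeasureTheory Filter Topology Set

noncomputable section

/-- Euclidean space `ℝⁿ`. -/
abbrev Euc (n : ℕ) : Type := EuclideanSpace ℝ (Fin n)

/-- The space `𝓛_α(ℝⁿ)`: measurable `u` with `∫ |u(x)| / (1 + |x|^(n+α)) dx < ∞`. -/
def MemLAlpha {n : ℕ} (α : ℝ) (u : Euc n → ℝ) : Prop :=
  Integrable (fun x : Euc n => u x / (1 + ‖x‖ ^ ((n : ℝ) + α)))

/-- The space `C^{k,γ}_loc(Ω)`, for `Ω` open: `u` is `k` times continuously differentiable in `Ω`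
and its `k`-th derivative is Hölder continuous with exponent `γ` on every compact subset of `Ω`. -/
def MemHolderLoc {n : ℕ} (k : ℕ) (γ : ℝ) (Ω : Set (Euc n)) (u : Euc n → ℝ) : Prop :=
  ContDiffOn ℝ (k : WithTop ℕ∞) u Ω ∧
    ∀ K : Set (Euc n), K ⊆ Ω → IsCompact K →
      ∃ C : NNReal, HolderOnWith C γ.toNNReal (iteratedFDeriv ℝ k u) K

/-- The standard normalisation constant `α 2^(α-1) Γ((n+α)/2) / (π^(n/2) Γ(1-α/2))` of the
fractional Laplacian of order `α`, which is positive for `0 < α < 2`. -/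
def fracLaplacianConst (n : ℕ) (α : ℝ) : ℝ :=
  α * 2 ^ (α - 1) * Real.Gamma (((n : ℝ) + α) / 2) /
    (Real.pi ^ ((n : ℝ) / 2) * Real.Gamma (1 - α / 2))

/-- The truncated singular integral
`C ∫_{|z-x| ≥ ε} (u(x) - u(z)) / |x-z|^(n+α) dz`. -/
def truncFracLaplacian {n : ℕ} (α : ℝ) (u : Euc n → ℝ) (x : Euc n) (ε : ℝ) : ℝ :=
  fracLaplacianConst n α *
    ∫ z in {z : Euc n | ε ≤ ‖z - x‖}, (u x - u z) / ‖x - z‖ ^ ((n : ℝ) + α)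

/-- The fractional Laplacian `(-Δ)^(α/2) u (x)` as a principal value: the limit of the truncated
integrals as `ε → 0⁺`. (`limUnder` is meaningful only where this limit exists.) -/
def fracLaplacian {n : ℕ} (α : ℝ) (u : Euc n → ℝ) (x : Euc n) : ℝ :=
  limUnder (𝓝[>] (0 : ℝ)) (truncFracLaplacian α u x)

/-- The spherical average of `u` over the sphere `∂B_r(y)`, for `r > 0`: the mean value of
`ω ↦ u (y + r ω)` with respect to the surface measure of the unit sphere. -/
def sphericalAverage {n : ℕ} (u : Euc n → ℝ) (y : Euc n) (r : ℝ) : ℝ :=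
  ⨍ ω : Metric.sphere (0 : Euc n) 1, u (y + r • (ω : Euc n)) ∂((volume : Measure (Euc n)).toSphere)

/-- The constant `(2/π) sin(πα/2)`. It is the constant `Γ(n/2) π^(-n/2-1) sin(πα/2)` of the
Poisson kernel of the ball times the area `2 π^(n/2) / Γ(n/2)` of the unit sphere, the latter
because the spherical average is a normalised mean. -/
def averageConst (α : ℝ) : ℝ := 2 / Real.pi * Real.sin (Real.pi * α / 2)

/-- The integrand `R^α / (r (r² - R²)^(α/2)) · ū(r)`, where `ū(r)` is the spherical average of `u`
with respect to the centre `y`. -/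
def averageIntegrand {n : ℕ} (α : ℝ) (u : Euc n → ℝ) (y : Euc n) (R r : ℝ) : ℝ :=
  R ^ α / (r * (r ^ 2 - R ^ 2) ^ (α / 2)) * sphericalAverage u y r

/-- The nonlocal average `(2/π) sin(πα/2) ∫_R^∞ R^α / (r (r² - R²)^(α/2)) ū(r) dr`. -/
def fracAverage {n : ℕ} (α : ℝ) (u : Euc n → ℝ) (y : Euc n) (R : ℝ) : ℝ :=
  averageConst α * ∫ r in Ioi R, averageIntegrand α u y R r

end

/-!
The nonlocal mean value property of the fractional Laplacian.

The second differences of `u` are paired with the torsion profile `(R² - ‖x‖²)₊ ^ (α / 2)`, whose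
fractional Laplacian is computed by slicing into chords: up to a positive factor it is the difference
of the average of the exterior kernels of radius below `R` and the exterior kernel of radius `R`.
For a supersolution the nonlocal averages are therefore dominated by their own volume means, hence by
their limit at the centre. Conversely, the mean value property is differentiated at radius zero.
-/

/-! Move the centre of the ball to the origin and write L v(x) for the integral of `secondDiff v x h
* kern α h` in h. Hölder regularity of order above α bounds second differences by |h|^(α+ε), so the
principal value exists and is a positive multiple of L v. The nonlocal average A(R) is the integral
of v against a probability density proportional to `outerKer α R`.

Mean value inequality. L is symmetric against the torsion profile τ_R (`integral_torsion_mul_eq`),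
and L τ_R is a positive multiple of `outerMean α R - R ^ n * outerKer α R` almost everywhere
(`exists_torsionLap_eq`). If L v ≥ 0, pairing with τ_R ≥ 0 therefore gives R^n A(R) ≤ n ∫₀^R ρ^(n-1)
A(ρ) dρ. A function below all its means of this kind cannot exceed its limit at 0
(`le_of_forall_pow_mul_le_integral`), and that limit is v(0) (`tendsto_fracAverage`). No Dirichlet
problem has to be solved. Subsolutions follow by passing to -v.

The formula for L τ_R. The profile is the superposition over 0 < ρ ≤ R of α ρ g_ρ, where g_ρ is
`innerKer α ρ`. Inside its ball L g_ρ = 0, because on every line g_ρ is a chord profile for which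
the one-dimensional integral vanishes (`integral_chord_eq_zero`). Hence L τ_R(x) does not depend on
R > |x|, and homogeneity and rotation invariance make it constant in the ball. Outside the ball the
potential of g_ρ is explicit up to a constant (`exists_lintegral_innerKer_kern`), and integrating it
in ρ is a product rule (`integral_exterior_density`). The constants are not evaluated: the exterior
one only has to be positive and finite, and the interior one is fixed by the vanishing of the total
integral of L τ_R.

Converse. If A(R) = v(0) for all small R, the integral of the second difference D of v at 0 against
`outerKer α R` vanishes. Since R^(-α) `outerKer α R` tends to `kern α`, the limit R → 0 yields L
v(0) = 0 (`tendsto_integral_outerKer`). -/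

/-! ### Polar coordinates. -/

lemma polar_aux {n : ℕ} [Nontrivial (Euc n)] {F : Euc n → ℝ} (hF : Integrable F) :
    Integrable (fun p : Metric.sphere (0 : Euc n) 1 × Ioi (0 : ℝ) => F ((p.2 : ℝ) • (p.1 : Euc n)))
      ((volume : Measure (Euc n)).toSphere.prod (Measure.volumeIoiPow (n - 1))) ∧
    ∫ x, F x = ∫ p : Metric.sphere (0 : Euc n) 1 × Ioi (0 : ℝ), F ((p.2 : ℝ) • (p.1 : Euc n))
      ∂((volume : Measure (Euc n)).toSphere.prod (Measure.volumeIoiPow (n - 1))) := by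
  have hmp := (volume : Measure (Euc n)).measurePreserving_homeomorphUnitSphereProd
  rw [finrank_euclideanSpace_fin] at hmp
  have hemb := (homeomorphUnitSphereProd (Euc n)).measurableEmbedding
  set G : Metric.sphere (0 : Euc n) 1 × Ioi (0 : ℝ) → ℝ :=
    fun p => F ((p.2 : ℝ) • (p.1 : Euc n)) with hG
  have hcomp : ∀ x : ({0}ᶜ : Set (Euc n)), G (homeomorphUnitSphereProd (Euc n) x) = F x := by
    intro x
    have hx : (x : Euc n) ≠ 0 := x.2
    have : ‖(x : Euc n)‖ ≠ 0 := by simpa using hx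
    simp [hG, smul_smul, this]
  constructor
  · rw [← hmp.integrable_comp_emb hemb]
    have : G ∘ (homeomorphUnitSphereProd (Euc n)) = F ∘ Subtype.val := by
      ext x; exact hcomp x
    rw [this, ← integrableOn_iff_comap_subtypeVal (by measurability)]
    exact hF.integrableOn
  · have h := hmp.integral_comp hemb G
    simp_rw [hcomp] at h
    rw [← h, integral_subtype_comap (by measurability) F, restrict_compl_singleton]

/-- The density r^m is positive on the open half-line, so a null set for it is Lebesgue null there.
-/
lemma ae_volumeIoiPow {m : ℕ} {p : ℝ → Prop} (h : ∀ᵐ r : Ioi (0 : ℝ) ∂(Measure.volumeIoiPow m), p (r : ℝ)) :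
    ∀ᵐ r ∂(volume.restrict (Ioi (0 : ℝ))), p r := by
  rw [Measure.volumeIoiPow, ae_withDensity_iff (by fun_prop)] at h
  rw [ae_restrict_iff_subtype measurableSet_Ioi]
  filter_upwards [h] with r hr
  apply hr
  have : (0 : ℝ) < r := r.2
  simp only [ne_eq, ENNReal.ofReal_eq_zero, not_le]
  positivity

lemma integral_volumeIoiPow {m : ℕ} (f : ℝ → ℝ) :
    ∫ r : Ioi (0 : ℝ), f (r : ℝ) ∂(Measure.volumeIoiPow m) = ∫ r in Ioi (0 : ℝ), r ^ m * f r := by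
  simp only [Measure.volumeIoiPow, ENNReal.ofReal]
  rw [integral_withDensity_eq_integral_smul ((measurable_subtype_coe.pow_const _).real_toNNReal),
    integral_subtype_comap measurableSet_Ioi fun a ↦ Real.toNNReal (a ^ m) • f a]
  refine setIntegral_congr_fun measurableSet_Ioi fun x hx ↦ ?_
  simp only [NNReal.smul_def]
  rw [Real.coe_toNNReal _ (pow_nonneg hx.out.le _), smul_eq_mul]

lemma integrable_volumeIoiPow {m : ℕ} {f : ℝ → ℝ} :
    Integrable (fun r : Ioi (0 : ℝ) => f r) (Measure.volumeIoiPow m) ↔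
      IntegrableOn (fun r => r ^ m * f r) (Ioi 0) := by
  rw [integrableOn_iff_comap_subtypeVal measurableSet_Ioi, Measure.volumeIoiPow,
    integrable_withDensity_iff_integrable_smul' (by fun_prop) (by simp)]
  refine integrable_congr (Eventually.of_forall ?_)
  rintro ⟨x, hx : 0 < x⟩
  simp (disch := positivity) [ENNReal.toReal_ofReal]

/-- Integration in polar coordinates. -/
lemma integral_polar {n : ℕ} [Nontrivial (Euc n)] {F : Euc n → ℝ} (hF : Integrable F) :
    (∀ᵐ r ∂(volume.restrict (Ioi (0 : ℝ))),
      Integrable (fun ω : Metric.sphere (0 : Euc n) 1 => F (r • (ω : Euc n)))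
        (volume : Measure (Euc n)).toSphere) ∧
    IntegrableOn (fun r : ℝ => r ^ (n - 1) * ∫ ω : Metric.sphere (0 : Euc n) 1,
      F (r • (ω : Euc n)) ∂(volume : Measure (Euc n)).toSphere) (Ioi 0) ∧
    ∫ x, F x = ∫ r in Ioi (0 : ℝ), r ^ (n - 1) * ∫ ω : Metric.sphere (0 : Euc n) 1,
      F (r • (ω : Euc n)) ∂(volume : Measure (Euc n)).toSphere := by
  obtain ⟨h1, h2⟩ := polar_aux hF
  refine ⟨?_, ?_, ?_⟩
  · exact ae_volumeIoiPow (p := fun r => Integrable (fun ω : Metric.sphere (0 : Euc n) 1 =>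
      F (r • (ω : Euc n))) (volume : Measure (Euc n)).toSphere) h1.prod_left_ae
  · exact integrable_volumeIoiPow (f := fun r => ∫ ω : Metric.sphere (0 : Euc n) 1,
      F (r • (ω : Euc n)) ∂(volume : Measure (Euc n)).toSphere) |>.1 h1.integral_prod_right
  · rw [h2, integral_prod_symm _ h1]
    exact integral_volumeIoiPow (fun r => ∫ ω : Metric.sphere (0 : Euc n) 1,
      F (r • (ω : Euc n)) ∂(volume : Measure (Euc n)).toSphere)

/-- A function whose weighted integral along each ray from the origin vanishes has integral `0`. -/
lemma integral_eq_zero_of_rays {n : ℕ} [Nontrivial (Euc n)] {F : Euc n → ℝ}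
    (h : ∀ ω : Euc n, ‖ω‖ = 1 → ∫ r in Ioi (0 : ℝ), r ^ (n - 1) * F (r • ω) = 0) :
    ∫ x, F x = 0 := by
  -- If F is not integrable, its Bochner integral is 0 by convention, so no integrability has to be
  -- assumed.
  by_cases hF : Integrable F
  · obtain ⟨h1, h2⟩ := polar_aux hF
    rw [h2, integral_prod _ h1]
    refine integral_eq_zero_of_ae (Eventually.of_forall fun ω => ?_)
    exact (integral_volumeIoiPow (fun r => F (r • (ω : Euc n)))).trans (h ω (by simp))
  · exact integral_undef hF

lemma integrable_radial {n : ℕ} [Nontrivial (Euc n)] {f : ℝ → ℝ} :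
    Integrable (fun x : Euc n => f ‖x‖) ↔ IntegrableOn (fun r => r ^ (n - 1) * f r) (Ioi 0) := by
  have := integrable_fun_norm_addHaar (volume : Measure (Euc n)) (f := f)
  rwa [finrank_euclideanSpace_fin] at this

/-- The total mass of the surface measure of the unit sphere. -/
noncomputable def sphereMass (n : ℕ) : ℝ :=
  (volume : Measure (Euc n)).toSphere.real univ

lemma sphereMass_pos {n : ℕ} [Nontrivial (Euc n)] : 0 < sphereMass n := by
  have : NeZero (volume : Measure (Euc n)).toSphere := ⟨Measure.toSphere_ne_zero _⟩
  exact measureReal_univ_pos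

lemma integral_radial {n : ℕ} [Nontrivial (Euc n)] (f : ℝ → ℝ) :
    ∫ x : Euc n, f ‖x‖ = sphereMass n * ∫ r in Ioi (0 : ℝ), r ^ (n - 1) * f r := by
  rw [integral_fun_norm_addHaar (volume : Measure (Euc n)) f]
  unfold sphereMass
  rw [Measure.toSphere_real_apply_univ, finrank_euclideanSpace_fin]
  simp [mul_assoc]

lemma pow_pred_eq {n : ℕ} (hn : n ≠ 0) {r : ℝ} : r ^ (n - 1) = r ^ ((n : ℝ) - 1) := by
  rw [← Real.rpow_natCast, Nat.cast_sub (by omega)]; simp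

lemma ne_zero_of_nontrivial (n : ℕ) [h : Nontrivial (Euc n)] : n ≠ 0 := by
  rintro rfl
  exact not_subsingleton (Euc 0) inferInstance

/-- Integrability of `|h|^(σ-n)` near the origin and of `|h|^(-n-α)` near infinity. -/
lemma integrable_of_kernel_bound {n : ℕ} [Nontrivial (Euc n)] {α σ η C : ℝ} (hα : 0 < α)
    (hσ : 0 < σ) (hη : 0 < η) {F : Euc n → ℝ} (hF : AEStronglyMeasurable F)
    (h1 : ∀ h, ‖h‖ < η → |F h| ≤ C * ‖h‖ ^ (σ - n))
    (h2 : ∀ h, η ≤ ‖h‖ → |F h| ≤ C * ‖h‖ ^ (-((n : ℝ) + α))) : Integrable F := by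
  have hn := ne_zero_of_nontrivial n
  -- Radial majorant. Against the Jacobian r^(n-1) its two branches become r^(σ-1) and r^(-1-α).
  set f : ℝ → ℝ := fun r => if r < η then C * r ^ (σ - n) else C * r ^ (-((n : ℝ) + α)) with hf
  have hfi : Integrable (fun x : Euc n => f ‖x‖) := by
    rw [integrable_radial]
    rw [← Ioo_union_Ici_eq_Ioi hη]
    refine IntegrableOn.union ?_ ?_
    · have : IntegrableOn (fun r : ℝ => C * r ^ (σ - 1)) (Ioo 0 η) := by
        apply Integrable.const_mul
        exact (intervalIntegral.integrableOn_Ioo_rpow_iff hη).2 (by linarith)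
      refine this.congr_fun (fun r hr => ?_) measurableSet_Ioo
      have hr0 : 0 < r := hr.1
      simp only [hf, if_pos hr.2]
      rw [pow_pred_eq hn, mul_left_comm, ← Real.rpow_add hr0]
      congr 2; ring
    · rw [integrableOn_Ici_iff_integrableOn_Ioi]
      have : IntegrableOn (fun r : ℝ => C * r ^ (-1 - α)) (Ioi η) := by
        apply Integrable.const_mul
        exact integrableOn_Ioi_rpow_of_lt (by linarith) hη
      refine this.congr_fun (fun r (hr : η < r) => ?_) measurableSet_Ioi
      have hr0 : 0 < r := hη.trans hr
      simp only [hf, if_neg (not_lt.2 hr.le)]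
      rw [pow_pred_eq hn, mul_left_comm, ← Real.rpow_add hr0]
      congr 2; ring
  refine hfi.mono' hF (Eventually.of_forall fun x => ?_)
  simp only [hf, Real.norm_eq_abs]
  split_ifs with h
  · exact h1 x h
  · exact h2 x (not_lt.1 h)

/-! ### The singular kernel, second differences and the principal value. -/

/-- The kernel `|h|^(-n-α)`. -/
noncomputable def kern {n : ℕ} (α : ℝ) (h : Euc n) : ℝ := ‖h‖ ^ (-((n : ℝ) + α))

/-- The symmetric second difference of `f` at `x`, with the sign of `-Δ`. -/
def secondDiff {n : ℕ} (f : Euc n → ℝ) (x h : Euc n) : ℝ := 2 * f x - f (x + h) - f (x - h)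

lemma kern_nonneg {n : ℕ} (α : ℝ) (h : Euc n) : 0 ≤ kern α h := by unfold kern; positivity

@[fun_prop]
lemma measurable_kern {n : ℕ} (α : ℝ) : Measurable (kern α : Euc n → ℝ) := by
  unfold kern; fun_prop

lemma kern_neg {n : ℕ} (α : ℝ) (h : Euc n) : kern α (-h) = kern α h := by simp [kern]

/-- Away from the origin the kernel is controlled by the weight in `MemLAlpha`; this is what makes
far interactions integrable. -/
lemma kern_le {n : ℕ} {α η : ℝ} (hα : 0 < α) (hη : 0 < η) {h : Euc n} (hh : η ≤ ‖h‖) :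
    kern α h ≤ (1 + η ^ (-((n : ℝ) + α))) * (1 + ‖h‖ ^ ((n : ℝ) + α))⁻¹ := by
  have hs : 0 < (n : ℝ) + α := by positivity
  have hp : 0 < ‖h‖ := hη.trans_le hh
  have h1 : ‖h‖ ^ (-((n : ℝ) + α)) ≤ η ^ (-((n : ℝ) + α)) :=
    Real.rpow_le_rpow_of_nonpos hη hh (by linarith)
  rw [← div_eq_mul_inv, le_div_iff₀ (by positivity), kern, mul_add, mul_one, ← Real.rpow_add hp]
  simp only [neg_add_cancel, Real.rpow_zero]; linarith

/-- The weights at x and y + x are comparable, because |y + x| is at most twice the larger norm.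
Translation invariance of `MemLAlpha` rests on this. -/
lemma one_add_rpow_norm_add_le {n : ℕ} {s : ℝ} (hs : 0 < s) (x y : Euc n) :
    1 + ‖y + x‖ ^ s ≤ (1 + 2 ^ s * (1 + ‖y‖ ^ s)) * (1 + ‖x‖ ^ s) := by
  have h1 : ‖y + x‖ ^ s ≤ 2 ^ s * (‖y‖ ^ s + ‖x‖ ^ s) := by
    calc ‖y + x‖ ^ s ≤ (2 * max ‖y‖ ‖x‖) ^ s := by
          gcongr
          have := norm_add_le y x
          have := le_max_left ‖y‖ ‖x‖
          have := le_max_right ‖y‖ ‖x‖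
          linarith
      _ = 2 ^ s * (max ‖y‖ ‖x‖) ^ s := Real.mul_rpow (by norm_num) (by positivity)
      _ ≤ _ := by
          gcongr
          rcases max_choice ‖y‖ ‖x‖ with h | h <;> rw [h]
          · have := Real.rpow_nonneg (norm_nonneg x) s; linarith
          · have := Real.rpow_nonneg (norm_nonneg y) s; linarith
  have h2 := Real.rpow_nonneg (norm_nonneg x) s
  have h3 := Real.rpow_nonneg (norm_nonneg y) s
  have h4 : (0 : ℝ) < 2 ^ s := by positivity
  nlinarith [mul_nonneg h4.le h3, mul_nonneg h4.le h2, mul_nonneg (mul_nonneg h4.le h3) h2]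

lemma MemLAlpha.aestronglyMeasurable {n : ℕ} {α : ℝ} {u : Euc n → ℝ} (hu : MemLAlpha α u) :
    AEStronglyMeasurable u := by
  have h1 := Integrable.aestronglyMeasurable hu
  have h2 : AEStronglyMeasurable (fun x : Euc n => 1 + ‖x‖ ^ ((n : ℝ) + α)) :=
    Measurable.aestronglyMeasurable (by fun_prop)
  refine (h1.mul h2).congr (Eventually.of_forall fun x => ?_)
  have : 0 < 1 + ‖x‖ ^ ((n : ℝ) + α) := by positivity
  simp only [Pi.mul_apply]; exact div_mul_cancel₀ _ this.ne'

lemma MemLAlpha.translate {n : ℕ} {α : ℝ} (hα : 0 < α) {u : Euc n → ℝ} (hu : MemLAlpha α u)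
    (y : Euc n) : MemLAlpha α (fun x => u (y + x)) := by
  have hs : 0 < (n : ℝ) + α := by positivity
  have h1 : Integrable (fun x : Euc n => u (y + x) / (1 + ‖y + x‖ ^ ((n : ℝ) + α))) :=
    Integrable.comp_add_left hu y
  refine (h1.norm.const_mul (1 + 2 ^ ((n : ℝ) + α) * (1 + ‖y‖ ^ ((n : ℝ) + α)))).mono' ?_
    (Eventually.of_forall fun x => ?_)
  · have h2 : AEStronglyMeasurable (fun x => u (y + x)) :=
      hu.aestronglyMeasurable.comp_measurePreserving (measurePreserving_add_left volume y)
    exact (h2.aemeasurable.div (by fun_prop)).aestronglyMeasurable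
  · have h2 := one_add_rpow_norm_add_le hs x y
    have h3 : 0 < 1 + ‖x‖ ^ ((n : ℝ) + α) := by positivity
    have h4 : 0 < 1 + ‖y + x‖ ^ ((n : ℝ) + α) := by positivity
    rw [Real.norm_eq_abs, Real.norm_eq_abs, abs_div, abs_div, abs_of_pos h3, abs_of_pos h4,
      div_le_iff₀ h3, ← mul_div_assoc, div_mul_eq_mul_div, le_div_iff₀ h4]
    calc |u (y + x)| * (1 + ‖y + x‖ ^ ((n : ℝ) + α)) ≤ |u (y + x)| * _ :=
          mul_le_mul_of_nonneg_left h2 (abs_nonneg _)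
      _ = _ := by ring

lemma MemLAlpha.reflect {n : ℕ} {α : ℝ} {u : Euc n → ℝ} (hu : MemLAlpha α u) :
    MemLAlpha α (fun x => u (-x)) := by
  have := Integrable.comp_neg hu
  simpa [MemLAlpha] using this

lemma memLAlpha_const {n : ℕ} [Nontrivial (Euc n)] {α : ℝ} (hα : 0 < α) (c : ℝ) :
    MemLAlpha α (fun _ : Euc n => c) := by
  unfold MemLAlpha
  have hn := ne_zero_of_nontrivial n
  refine integrable_of_kernel_bound (n := n) (α := α) (σ := n) (η := 1) (C := |c|) hα
    (by positivity) one_pos (Measurable.aestronglyMeasurable (by fun_prop)) ?_ ?_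
  · intro h _
    have : 0 ≤ ‖h‖ ^ ((n : ℝ) + α) := by positivity
    rw [abs_div, abs_of_pos (by positivity : 0 < 1 + ‖h‖ ^ ((n : ℝ) + α)), sub_self,
      Real.rpow_zero, mul_one]
    exact div_le_self (abs_nonneg _) (by linarith)
  · intro h hh
    have hp : 0 < ‖h‖ := by linarith
    rw [abs_div, abs_of_pos (by positivity : 0 < 1 + ‖h‖ ^ ((n : ℝ) + α)), Real.rpow_neg hp.le,
      ← div_eq_mul_inv]
    gcongr
    linarith

lemma MemLAlpha.integrableOn_kern {n : ℕ} {α : ℝ} (hα : 0 < α) {u : Euc n → ℝ}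
    (hu : MemLAlpha α u) {η : ℝ} (hη : 0 < η) :
    IntegrableOn (fun h => u h * kern α h) {h | η ≤ ‖h‖} := by
  have hms : MeasurableSet {h : Euc n | η ≤ ‖h‖} := measurableSet_le measurable_const (by fun_prop)
  refine Integrable.mono' ((Integrable.norm hu).const_mul
    (1 + η ^ (-((n : ℝ) + α)))).integrableOn ?_ ?_
  · exact (hu.aestronglyMeasurable.mul (measurable_kern α).aestronglyMeasurable).restrict
  · filter_upwards [ae_restrict_mem hms] with h hh
    have h3 : 0 < 1 + ‖h‖ ^ ((n : ℝ) + α) := by positivity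
    rw [Real.norm_eq_abs, Real.norm_eq_abs, abs_mul, abs_div, abs_of_pos h3,
      abs_of_nonneg (kern_nonneg α h)]
    calc |u h| * kern α h ≤ |u h| * ((1 + η ^ (-((n : ℝ) + α))) * (1 + ‖h‖ ^ ((n : ℝ) + α))⁻¹) :=
          mul_le_mul_of_nonneg_left (kern_le hα hη hh) (abs_nonneg _)
      _ = _ := by ring

lemma MemLAlpha.locallyIntegrable {n : ℕ} {α : ℝ} (hα : 0 < α) {u : Euc n → ℝ}
    (hu : MemLAlpha α u) (R : ℝ) : IntegrableOn u (Metric.closedBall 0 R) := by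
  have hs : 0 < (n : ℝ) + α := by positivity
  refine Integrable.mono' ((Integrable.norm hu).const_mul
    (1 + |R| ^ ((n : ℝ) + α))).integrableOn hu.aestronglyMeasurable.restrict ?_
  filter_upwards [ae_restrict_mem Metric.isClosed_closedBall.measurableSet] with h hh
  rw [mem_closedBall_zero_iff] at hh
  have h3 : 0 < 1 + ‖h‖ ^ ((n : ℝ) + α) := by positivity
  have h4 : ‖h‖ ^ ((n : ℝ) + α) ≤ |R| ^ ((n : ℝ) + α) := by
    gcongr; exact hh.trans (le_abs_self R)
  rw [Real.norm_eq_abs, Real.norm_eq_abs, abs_div, abs_of_pos h3, ← mul_div_assoc, le_div_iff₀ h3,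
    mul_comm]
  gcongr

lemma measurableSet_le_norm {n : ℕ} (η : ℝ) : MeasurableSet {h : Euc n | η ≤ ‖h‖} :=
  measurableSet_le measurable_const (by fun_prop)

lemma aestronglyMeasurable_secondDiff {n : ℕ} {f : Euc n → ℝ} (hf : AEStronglyMeasurable f)
    (x : Euc n) : AEStronglyMeasurable (secondDiff f x) := by
  have h1 : AEStronglyMeasurable (fun h => f (x + h)) :=
    hf.comp_measurePreserving (measurePreserving_add_left volume x)
  have h2 : AEStronglyMeasurable (fun h => f (x - h)) :=
    hf.comp_measurePreserving (Measure.measurePreserving_sub_left volume x)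
  exact ((aestronglyMeasurable_const.sub h1).sub h2)

/-- Near the origin the assumed bound leaves |h|^(σ-n). Away from it the three terms of the second
difference are integrable separately. -/
lemma integrable_secondDiff_kern {n : ℕ} [Nontrivial (Euc n)] {α σ η C : ℝ} (hα : 0 < α)
    (hσ : 0 < σ) (hη : 0 < η) (hC : 0 ≤ C) {u : Euc n → ℝ} (hu : MemLAlpha α u) {x : Euc n}
    (hx : ∀ h, ‖h‖ < η → |secondDiff u x h| ≤ C * ‖h‖ ^ (α + σ)) :
    Integrable (fun h => secondDiff u x h * kern α h) := by
  rw [← integrableOn_univ, ← union_compl_self {h : Euc n | η ≤ ‖h‖}]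
  refine IntegrableOn.union ?_ ?_
  · have h0 := (memLAlpha_const (n := n) hα (2 * u x)).integrableOn_kern hα hη
    have h1 := (hu.translate hα x).integrableOn_kern hα hη
    have h2 := (hu.translate hα x).reflect.integrableOn_kern hα hη
    refine ((h0.sub h1).sub h2).congr (Eventually.of_forall fun h => ?_)
    simp only [Pi.sub_apply, secondDiff, ← sub_eq_add_neg]; ring
  · rw [← integrable_indicator_iff (measurableSet_le_norm η).compl]
    refine integrable_of_kernel_bound (α := α) (σ := σ) (η := η) (C := C) hα hσ hη ?_ ?_ ?_
    · exact ((aestronglyMeasurable_secondDiff hu.aestronglyMeasurable x).mul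
        (measurable_kern α).aestronglyMeasurable).indicator (measurableSet_le_norm η).compl
    · intro h hh
      rw [indicator_of_mem (by simpa using hh), abs_mul, abs_of_nonneg (kern_nonneg α h)]
      refine (mul_le_mul_of_nonneg_right (hx h hh) (kern_nonneg α h)).trans ?_
      rcases eq_or_ne h 0 with rfl | h0
      · have : 0 < α + σ := by positivity
        simp only [norm_zero, Real.zero_rpow this.ne', mul_zero, zero_mul]
        positivity
      · have hp : 0 < ‖h‖ := norm_pos_iff.2 h0
        rw [kern, mul_assoc, ← Real.rpow_add hp]
        apply le_of_eq; congr 2; ring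
    · intro h hh
      have hp : 0 < ‖h‖ := hη.trans_le hh
      rw [indicator_of_notMem (by simpa using hh), abs_zero]
      positivity

/-- The truncated singular integral in symmetrised form. -/
lemma truncFracLaplacian_eq {n : ℕ} [Nontrivial (Euc n)] {α : ℝ} (hα : 0 < α) {u : Euc n → ℝ}
    (hu : MemLAlpha α u) (x : Euc n) {ε : ℝ} (hε : 0 < ε) :
    truncFracLaplacian α u x ε = fracLaplacianConst n α / 2 *
      ∫ h in {h : Euc n | ε ≤ ‖h‖}, secondDiff u x h * kern α h := by
  have h0 := (memLAlpha_const (n := n) hα (u x)).integrableOn_kern hα hε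
  have h1 := (hu.translate hα x).integrableOn_kern hα hε
  have h2 := (hu.translate hα x).reflect.integrableOn_kern hα hε
  have hms := measurableSet_le_norm (n := n) ε
  have e1 : ∫ z in {z : Euc n | ε ≤ ‖z - x‖}, (u x - u z) / ‖x - z‖ ^ ((n : ℝ) + α) =
      ∫ h in {h : Euc n | ε ≤ ‖h‖}, (u x - u (x + h)) * kern α h := by
    have hms' : MeasurableSet {z : Euc n | ε ≤ ‖z - x‖} :=
      measurableSet_le measurable_const (by fun_prop)
    rw [← integral_indicator hms', ← integral_indicator hms, ← integral_add_left_eq_self _ x]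
    congr 1; ext h
    simp only [indicator, mem_ofPred_eq, add_sub_cancel_left]
    split_ifs
    · rw [show x - (x + h) = -h by abel, norm_neg, div_eq_mul_inv, kern,
        Real.rpow_neg (norm_nonneg _)]
    · rfl
  -- The truncation set and the kernel are even, so h may be replaced by -h; averaging the two forms
  -- produces the second difference and the factor 1/2.
  have e2 : ∫ h in {h : Euc n | ε ≤ ‖h‖}, (u x - u (x + h)) * kern α h =
      ∫ h in {h : Euc n | ε ≤ ‖h‖}, (u x - u (x - h)) * kern α h := by
    rw [← integral_indicator hms, ← integral_indicator hms, ← integral_neg_eq_self]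
    congr 1; ext h
    simp only [indicator, mem_ofPred_eq, norm_neg, kern_neg, ← sub_eq_add_neg]
  have e3 : ∫ h in {h : Euc n | ε ≤ ‖h‖}, secondDiff u x h * kern α h =
      ∫ h in {h : Euc n | ε ≤ ‖h‖}, ((u x - u (x + h)) * kern α h + (u x - u (x - h)) * kern α h) := by
    congr 1; ext h; simp only [secondDiff]; ring
  rw [truncFracLaplacian, e1, e3, integral_add, ← e2]
  · ring
  · refine (h0.sub h1).congr (Eventually.of_forall fun h => ?_)
    simp only [Pi.sub_apply]; ring
  · refine (h0.sub h2).congr (Eventually.of_forall fun h => ?_)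
    simp only [Pi.sub_apply, ← sub_eq_add_neg]; ring

/-- The principal value exists and equals an absolutely convergent integral of second differences. -/
lemma tendsto_truncFracLaplacian {n : ℕ} [Nontrivial (Euc n)] {α σ η C : ℝ} (hα : 0 < α)
    (hσ : 0 < σ) (hη : 0 < η) (hC : 0 ≤ C) {u : Euc n → ℝ} (hu : MemLAlpha α u) {x : Euc n}
    (hx : ∀ h, ‖h‖ < η → |secondDiff u x h| ≤ C * ‖h‖ ^ (α + σ)) :
    Tendsto (truncFracLaplacian α u x) (𝓝[>] 0)
      (𝓝 (fracLaplacianConst n α / 2 * ∫ h, secondDiff u x h * kern α h)) := by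
  have hi := integrable_secondDiff_kern hα hσ hη hC hu hx
  have hc : AECover (volume : Measure (Euc n)) (𝓝[>] (0 : ℝ)) (fun ε => {h : Euc n | ε ≤ ‖h‖}) := by
    refine ⟨?_, fun ε => measurableSet_le_norm ε⟩
    filter_upwards [Measure.ae_ne volume (0 : Euc n)] with h hh
    have hp : 0 < ‖h‖ := norm_pos_iff.2 hh
    filter_upwards [Ioo_mem_nhdsGT hp] with ε hε using hε.2.le
  refine ((hc.integral_tendsto_of_countably_generated hi).const_mul _).congr' ?_
  filter_upwards [self_mem_nhdsWithin] with ε hε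
  exact (truncFracLaplacian_eq hα hu x hε).symm

/-! ### The radial weight and its total mass. -/

/-- Both integrability and value are read off from the normalisation of the beta density. -/
lemma integral_beta {a b : ℝ} (ha : 0 < a) (hb : 0 < b) :
    IntegrableOn (fun x : ℝ => x ^ (a - 1) * (1 - x) ^ (b - 1)) (Ioo 0 1) ∧
    ∫ x in Ioo (0 : ℝ) 1, x ^ (a - 1) * (1 - x) ^ (b - 1) = ProbabilityTheory.beta a b := by
  have hB := ProbabilityTheory.beta_pos ha hb
  have h := ProbabilityTheory.lintegral_betaPDF_eq_one ha hb
  rw [ProbabilityTheory.lintegral_betaPDF] at h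
  have hm : Measurable (fun x : ℝ => 1 / ProbabilityTheory.beta a b * x ^ (a - 1) * (1 - x) ^ (b - 1)) := by
    fun_prop
  have hnn : 0 ≤ᵐ[volume.restrict (Ioo (0 : ℝ) 1)]
      (fun x : ℝ => 1 / ProbabilityTheory.beta a b * x ^ (a - 1) * (1 - x) ^ (b - 1)) := by
    filter_upwards [ae_restrict_mem measurableSet_Ioo] with x hx
    have h1 : 0 < x := hx.1
    have h2 : 0 < 1 - x := by linarith [hx.2]
    simp only [Pi.zero_apply]; positivity
  have hint : IntegrableOn (fun x : ℝ => 1 / ProbabilityTheory.beta a b * x ^ (a - 1) * (1 - x) ^ (b - 1))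
      (Ioo 0 1) := by
    refine ⟨hm.aestronglyMeasurable, ?_⟩
    rw [hasFiniteIntegral_iff_ofReal hnn, h]; simp
  have heq : (fun x : ℝ => x ^ (a - 1) * (1 - x) ^ (b - 1)) = fun x =>
      ProbabilityTheory.beta a b *
        (1 / ProbabilityTheory.beta a b * x ^ (a - 1) * (1 - x) ^ (b - 1)) := by
    ext x; field_simp
  rw [heq]
  refine ⟨hint.const_mul _, ?_⟩
  rw [integral_const_mul, integral_eq_lintegral_of_nonneg_ae hnn hm.aestronglyMeasurable, h]
  simp

lemma sin_half_pos {α : ℝ} (hα0 : 0 < α) (hα2 : α < 2) : 0 < Real.sin (Real.pi * α / 2) :=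
  Real.sin_pos_of_pos_of_lt_pi (by have := Real.pi_pos; positivity) (by nlinarith [Real.pi_pos])

lemma averageConst_pos {α : ℝ} (hα0 : 0 < α) (hα2 : α < 2) : 0 < averageConst α := by
  have := sin_half_pos hα0 hα2
  have := Real.pi_pos
  unfold averageConst; positivity

lemma image_div_sqrt {R : ℝ} (hR : 0 < R) :
    (fun x : ℝ => R * x ^ (-(1 / 2) : ℝ)) '' Ioo 0 1 = Ioi R := by
  ext r
  simp only [mem_image, mem_Ioo, mem_Ioi]
  constructor
  · rintro ⟨x, ⟨h0, h1⟩, rfl⟩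
    have := Real.one_lt_rpow_of_pos_of_lt_one_of_neg h0 h1 (by norm_num : (-(1 / 2) : ℝ) < 0)
    nlinarith
  · intro hr
    have hr0 : 0 < r := hR.trans hr
    refine ⟨(r / R) ^ (-2 : ℝ), ⟨by positivity, ?_⟩, ?_⟩
    · exact Real.rpow_lt_one_of_one_lt_of_neg ((one_lt_div hR).2 hr) (by norm_num)
    · rw [← Real.rpow_mul (by positivity)]
      norm_num
      field_simp

/-- Total mass of the radial weight of the averages. -/
lemma integral_averageWeight {α R : ℝ} (hα0 : 0 < α) (hα2 : α < 2) (hR : 0 < R) :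
    IntegrableOn (fun r : ℝ => R ^ α / (r * (r ^ 2 - R ^ 2) ^ (α / 2))) (Ioi R) ∧
    averageConst α * ∫ r in Ioi R, R ^ α / (r * (r ^ 2 - R ^ 2) ^ (α / 2)) = 1 := by
  -- The substitution x = R²/r² turns the weight into half of x^(α/2-1) (1-x)^(-α/2). By the
  -- reflection formula its beta integral is π / sin(πα/2), which `averageConst` cancels.
  have hd : ∀ x ∈ Ioo (0 : ℝ) 1, HasDerivWithinAt (fun x : ℝ => R * x ^ (-(1 / 2) : ℝ))
      (R * (-(1 / 2) * x ^ (-(1 / 2) - 1 : ℝ))) (Ioo 0 1) x := fun x hx =>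
    ((Real.hasDerivAt_rpow_const (Or.inl hx.1.ne')).const_mul R).hasDerivWithinAt
  have hinj : InjOn (fun x : ℝ => R * x ^ (-(1 / 2) : ℝ)) (Ioo 0 1) := by
    intro x hx y hy hxy
    have h1 : x ^ (-(1 / 2) : ℝ) = y ^ (-(1 / 2) : ℝ) := mul_left_cancel₀ hR.ne' hxy
    exact (Real.rpow_left_inj hx.1.le hy.1.le (by norm_num)).1 h1
  have hpt : ∀ x ∈ Ioo (0 : ℝ) 1, |R * (-(1 / 2) * x ^ (-(1 / 2) - 1 : ℝ))| •
      (R ^ α / ((R * x ^ (-(1 / 2) : ℝ)) * ((R * x ^ (-(1 / 2) : ℝ)) ^ 2 - R ^ 2) ^ (α / 2))) =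
      1 / 2 * (x ^ (α / 2 - 1) * (1 - x) ^ (1 - α / 2 - 1)) := by
    intro x hx
    have h0 : 0 < x := hx.1
    have h1 : 0 < 1 - x := by linarith [hx.2]
    have e1 : (R * x ^ (-(1 / 2) : ℝ)) ^ 2 - R ^ 2 = R ^ (2 : ℝ) * (x ^ (-1 : ℝ) * (1 - x)) := by
      rw [mul_pow, ← Real.rpow_natCast (x ^ _), ← Real.rpow_mul h0.le]
      norm_num
      rw [Real.rpow_neg_one]
      field_simp
    rw [e1, Real.mul_rpow (by positivity) (by positivity), Real.mul_rpow (by positivity) h1.le,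
      ← Real.rpow_mul hR.le, ← Real.rpow_mul h0.le, smul_eq_mul, abs_mul, abs_mul, abs_of_pos hR,
      abs_of_pos (by positivity : 0 < x ^ (-(1 / 2) - 1 : ℝ))]
    have e2 : x ^ (α / 2 - 1) = x ^ (-(1 / 2) - 1 : ℝ) / (x ^ (-(1 / 2) : ℝ) * x ^ (-1 * (α / 2))) := by
      rw [← Real.rpow_add h0, ← Real.rpow_sub h0]; congr 1; ring
    have e3 : (1 - x) ^ (1 - α / 2 - 1) = ((1 - x) ^ (α / 2))⁻¹ := by
      rw [← Real.rpow_neg h1.le]; congr 1; ring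
    rw [e2, e3]
    have : (2 : ℝ) * (α / 2) = α := by ring
    rw [this]
    norm_num
    field_simp
  obtain ⟨hi, hv⟩ := integral_beta (a := α / 2) (b := 1 - α / 2) (by linarith) (by linarith)
  rw [← image_div_sqrt hR]
  constructor
  · rw [integrableOn_image_iff_integrableOn_abs_deriv_smul measurableSet_Ioo hd hinj]
    exact IntegrableOn.congr_fun (hi.const_mul (1 / 2)) (fun x hx => (hpt x hx).symm) measurableSet_Ioo
  · rw [integral_image_eq_integral_abs_deriv_smul measurableSet_Ioo hd hinj,
      setIntegral_congr_fun measurableSet_Ioo hpt, integral_const_mul, hv, ProbabilityTheory.beta,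
      Real.Gamma_mul_Gamma_one_sub, averageConst]
    have := sin_half_pos hα0 hα2
    rw [show Real.pi * (α / 2) = Real.pi * α / 2 by ring]
    simp only [add_sub_cancel, Real.Gamma_one]
    have := Real.pi_pos
    field_simp

/-! ### The exterior kernel and the averages as integrals over space. -/

/-- The kernel `R^α |x|^(-n) (|x|² - R²)₊^(-α/2)`, proportional to the Poisson kernel of `B_R`
at the centre. -/
noncomputable def outerKer {n : ℕ} (α R : ℝ) (x : Euc n) : ℝ :=
  if R < ‖x‖ then R ^ α / (‖x‖ ^ n * (‖x‖ ^ 2 - R ^ 2) ^ (α / 2)) else 0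

/-- The normalising constant of `outerKer`. -/
noncomputable def outerConst (n : ℕ) (α : ℝ) : ℝ := averageConst α / sphereMass n

lemma outerConst_pos {n : ℕ} [Nontrivial (Euc n)] {α : ℝ} (hα0 : 0 < α) (hα2 : α < 2) :
    0 < outerConst n α := div_pos (averageConst_pos hα0 hα2) sphereMass_pos

lemma outerKer_nonneg {n : ℕ} {α R : ℝ} (hR : 0 ≤ R) (x : Euc n) : 0 ≤ outerKer α R x := by
  unfold outerKer
  split_ifs with h
  · have : 0 ≤ ‖x‖ ^ 2 - R ^ 2 := by nlinarith
    positivity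
  · rfl

lemma measurable_outerKer_uncurry {n : ℕ} (α : ℝ) :
    Measurable (fun p : ℝ × Euc n => outerKer α p.1 p.2) := by
  unfold outerKer
  exact Measurable.ite (measurableSet_lt (by fun_prop) (by fun_prop)) (by fun_prop) (by fun_prop)

@[fun_prop]
lemma measurable_outerKer {n : ℕ} (α R : ℝ) : Measurable (outerKer α R : Euc n → ℝ) :=
  (measurable_outerKer_uncurry α).comp (measurable_const.prodMk measurable_id)

/-- In polar coordinates |x|^(-n) r^(n-1) is 1/r, so the mass reduces to `integral_averageWeight`.
The resulting mass does not depend on R. -/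
lemma integral_outerKer {n : ℕ} [Nontrivial (Euc n)] {α R : ℝ} (hα0 : 0 < α) (hα2 : α < 2)
    (hR : 0 < R) :
    Integrable (outerKer α R : Euc n → ℝ) ∧ outerConst n α * ∫ x : Euc n, outerKer α R x = 1 := by
  have hn := ne_zero_of_nontrivial n
  obtain ⟨h1, h2⟩ := integral_averageWeight hα0 hα2 hR
  set f : ℝ → ℝ := fun r => if R < r then R ^ α / (r ^ n * (r ^ 2 - R ^ 2) ^ (α / 2)) else 0 with hf
  have hpt : (fun r => r ^ (n - 1) * f r) =
      (Ioi R).indicator (fun r : ℝ => R ^ α / (r * (r ^ 2 - R ^ 2) ^ (α / 2))) := by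
    ext r
    by_cases hr : R < r
    · have hr0 : 0 < r := hR.trans hr
      rw [indicator_of_mem (show r ∈ Ioi R from hr), hf]
      simp only [if_pos hr]
      have hpow : r ^ n = r ^ (n - 1) * r := by rw [← pow_succ, Nat.sub_one_add_one hn]
      rw [hpow]
      field_simp
    · rw [indicator_of_notMem (show r ∉ Ioi R from hr), hf]
      simp [hr]
  have hsub : Ioi (0 : ℝ) ∩ Ioi R = Ioi R := by
    rw [Ioi_inter_Ioi]; simp [hR.le]
  constructor
  · change Integrable (fun x : Euc n => f ‖x‖)
    rw [integrable_radial, hpt, IntegrableOn, integrable_indicator_iff measurableSet_Ioi,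
      IntegrableOn, Measure.restrict_restrict measurableSet_Ioi, inter_comm, hsub]
    exact h1
  · have := sphereMass_pos (n := n)
    change outerConst n α * ∫ x : Euc n, f ‖x‖ = 1
    rw [integral_radial, hpt, setIntegral_indicator measurableSet_Ioi, hsub, outerConst, ← h2]
    field_simp

/-- With θ = R₀ / (R₀ + η) one has R ≤ θ|x|, hence |x|² - R² ≥ (1 - θ²)|x|². The constant depends on
R only through the factor R^α, which is small for small balls. -/
lemma outerKer_le {n : ℕ} {α R R₀ η : ℝ} (hα0 : 0 < α) (hR : 0 < R) (hR0 : R ≤ R₀) (hη : 0 < η)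
    {x : Euc n} (hx : R₀ + η ≤ ‖x‖) :
    outerKer α R x ≤ R ^ α * (1 - (R₀ / (R₀ + η)) ^ 2) ^ (-(α / 2)) * kern α x := by
  have hx0 : 0 < ‖x‖ := by linarith
  have hθ : (R₀ / (R₀ + η)) ^ 2 < 1 := by
    rw [sq_lt_one_iff₀ (by have : 0 < R₀ := by linarith
                           positivity), div_lt_one (by linarith)]; linarith
  have h1 : (1 - (R₀ / (R₀ + η)) ^ 2) * ‖x‖ ^ 2 ≤ ‖x‖ ^ 2 - R ^ 2 := by
    have : R ≤ R₀ / (R₀ + η) * ‖x‖ := by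
      rw [div_mul_eq_mul_div, le_div_iff₀ (by linarith)]
      have : 0 < R₀ := by linarith
      gcongr
    have := pow_le_pow_left₀ hR.le this 2
    rw [mul_pow] at this
    linarith
  have h0 : 0 < 1 - (R₀ / (R₀ + η)) ^ 2 := by linarith
  rw [outerKer, if_pos (by linarith), kern, div_eq_mul_inv, mul_assoc]
  gcongr
  have h2 : ((1 - (R₀ / (R₀ + η)) ^ 2) * ‖x‖ ^ 2) ^ (α / 2) ≤ (‖x‖ ^ 2 - R ^ 2) ^ (α / 2) := by
    gcongr
  calc (‖x‖ ^ n * (‖x‖ ^ 2 - R ^ 2) ^ (α / 2))⁻¹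
      ≤ (‖x‖ ^ n * ((1 - (R₀ / (R₀ + η)) ^ 2) * ‖x‖ ^ 2) ^ (α / 2))⁻¹ := by gcongr
    _ = _ := by
      rw [Real.mul_rpow h0.le (by positivity), Real.rpow_neg h0.le, neg_add, Real.rpow_add hx0,
        Real.rpow_neg hx0.le, Real.rpow_neg hx0.le, Real.rpow_natCast, ← Real.rpow_natCast ‖x‖ 2,
        ← Real.rpow_mul hx0.le, mul_inv, mul_inv]
      norm_num
      rw [mul_div_cancel₀ α two_ne_zero]; ring

/-- Integrability against `outerKer`, with a bound that is uniform in the radius. -/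
lemma MemLAlpha.integrable_mul_outerKer {n : ℕ} [Nontrivial (Euc n)] {α R R₀ η M : ℝ} (hα0 : 0 < α)
    (hα2 : α < 2) (hR : 0 < R) (hR0 : R ≤ R₀) (hη : 0 < η) {v : Euc n → ℝ} (hv : MemLAlpha α v)
    (hM : ∀ x, ‖x‖ ≤ R₀ + η → |v x| ≤ M) :
    Integrable (fun x => v x * outerKer α R x) ∧
    ∫ x, |v x * outerKer α R x| ≤ M / outerConst n α +
      R ^ α * ((1 - (R₀ / (R₀ + η)) ^ 2) ^ (-(α / 2)) *
        ∫ x in {x : Euc n | R₀ + η ≤ ‖x‖}, |v x * kern α x|) := by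
  obtain ⟨hq, hq1⟩ := integral_outerKer (n := n) hα0 hα2 hR
  have hk := outerConst_pos (n := n) hα0 hα2
  have hms := measurableSet_le_norm (n := n) (R₀ + η)
  have hfar := (hv.integrableOn_kern hα0 (by linarith : 0 < R₀ + η)).abs
  have hfar' := IntegrableOn.integrable_indicator hfar hms
  have hM0 : 0 ≤ M := (abs_nonneg _).trans (hM 0 (by simp; linarith))
  set K := (1 - (R₀ / (R₀ + η)) ^ 2) ^ (-(α / 2)) with hK
  have hK0 : 0 ≤ K := by
    apply Real.rpow_nonneg
    have : R₀ / (R₀ + η) ≤ 1 := by rw [div_le_one] <;> linarith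
    have h2 : 0 ≤ R₀ / (R₀ + η) := div_nonneg (by linarith) (by linarith)
    nlinarith
  have hbd : ∀ x, |v x * outerKer α R x| ≤ M * outerKer α R x +
      R ^ α * (K * {x : Euc n | R₀ + η ≤ ‖x‖}.indicator (fun x => |v x * kern α x|) x) := by
    intro x
    have hq0 := outerKer_nonneg (α := α) hR.le x
    rw [abs_mul, abs_of_nonneg hq0]
    by_cases hx : R₀ + η ≤ ‖x‖
    · rw [indicator_of_mem (by exact hx), abs_mul, abs_of_nonneg (kern_nonneg α x)]
      have := mul_le_mul_of_nonneg_left (outerKer_le hα0 hR hR0 hη hx) (abs_nonneg (v x))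
      nlinarith [mul_nonneg hM0 hq0]
    · rw [indicator_of_notMem (by exact hx), mul_zero, mul_zero, add_zero]
      exact mul_le_mul_of_nonneg_right (hM x (not_le.1 hx).le) hq0
  have hdom := (hq.const_mul M).add ((hfar'.const_mul K).const_mul (R ^ α))
  have hint : Integrable (fun x => v x * outerKer α R x) :=
    hdom.mono' (hv.aestronglyMeasurable.mul (measurable_outerKer α R).aestronglyMeasurable)
      (Eventually.of_forall hbd)
  refine ⟨hint, (integral_mono hint.abs hdom hbd).trans (le_of_eq ?_)⟩
  simp only [Pi.add_apply]
  rw [integral_add (hq.const_mul M) ((hfar'.const_mul K).const_mul (R ^ α)), integral_const_mul,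
    integral_const_mul, integral_const_mul, integral_indicator hms]
  congr 1
  rw [eq_div_iff hk.ne']
  linear_combination M * hq1

lemma averageIntegrand_eq {n : ℕ} (α : ℝ) (v : Euc n → ℝ) (R r : ℝ) :
    averageIntegrand α v 0 R r = R ^ α / (r * (r ^ 2 - R ^ 2) ^ (α / 2)) *
      ((sphereMass n)⁻¹ * ∫ ω : Metric.sphere (0 : Euc n) 1, v (r • (ω : Euc n))
        ∂(volume : Measure (Euc n)).toSphere) := by
  simp [averageIntegrand, sphericalAverage, average_eq, sphereMass]

/-- The averages are honest integrals, given by integration against `outerKer`. -/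
lemma fracAverage_eq {n : ℕ} [Nontrivial (Euc n)] {α R : ℝ} (hR : 0 < R)
    {v : Euc n → ℝ} (hv : Integrable (fun x => v x * outerKer α R x)) :
    (∀ᵐ r ∂(volume.restrict (Ioi R)),
      Integrable (fun ω : Metric.sphere (0 : Euc n) 1 => v (r • (ω : Euc n)))
        (volume : Measure (Euc n)).toSphere) ∧
    IntegrableOn (averageIntegrand α v 0 R) (Ioi R) ∧
    fracAverage α v 0 R = outerConst n α * ∫ x, v x * outerKer α R x := by
  have hn := ne_zero_of_nontrivial n
  have hsm := sphereMass_pos (n := n)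
  obtain ⟨h1, h2, h3⟩ := integral_polar hv
  have hsub : Ioi (0 : ℝ) ∩ Ioi R = Ioi R := by
    rw [Ioi_inter_Ioi]; simp [hR.le]
  have hval : ∀ r : ℝ, 0 < r → ∀ ω : Metric.sphere (0 : Euc n) 1,
      outerKer α R (r • (ω : Euc n)) =
        if R < r then R ^ α / (r ^ n * (r ^ 2 - R ^ 2) ^ (α / 2)) else 0 := by
    intro r hr ω
    have : ‖r • (ω : Euc n)‖ = r := by rw [norm_smul, Real.norm_of_nonneg hr.le]; simp
    rw [outerKer, this]
  have hpt : ∀ r ∈ Ioi (0 : ℝ), r ^ (n - 1) * ∫ ω : Metric.sphere (0 : Euc n) 1,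
      v (r • (ω : Euc n)) * outerKer α R (r • (ω : Euc n)) ∂(volume : Measure (Euc n)).toSphere =
      sphereMass n * (Ioi R).indicator (averageIntegrand α v 0 R) r := by
    intro r hr
    simp_rw [hval r hr, integral_mul_const]
    by_cases hRr : R < r
    · have hr0 : 0 < r := hr
      rw [indicator_of_mem (by exact hRr), averageIntegrand_eq, if_pos hRr]
      have hpow : r ^ n = r ^ (n - 1) * r := by rw [← pow_succ, Nat.sub_one_add_one hn]
      rw [hpow]
      field_simp
    · rw [indicator_of_notMem (by exact hRr), if_neg hRr]; simp
  refine ⟨?_, ?_, ?_⟩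
  · have h4 := ae_mono (Measure.restrict_mono (Ioi_subset_Ioi hR.le) le_rfl) h1
    filter_upwards [h4, ae_restrict_mem measurableSet_Ioi] with r hr hRr
    have hr0 : 0 < r := hR.trans hRr
    have hpos : 0 < R ^ α / (r ^ n * (r ^ 2 - R ^ 2) ^ (α / 2)) := by
      have : 0 < r ^ 2 - R ^ 2 := by
        have : R < r := hRr
        nlinarith
      positivity
    simp_rw [hval r hr0, if_pos (show R < r from hRr)] at hr
    refine (hr.mul_const (R ^ α / (r ^ n * (r ^ 2 - R ^ 2) ^ (α / 2)))⁻¹).congr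
      (Eventually.of_forall fun ω => ?_)
    simp only
    rw [mul_assoc, mul_inv_cancel₀ hpos.ne', mul_one]
  · have h4 := h2.congr_fun hpt measurableSet_Ioi
    have h5 := h4.const_mul (sphereMass n)⁻¹
    simp_rw [inv_mul_cancel_left₀ hsm.ne'] at h5
    rw [integrable_indicator_iff measurableSet_Ioi, IntegrableOn,
      Measure.restrict_restrict measurableSet_Ioi, inter_comm, hsub] at h5
    exact h5
  · rw [h3, setIntegral_congr_fun measurableSet_Ioi hpt, integral_const_mul,
      setIntegral_indicator measurableSet_Ioi, hsub, fracAverage, outerConst]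
    field_simp

lemma MemLAlpha.sub_const {n : ℕ} [Nontrivial (Euc n)] {α : ℝ} (hα0 : 0 < α) {v : Euc n → ℝ}
    (hv : MemLAlpha α v) (c : ℝ) : MemLAlpha α (fun x => v x - c) := by
  have := Integrable.sub hv (memLAlpha_const hα0 c)
  refine this.congr (Eventually.of_forall fun x => ?_)
  simp only [Pi.sub_apply]; ring

lemma fracAverage_sub_eq {n : ℕ} [Nontrivial (Euc n)] {α R : ℝ} (hα0 : 0 < α) (hα2 : α < 2)
    (hR : 0 < R) {v : Euc n → ℝ} (hv : Integrable (fun x => v x * outerKer α R x)) (c : ℝ) :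
    fracAverage α v 0 R - c = outerConst n α * ∫ x, (v x - c) * outerKer α R x := by
  obtain ⟨h1, h2⟩ := integral_outerKer (n := n) hα0 hα2 hR
  simp_rw [sub_mul]
  rw [(fracAverage_eq hR hv).2.2, integral_sub hv (h1.const_mul c), integral_const_mul]
  linear_combination c * h2

/-- The average is taken against a probability density: points within R₀ + η contribute at most the
oscillation M, and the rest carries the factor R^α of `outerKer_le`. -/
lemma abs_fracAverage_sub_le {n : ℕ} [Nontrivial (Euc n)] {α R₀ η M : ℝ} (hα0 : 0 < α)
    (hα2 : α < 2) (hη : 0 < η) {v : Euc n → ℝ} (hv : MemLAlpha α v)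
    (c : ℝ) (hM : ∀ x, ‖x‖ ≤ R₀ + η → |v x - c| ≤ M) :
    ∃ K : ℝ, ∀ R, 0 < R → R ≤ R₀ → |fracAverage α v 0 R - c| ≤ M + K * R ^ α := by
  have hk := outerConst_pos (n := n) hα0 hα2
  have hM' : ∀ x, ‖x‖ ≤ R₀ + η → |v x| ≤ M + |c| := fun x hx => by
    have := abs_sub_abs_le_abs_sub (v x) c
    have := hM x hx
    linarith
  refine ⟨outerConst n α * ((1 - (R₀ / (R₀ + η)) ^ 2) ^ (-(α / 2)) *
        ∫ x in {x : Euc n | R₀ + η ≤ ‖x‖}, |(v x - c) * kern α x|), fun R hR hR0 => ?_⟩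
  rw [fracAverage_sub_eq hα0 hα2 hR (hv.integrable_mul_outerKer hα0 hα2 hR hR0 hη hM').1 c,
    abs_mul, abs_of_pos hk]
  have h1 := ((hv.sub_const hα0 c).integrable_mul_outerKer hα0 hα2 hR hR0 hη hM).2
  have h2 := (abs_integral_le_integral_abs (μ := volume)
    (f := fun x => (v x - c) * outerKer α R x)).trans h1
  have h3 := mul_le_mul_of_nonneg_left h2 hk.le
  refine h3.trans (le_of_eq ?_)
  rw [mul_add, mul_div_cancel₀ _ hk.ne']; ring

/-! ### Averages over small balls. -/

/-- The averages over small balls converge to the value at the centre. -/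
lemma tendsto_fracAverage {n : ℕ} [Nontrivial (Euc n)] {α : ℝ} (hα0 : 0 < α) (hα2 : α < 2)
    {v : Euc n → ℝ} (hv : MemLAlpha α v) (hc : ContinuousAt v 0) :
    Tendsto (fracAverage α v 0) (𝓝[>] 0) (𝓝 (v 0)) := by
  rw [Metric.tendsto_nhds]
  intro e he
  rw [Metric.continuousAt_iff] at hc
  obtain ⟨d, hd, hcd⟩ := hc (e / 2) (by positivity)
  obtain ⟨K, hK⟩ := abs_fracAverage_sub_le (R₀ := d / 3) (η := d / 3) (M := e / 2) hα0 hα2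
    (by positivity) hv (v 0) (fun x hx => by
      have := @hcd x (by rw [dist_zero_right]; linarith)
      exact this.le)
  have ht : Tendsto (fun R : ℝ => e / 2 + K * R ^ α) (𝓝[>] 0) (𝓝 (e / 2 + K * 0)) := by
    refine tendsto_const_nhds.add (Tendsto.const_mul K ?_)
    have := (Real.continuousAt_rpow_const 0 α (Or.inr hα0.le)).tendsto
    rw [Real.zero_rpow hα0.ne'] at this
    exact this.mono_left nhdsWithin_le_nhds
  have h1 := ht.eventually (gt_mem_nhds (show e / 2 + K * 0 < e by linarith))
  filter_upwards [h1, Ioo_mem_nhdsGT (show 0 < d / 3 by positivity)] with R hR hR'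
  exact (hK R hR'.1 hR'.2.le).trans_lt hR

/-- Rescaled small averages of a function vanishing to order higher than `α` at the origin. -/
lemma tendsto_integral_outerKer {n : ℕ} [Nontrivial (Euc n)] {α σ η C : ℝ} (hα0 : 0 < α)
    (hα2 : α < 2) (hσ : 0 < σ) (hη : 0 < η) (hC : 0 ≤ C) {D : Euc n → ℝ}
    (hD : Integrable (fun h => D h * kern α h))
    (hDm : AEStronglyMeasurable D)
    (hDb : ∀ h, ‖h‖ < η → |D h| ≤ C * ‖h‖ ^ (α + σ))
    (hDq : ∀ R, 0 < R → R < η / 2 → Integrable (fun h => D h * outerKer α R h)) :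
    Tendsto (fun R => R ^ (-α) * ∫ h, D h * outerKer α R h) (𝓝[>] 0) (𝓝 (∫ h, D h * kern α h)) := by
  have hk := outerConst_pos (n := n) hα0 hα2
  -- Beyond |h| = 2R, the kernel R^(-α) `outerKer α R` is at most a fixed multiple of `kern α`, so
  -- dominated convergence applies there.
  set far : ℝ → Set (Euc n) := fun R => {h | R + R ≤ ‖h‖} with hfar
  have hfm : ∀ R, MeasurableSet (far R) := fun R => measurableSet_le_norm _
  have hsplit : ∀ᶠ R in 𝓝[>] (0 : ℝ), (∫ h in (far R)ᶜ, R ^ (-α) * (D h * outerKer α R h)) +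
      ∫ h, (far R).indicator (fun h => R ^ (-α) * (D h * outerKer α R h)) h =
      R ^ (-α) * ∫ h, D h * outerKer α R h := by
    filter_upwards [Ioo_mem_nhdsGT (show 0 < η / 2 by positivity)] with R hR
    rw [integral_indicator (hfm R), add_comm,
      integral_add_compl (hfm R) ((hDq R hR.1 hR.2).const_mul _), integral_const_mul]
  refine Tendsto.congr' hsplit ?_
  rw [← zero_add (∫ h, D h * kern α h)]
  refine Tendsto.add ?_ ?_
  -- Near part: |D| ≤ C (2R)^(α+σ) and the mass of `outerKer` is independent of R, so O(R^σ) remains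
  -- after the rescaling.
  · have hb : ∀ᶠ R in 𝓝[>] (0 : ℝ), ‖∫ h in (far R)ᶜ, R ^ (-α) * (D h * outerKer α R h)‖ ≤
        C * 2 ^ (α + σ) / outerConst n α * R ^ σ := by
      filter_upwards [Ioo_mem_nhdsGT (show 0 < η / 2 by positivity)] with R hR
      have hR0 : 0 < R := hR.1
      obtain ⟨hq1, hq2⟩ := integral_outerKer (n := n) hα0 hα2 hR0
      have hpt : ∀ h ∈ (far R)ᶜ, ‖R ^ (-α) * (D h * outerKer α R h)‖ ≤
          C * 2 ^ (α + σ) * R ^ σ * outerKer α R h := by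
        intro h hh
        have hlt : ‖h‖ < R + R := not_le.1 hh
        have h1 : |D h| ≤ C * (2 * R) ^ (α + σ) := by
          refine (hDb h (by linarith [hR.2])).trans ?_
          gcongr; linarith
        rw [Real.norm_eq_abs, abs_mul, abs_mul, abs_of_nonneg (outerKer_nonneg hR0.le h),
          abs_of_pos (by positivity : 0 < R ^ (-α))]
        have h2 : R ^ (-α) * (C * (2 * R) ^ (α + σ)) = C * 2 ^ (α + σ) * R ^ σ := by
          rw [Real.mul_rpow (by norm_num) hR0.le, Real.rpow_add hR0, Real.rpow_neg hR0.le]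
          have : R ^ α ≠ 0 := by positivity
          field_simp
        rw [← mul_assoc, ← h2]
        have := outerKer_nonneg (α := α) hR0.le h
        gcongr
      calc _ ≤ ∫ h in (far R)ᶜ, C * 2 ^ (α + σ) * R ^ σ * outerKer α R h :=
            norm_integral_le_of_norm_le (hq1.const_mul _).integrableOn
              ((ae_restrict_iff' (hfm R).compl).2 (Eventually.of_forall hpt))
        _ ≤ ∫ h, C * 2 ^ (α + σ) * R ^ σ * outerKer α R h := by
            refine setIntegral_le_integral (hq1.const_mul _) (Eventually.of_forall fun h => ?_)
            have := outerKer_nonneg (α := α) hR0.le h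
            simp only [Pi.zero_apply]; positivity
        _ = _ := by
            rw [integral_const_mul]
            have : ∫ h : Euc n, outerKer α R h = 1 / outerConst n α := by
              rw [eq_div_iff hk.ne', mul_comm]; exact hq2
            rw [this]; ring
    refine squeeze_zero_norm' hb ?_
    have := (Real.continuousAt_rpow_const 0 σ (Or.inr hσ.le)).tendsto
    rw [Real.zero_rpow hσ.ne'] at this
    simpa using (this.mono_left (nhdsWithin_le_nhds (s := Ioi 0))).const_mul
      (C * 2 ^ (α + σ) / outerConst n α)
  · refine tendsto_integral_filter_of_dominated_convergence
      (fun h => (1 - (1 / 2 : ℝ) ^ 2) ^ (-(α / 2)) * |D h * kern α h|) ?_ ?_ (hD.abs.const_mul _) ?_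
    · filter_upwards with R
      exact ((hDm.mul (measurable_outerKer α R).aestronglyMeasurable).const_mul _).indicator (hfm R)
    · filter_upwards [self_mem_nhdsWithin] with R hR
      have hR0 : 0 < R := hR
      filter_upwards with h
      by_cases hh : h ∈ far R
      · rw [indicator_of_mem hh, Real.norm_eq_abs, abs_mul, abs_mul, abs_mul,
          abs_of_nonneg (outerKer_nonneg hR0.le h), abs_of_nonneg (kern_nonneg α h),
          abs_of_pos (by positivity : 0 < R ^ (-α))]
        have h1 := outerKer_le hα0 hR0 le_rfl hR0 hh
        rw [show R / (R + R) = 1 / 2 by field_simp; norm_num] at h1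
        calc R ^ (-α) * (|D h| * outerKer α R h) ≤ R ^ (-α) * (|D h| *
              (R ^ α * (1 - (1 / 2 : ℝ) ^ 2) ^ (-(α / 2)) * kern α h)) := by gcongr
          _ = (R ^ (-α) * R ^ α) * ((1 - (1 / 2 : ℝ) ^ 2) ^ (-(α / 2)) * (|D h| * kern α h)) := by ring
          _ = _ := by rw [← Real.rpow_add hR0]; simp
      · rw [indicator_of_notMem hh, norm_zero]
        have : (0 : ℝ) ≤ (1 - (1 / 2 : ℝ) ^ 2) ^ (-(α / 2)) := by positivity
        positivity
    · filter_upwards [Measure.ae_ne volume (0 : Euc n)] with h hh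
      have hp : 0 < ‖h‖ := norm_pos_iff.2 hh
      have hlim : Tendsto (fun R : ℝ => D h * ((‖h‖ ^ n)⁻¹ * (‖h‖ ^ 2 - R ^ 2) ^ (-(α / 2))))
          (𝓝[>] 0) (𝓝 (D h * ((‖h‖ ^ n)⁻¹ * (‖h‖ ^ 2 - 0 ^ 2) ^ (-(α / 2))))) := by
        refine Tendsto.mono_left (ContinuousAt.tendsto (f := fun R : ℝ =>
          D h * ((‖h‖ ^ n)⁻¹ * (‖h‖ ^ 2 - R ^ 2) ^ (-(α / 2)))) ?_) nhdsWithin_le_nhds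
        refine continuousAt_const.mul (continuousAt_const.mul ?_)
        refine ContinuousAt.rpow_const (by fun_prop) (Or.inl ?_)
        simp [hp.ne']
      have hkern : (‖h‖ ^ n)⁻¹ * (‖h‖ ^ 2 - 0 ^ 2) ^ (-(α / 2)) = kern α h := by
        rw [kern, neg_add, Real.rpow_add hp, Real.rpow_neg hp.le, Real.rpow_natCast]
        rw [← Real.rpow_natCast ‖h‖ 2]
        rw [zero_pow two_ne_zero, sub_zero, ← Real.rpow_mul hp.le]
        congr 2; push_cast; ring
      rw [hkern] at hlim
      refine hlim.congr' ?_
      filter_upwards [Ioo_mem_nhdsGT (show 0 < ‖h‖ / 2 by positivity)] with R hR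
      have hR0 : 0 < R := hR.1
      have hlt : R < ‖h‖ := by linarith [hR.2]
      rw [indicator_of_mem (show h ∈ far R from (by linarith [hR.2] : R + R ≤ ‖h‖)), outerKer, if_pos hlt]
      have : 0 < ‖h‖ ^ 2 - R ^ 2 := by nlinarith
      rw [Real.rpow_neg this.le, Real.rpow_neg hR0.le]
      have h2 : R ^ α ≠ 0 := by positivity
      have h3 : (‖h‖ ^ 2 - R ^ 2) ^ (α / 2) ≠ 0 := by positivity
      field_simp

/-- If all small averages agree with the value at the centre, the singular integral vanishes. -/
lemma integral_secondDiff_eq_zero_of_fracAverage {n : ℕ} [Nontrivial (Euc n)] {α σ η C M R₁ : ℝ}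
    (hα0 : 0 < α) (hα2 : α < 2) (hσ : 0 < σ) (hη : 0 < η) (hC : 0 ≤ C) (hR₁ : 0 < R₁)
    {v : Euc n → ℝ} (hv : MemLAlpha α v) (hM : ∀ x, ‖x‖ ≤ η → |v x| ≤ M)
    (hsd : ∀ h, ‖h‖ < η → |secondDiff v 0 h| ≤ C * ‖h‖ ^ (α + σ))
    (hA : ∀ R, 0 < R → R < R₁ → v 0 = fracAverage α v 0 R) :
    ∫ h, secondDiff v 0 h * kern α h = 0 := by
  have hi := integrable_secondDiff_kern hα0 hσ hη hC hv hsd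
  have hvq : ∀ R, 0 < R → R < η / 2 → Integrable (fun h => (v h - v 0) * outerKer α R h) := by
    intro R h0 h1
    refine ((hv.sub_const hα0 (v 0)).integrable_mul_outerKer (R₀ := η / 2) (η := η / 2)
      (M := M + M) hα0 hα2 h0 h1.le (by positivity) (fun x hx => ?_)).1
    have h2 := hM x (by linarith)
    have h3 := hM 0 (by simp [hη.le])
    exact (abs_sub _ _).trans (add_le_add h2 h3)
  have hneg : ∀ R (h : Euc n), outerKer α R (-h) = outerKer α R h := by simp [outerKer]
  -- The kernel is even, so D integrates to minus twice the integral of v - v(0), which vanishes by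
  -- the mean value property.
  have heq : ∀ R (h : Euc n), secondDiff v 0 h * outerKer α R h =
      -((v h - v 0) * outerKer α R h) + -((v (-h) - v 0) * outerKer α R (-h)) := by
    intro R h; rw [hneg]; simp [secondDiff]; ring
  have hDq : ∀ R, 0 < R → R < η / 2 → Integrable (fun h => secondDiff v 0 h * outerKer α R h) := by
    intro R h0 h1
    simp_rw [heq]
    exact (hvq R h0 h1).neg.add (hvq R h0 h1).comp_neg.neg
  have ht := tendsto_integral_outerKer hα0 hα2 hσ hη hC hi
    (aestronglyMeasurable_secondDiff hv.aestronglyMeasurable 0) hsd hDq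
  refine tendsto_nhds_unique ht (tendsto_const_nhds.congr' ?_)
  filter_upwards [Ioo_mem_nhdsGT (show 0 < min (η / 2) R₁ by positivity)] with R hR
  have hR0 : 0 < R := hR.1
  have hRη : R < η / 2 := hR.2.trans_le (min_le_left _ _)
  have hk := outerConst_pos (n := n) hα0 hα2
  have hvi : Integrable (fun x => v x * outerKer α R x) :=
    (hv.integrable_mul_outerKer (R₀ := η / 2) (η := η / 2) (M := M) hα0 hα2 hR0 hRη.le
      (by positivity) (fun x hx => hM x (by linarith))).1
  have h1 := fracAverage_sub_eq hα0 hα2 hR0 hvi (v 0)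
  rw [← hA R hR0 (hR.2.trans_le (min_le_right _ _)), sub_self] at h1
  have h2 : ∫ x, (v x - v 0) * outerKer α R x = 0 := by
    rcases mul_eq_zero.1 h1.symm with h | h
    · exact absurd h hk.ne'
    · exact h
  simp_rw [heq]
  have h3 : ∫ h, (v (-h) - v 0) * outerKer α R (-h) = 0 :=
    (integral_neg_eq_self (fun h => (v h - v 0) * outerKer α R h) volume).trans h2
  have h4 := integral_add (hvq R hR0 hRη).neg (hvq R hR0 hRη).comp_neg.neg
  simp only [Pi.neg_apply] at h4
  rw [h4, integral_neg, integral_neg, h2, h3]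
  simp

/-! ### The torsion profile and its second differences. -/

/-- The torsion-type profile `(R² - |x|²)₊^(α/2)`. -/
noncomputable def torsion {n : ℕ} (α R : ℝ) (x : Euc n) : ℝ := (max (R ^ 2 - ‖x‖ ^ 2) 0) ^ (α / 2)

lemma torsion_nonneg {n : ℕ} (α R : ℝ) (x : Euc n) : 0 ≤ torsion α R x := by
  unfold torsion; positivity

lemma torsion_eq_zero {n : ℕ} {α R : ℝ} (hα : 0 < α) (hR : 0 ≤ R) {x : Euc n} (hx : R ≤ ‖x‖) :
    torsion α R x = 0 := by
  rw [torsion, max_eq_right (by nlinarith), Real.zero_rpow (by positivity)]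

@[fun_prop]
lemma measurable_torsion {n : ℕ} (α R : ℝ) : Measurable (torsion α R : Euc n → ℝ) := by
  unfold torsion; fun_prop

lemma torsion_le {n : ℕ} {α R : ℝ} (hα : 0 < α) (x : Euc n) :
    torsion α R x ≤ (R ^ 2) ^ (α / 2) := by
  unfold torsion
  gcongr
  exact max_le (by nlinarith [sq_nonneg ‖x‖]) (by positivity)

/-- The factor 4Rs comes from R² - |x|² = (R - |x|)(R + |x|) ≤ 2s · 2R inside the ball. -/
lemma torsion_le_of_le {n : ℕ} {α R s : ℝ} (hα : 0 < α) (hR : 0 < R) (hs : 0 ≤ s) {x : Euc n}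
    (hx : R - 2 * s ≤ ‖x‖) : torsion α R x ≤ (4 * R * s) ^ (α / 2) := by
  unfold torsion
  gcongr
  refine max_le ?_ (by positivity)
  rcases le_total R ‖x‖ with h | h
  · nlinarith [mul_nonneg hR.le hs]
  · nlinarith [mul_nonneg hR.le hs, norm_nonneg x]

lemma MemLAlpha.integrable_torsion_mul {n : ℕ} {α : ℝ} (hα : 0 < α) {R : ℝ} (hR : 0 ≤ R)
    {v : Euc n → ℝ} (hv : MemLAlpha α v) : Integrable (fun x => torsion α R x * v x) := by
  have h1 : IntegrableOn (fun x => torsion α R x * v x) (Metric.closedBall 0 R) := by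
    refine (hv.locallyIntegrable hα R).norm.const_mul ((R ^ 2) ^ (α / 2)) |>.mono' ?_ ?_
    · exact ((measurable_torsion α R).aestronglyMeasurable.mul hv.aestronglyMeasurable).restrict
    · refine Eventually.of_forall fun x => ?_
      rw [norm_mul, Real.norm_of_nonneg (torsion_nonneg α R x)]
      exact mul_le_mul_of_nonneg_right (torsion_le hα x) (norm_nonneg _)
  refine (integrableOn_iff_integrable_of_support_subset ?_).1 h1
  intro x hx
  rw [mem_closedBall_zero_iff]
  by_contra hlt
  exact hx (by simp [torsion_eq_zero hα hR (not_le.1 hlt).le])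

lemma integrable_torsion {n : ℕ} [Nontrivial (Euc n)] {α : ℝ} (hα : 0 < α) {R : ℝ} (hR : 0 ≤ R) :
    Integrable (torsion α R : Euc n → ℝ) := by
  simpa using (memLAlpha_const (n := n) hα 1).integrable_torsion_mul hα hR

/-- The torsion profile is midpoint concave in the ball. -/
lemma secondDiff_torsion_nonneg {n : ℕ} {α R : ℝ} (hα0 : 0 < α) (hα2 : α < 2) {x h : Euc n}
    (hx : ‖x‖ + ‖h‖ ≤ R) : 0 ≤ secondDiff (torsion α R) x h := by
  have h1 : ‖x + h‖ ≤ R := (norm_add_le x h).trans hx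
  have h2 : ‖x - h‖ ≤ R := (norm_sub_le x h).trans hx
  have hx0 : ‖x‖ ≤ R := by linarith [norm_nonneg h]
  have a1 : 0 ≤ R ^ 2 - ‖x + h‖ ^ 2 := by nlinarith [norm_nonneg (x + h)]
  have a2 : 0 ≤ R ^ 2 - ‖x - h‖ ^ 2 := by nlinarith [norm_nonneg (x - h)]
  have a0 : 0 ≤ R ^ 2 - ‖x‖ ^ 2 := by nlinarith [norm_nonneg x]
  have hp := parallelogram_law_with_norm ℝ x h
  have hc := (Real.concaveOn_rpow (p := α / 2) (by linarith) (by linarith)).2 a1 a2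
    (by norm_num : (0 : ℝ) ≤ 1 / 2) (by norm_num : (0 : ℝ) ≤ 1 / 2) (by norm_num)
  simp only [smul_eq_mul] at hc
  have hm : (1 / 2 * (R ^ 2 - ‖x + h‖ ^ 2) + 1 / 2 * (R ^ 2 - ‖x - h‖ ^ 2)) ^ (α / 2) ≤
      (R ^ 2 - ‖x‖ ^ 2) ^ (α / 2) := by
    apply Real.rpow_le_rpow (by positivity) _ (by positivity)
    nlinarith [norm_nonneg h]
  simp only [secondDiff, torsion, max_eq_left a0, max_eq_left a1, max_eq_left a2]
  linarith

lemma integrable_secondDiff_torsion {n : ℕ} [Nontrivial (Euc n)] {α : ℝ} (hα : 0 < α) {R : ℝ}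
    (hR : 0 ≤ R) (h : Euc n) : Integrable (fun x => secondDiff (torsion α R) x h) := by
  have hi := integrable_torsion (n := n) hα hR
  exact ((hi.const_mul 2).sub (hi.comp_add_right h)).sub (hi.comp_sub_right h)

lemma integral_secondDiff_torsion {n : ℕ} [Nontrivial (Euc n)] {α : ℝ} (hα : 0 < α) {R : ℝ}
    (hR : 0 ≤ R) (h : Euc n) : ∫ x, secondDiff (torsion α R) x h = 0 := by
  have hi := integrable_torsion (n := n) hα hR
  have h1 := integral_sub ((hi.const_mul 2).sub (hi.comp_add_right h)) (hi.comp_sub_right h)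
  have h2 := integral_sub (hi.const_mul 2) (hi.comp_add_right h)
  simp only [Pi.sub_apply] at h1
  simp only [secondDiff]
  rw [h1, h2, integral_const_mul, integral_add_right_eq_self (torsion α R : Euc n → ℝ),
    integral_sub_right_eq_self (torsion α R : Euc n → ℝ)]
  ring

lemma abs_secondDiff_torsion_le {n : ℕ} (α R : ℝ) (x h : Euc n) :
    |secondDiff (torsion α R) x h| ≤
      2 * torsion α R x + torsion α R (x + h) + torsion α R (x - h) := by
  have h0 := torsion_nonneg α R x
  have h1 := torsion_nonneg α R (x + h)
  have h2 := torsion_nonneg α R (x - h)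
  rw [secondDiff, abs_le]; constructor <;> linarith

lemma exists_measure_annulus_le {n : ℕ} [Nontrivial (Euc n)] {R : ℝ} (hR : 0 < R) :
    ∃ K : ℝ, 0 ≤ K ∧ ∀ s, 0 ≤ s → s ≤ R →
      volume.real (Metric.ball (0 : Euc n) (R + s) \ Metric.ball 0 (R - s)) ≤ K * s := by
  refine ⟨2 * n * (2 * R) ^ (n - 1) * volume.real (Metric.ball (0 : Euc n) 1), by positivity,
    fun s hs hsR => ?_⟩
  rw [measureReal_sdiff (Metric.ball_subset_ball (by linarith)) measurableSet_ball]
  rw [measureReal_def, measureReal_def, Measure.addHaar_ball _ _ (by linarith : 0 ≤ R + s),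
    Measure.addHaar_ball _ _ (by linarith : 0 ≤ R - s), ENNReal.toReal_mul, ENNReal.toReal_mul,
    ENNReal.toReal_ofReal (by positivity), ENNReal.toReal_ofReal (by
      have : 0 ≤ R - s := by linarith
      positivity), finrank_euclideanSpace_fin, ← sub_mul, ← measureReal_def]
  have h1 : (R + s) ^ n - (R - s) ^ n ≤ 2 * n * (2 * R) ^ (n - 1) * s := by
    refine (le_abs_self _).trans ((abs_pow_sub_pow_le _ _ n).trans ?_)
    rw [show R + s - (R - s) = 2 * s by ring, abs_of_nonneg (by linarith : 0 ≤ 2 * s),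
      abs_of_nonneg (by linarith : 0 ≤ R + s), abs_of_nonneg (by linarith : 0 ≤ R - s),
      max_eq_left (by linarith)]
    have : (R + s) ^ (n - 1) ≤ (2 * R) ^ (n - 1) := by
      gcongr; linarith
    calc 2 * s * n * (R + s) ^ (n - 1) ≤ 2 * s * n * (2 * R) ^ (n - 1) := by gcongr
      _ = _ := by ring
  calc _ ≤ 2 * n * (2 * R) ^ (n - 1) * s * volume.real (Metric.ball (0 : Euc n) 1) := by gcongr
    _ = _ := by ring

/-- The `L¹` modulus of smoothness of the torsion profile. -/
lemma exists_integral_abs_secondDiff_torsion_le {n : ℕ} [Nontrivial (Euc n)] {α R : ℝ}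
    (hα0 : 0 < α) (hα2 : α < 2) (hR : 0 < R) :
    ∃ K : ℝ, (∀ h : Euc n, ‖h‖ < R →
      ∫ x, |secondDiff (torsion α R) x h| ≤ K * ‖h‖ ^ (1 + α / 2)) ∧
      ∀ h : Euc n, ∫ x, |secondDiff (torsion α R) x h| ≤ K := by
  obtain ⟨K, hK0, hK⟩ := exists_measure_annulus_le (n := n) hR
  have hi := integrable_torsion (n := n) hα0 hR.le
  refine ⟨max (8 * (4 * R) ^ (α / 2) * K) (4 * ∫ x : Euc n, torsion α R x), ?_, ?_⟩
  · intro h hh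
    set s := ‖h‖ with hs
    have hs0 : 0 ≤ s := norm_nonneg h
    set Ann := Metric.ball (0 : Euc n) (R + s) \ Metric.ball 0 (R - s) with hAnn
    have hAm : MeasurableSet Ann := measurableSet_ball.diff measurableSet_ball
    have hAf : volume Ann ≠ ⊤ :=
      ne_top_of_le_ne_top measure_ball_lt_top.ne (measure_mono sdiff_subset)
    -- By concavity the second difference can be negative only in the annulus of half-width s around
    -- the sphere. There |D| - D ≤ 2|D|, and D has total coefficient 4 on values at most
    -- (4Rs)^(α/2). Since D has integral zero, only this annular term, of measure O(s), survives
    -- integration.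
    have hbd : ∀ x, |secondDiff (torsion α R) x h| ≤ secondDiff (torsion α R) x h +
        Ann.indicator (fun _ => 8 * (4 * R * s) ^ (α / 2)) x := by
      intro x
      by_cases hx : x ∈ Ann
      · rw [indicator_of_mem hx]
        have hx1 : R - s ≤ ‖x‖ := by
          have := hx.2
          rw [mem_ball_zero_iff] at this; linarith
        have t0 := torsion_le_of_le (x := x) hα0 hR hs0 (by linarith)
        have t1 := torsion_le_of_le (x := x + h) hα0 hR hs0 (by
          have := norm_sub_le (x + h) h; rw [add_sub_cancel_right] at this; linarith)
        have t2 := torsion_le_of_le (x := x - h) hα0 hR hs0 (by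
          have := norm_add_le (x - h) h; rw [sub_add_cancel] at this; linarith)
        have := abs_secondDiff_torsion_le α R x h
        have := neg_abs_le (secondDiff (torsion α R) x h)
        linarith
      · rw [indicator_of_notMem hx, add_zero]
        by_cases hxR : ‖x‖ < R + s
        · have : ‖x‖ < R - s := by
            by_contra hcon
            exact hx ⟨mem_ball_zero_iff.2 hxR, fun hb => hcon (mem_ball_zero_iff.1 hb)⟩
          rw [abs_of_nonneg (secondDiff_torsion_nonneg hα0 hα2 (by linarith))]
        · have e0 := torsion_eq_zero (x := x) hα0 hR.le (by linarith)
          have e1 := torsion_eq_zero (x := x + h) hα0 hR.le (by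
            have := norm_sub_le (x + h) h; rw [add_sub_cancel_right] at this; linarith)
          have e2 := torsion_eq_zero (x := x - h) hα0 hR.le (by
            have := norm_add_le (x - h) h; rw [sub_add_cancel] at this; linarith)
          simp [secondDiff, e0, e1, e2]
    have hci : Integrable (Ann.indicator (fun _ : Euc n => 8 * (4 * R * s) ^ (α / 2))) :=
      (integrable_indicator_iff hAm).2 (integrableOn_const hAf)
    have hsd := integrable_secondDiff_torsion (n := n) hα0 hR.le h
    refine (integral_mono hsd.abs (hsd.add hci) hbd).trans ?_
    simp only [Pi.add_apply]
    rw [integral_add hsd hci, integral_secondDiff_torsion hα0 hR.le, zero_add,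
      integral_indicator hAm, setIntegral_const, smul_eq_mul]
    calc volume.real Ann * (8 * (4 * R * s) ^ (α / 2)) ≤ K * s * (8 * (4 * R * s) ^ (α / 2)) := by
          gcongr; exact hK s hs0 hh.le
      _ = 8 * (4 * R) ^ (α / 2) * K * s ^ (1 + α / 2) := by
          rw [Real.mul_rpow (by positivity) hs0, Real.rpow_add_of_nonneg hs0 (by norm_num)
            (by positivity), Real.rpow_one]; ring
      _ ≤ _ := by gcongr; exact le_max_left _ _
  · intro h
    refine le_trans ?_ (le_max_right _ _)
    refine (integral_mono (integrable_secondDiff_torsion (n := n) hα0 hR.le h).abs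
      (((hi.const_mul 2).add (hi.comp_add_right h)).add (hi.comp_sub_right h))
      (fun x => abs_secondDiff_torsion_le α R x h)).trans (le_of_eq ?_)
    have h1 := integral_add ((hi.const_mul 2).add (hi.comp_add_right h)) (hi.comp_sub_right h)
    have h2 := integral_add (hi.const_mul 2) (hi.comp_add_right h)
    simp only [Pi.add_apply] at h1 h2 ⊢
    rw [h1, h2, integral_const_mul, integral_add_right_eq_self (torsion α R : Euc n → ℝ),
      integral_sub_right_eq_self (torsion α R : Euc n → ℝ)]
    ring

lemma measurable_secondDiff_torsion {n : ℕ} (α R : ℝ) :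
    Measurable (fun p : Euc n × Euc n => secondDiff (torsion α R) p.1 p.2) := by
  have h := measurable_torsion (n := n) α R
  unfold secondDiff
  exact (((h.comp measurable_fst).const_mul 2).sub (h.comp (measurable_fst.add measurable_snd))).sub
    (h.comp (measurable_fst.sub measurable_snd))

/-- The second differences of the torsion profile are integrable against the singular kernel. -/
lemma integrable_prod_secondDiff_torsion {n : ℕ} [Nontrivial (Euc n)] {α R : ℝ}
    (hα0 : 0 < α) (hα2 : α < 2) (hR : 0 < R) :
    Integrable (fun p : Euc n × Euc n => secondDiff (torsion α R) p.1 p.2 * kern α p.2)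
      (volume.prod volume) := by
  obtain ⟨K, hK1, hK2⟩ := exists_integral_abs_secondDiff_torsion_le (n := n) hα0 hα2 hR
  have hm : AEStronglyMeasurable
      (fun p : Euc n × Euc n => secondDiff (torsion α R) p.1 p.2 * kern α p.2)
      (volume.prod volume) :=
    ((measurable_secondDiff_torsion α R).mul
      ((measurable_kern α).comp measurable_snd)).aestronglyMeasurable
  rw [integrable_prod_iff' hm]
  refine ⟨Eventually.of_forall fun h =>
    (integrable_secondDiff_torsion hα0 hR.le h).mul_const (kern α h), ?_⟩
  have hval : ∀ h : Euc n, ∫ x, ‖secondDiff (torsion α R) x h * kern α h‖ =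
      (∫ x, |secondDiff (torsion α R) x h|) * kern α h := by
    intro h
    simp_rw [norm_mul, Real.norm_of_nonneg (kern_nonneg α h), Real.norm_eq_abs]
    rw [integral_mul_const]
  have hm2 := hm.norm.prod_swap.integral_prod_right'
  -- The value of σ is determined by α + σ = 1 + α/2, the exponent of the L¹ modulus; it is positive
  -- because α < 2.
  refine integrable_of_kernel_bound (α := α) (σ := 1 - α / 2) (η := R) (C := K) hα0 (by linarith)
    hR hm2 ?_ ?_
  · intro h hh
    simp only
    rw [hval, abs_of_nonneg (mul_nonneg (integral_nonneg fun x => abs_nonneg _) (kern_nonneg α h))]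
    refine (mul_le_mul_of_nonneg_right (hK1 h hh) (kern_nonneg α h)).trans ?_
    have hK0 : 0 ≤ K := (integral_nonneg fun x => abs_nonneg _).trans (hK2 0)
    rcases eq_or_ne h 0 with rfl | h0
    · rw [norm_zero, Real.zero_rpow (by positivity), mul_zero, zero_mul]; positivity
    · have hp : 0 < ‖h‖ := norm_pos_iff.2 h0
      rw [kern, mul_assoc, ← Real.rpow_add hp]
      apply le_of_eq; congr 2; ring
  · intro h hh
    simp only
    rw [hval, abs_of_nonneg (mul_nonneg (integral_nonneg fun x => abs_nonneg _) (kern_nonneg α h))]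
    exact mul_le_mul_of_nonneg_right (hK2 h) (kern_nonneg α h)

/-! ### Symmetry of the singular integral against the torsion profile. -/

lemma integrable_prod_add {n : ℕ} {f g : Euc n → ℝ} (hf : Integrable f) (hg : Integrable g) :
    Integrable (fun p : Euc n × Euc n => f p.1 * g (p.1 + p.2)) (volume.prod volume) :=
  (measurePreserving_prod_add (volume : Measure (Euc n)) (volume : Measure (Euc n))
    ).integrable_comp_of_integrable (hf.mul_prod hg)

lemma integrable_prod_sub {n : ℕ} {f g : Euc n → ℝ} (hf : Integrable f) (hg : Integrable g) :
    Integrable (fun p : Euc n × Euc n => f p.1 * g (p.1 - p.2)) (volume.prod volume) := by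
  have h1 := integrable_prod_add hf hg
  have h2 : MeasurePreserving (fun p : Euc n × Euc n => (p.1, -p.2))
      (volume.prod volume) (volume.prod volume) :=
    (MeasurePreserving.id volume).prod (Measure.measurePreserving_neg volume)
  have h3 := h2.integrable_comp_of_integrable h1
  refine h3.congr (Eventually.of_forall fun p => ?_)
  simp [sub_eq_add_neg]

/-- For base points in a fixed ball and steps bounded below, the kernel is dominated by the
`MemLAlpha` weight at the endpoint, uniformly in the base point. -/
lemma exists_kern_le_shift {n : ℕ} {α η R : ℝ} (hα : 0 < α) (hη : 0 < η) (hR : 0 ≤ R) :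
    ∃ c : ℝ, 0 ≤ c ∧ ∀ y h : Euc n, ‖y‖ ≤ R → η ≤ ‖h‖ →
      kern α h ≤ c * (1 + ‖y + h‖ ^ ((n : ℝ) + α))⁻¹ := by
  have hs : 0 < (n : ℝ) + α := by positivity
  refine ⟨(1 + η ^ (-((n : ℝ) + α))) * (1 + 2 ^ ((n : ℝ) + α) * (1 + R ^ ((n : ℝ) + α))),
    by positivity, fun y h hy hh => ?_⟩
  have h1 := one_add_rpow_norm_add_le hs h y
  have h2 : (1 + 2 ^ ((n : ℝ) + α) * (1 + ‖y‖ ^ ((n : ℝ) + α))) ≤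
    (1 + 2 ^ ((n : ℝ) + α) * (1 + R ^ ((n : ℝ) + α))) := by gcongr
  have h3 : 0 < 1 + ‖h‖ ^ ((n : ℝ) + α) := by positivity
  have h4 : 0 < 1 + ‖y + h‖ ^ ((n : ℝ) + α) := by positivity
  refine (kern_le hα hη hh).trans ?_
  rw [mul_assoc]
  refine mul_le_mul_of_nonneg_left ?_ (by positivity)
  rw [← div_eq_mul_inv, le_div_iff₀ h4, inv_mul_le_iff₀ h3, mul_comm]
  exact h1.trans (mul_le_mul_of_nonneg_right h2 h3.le)

lemma aestronglyMeasurable_secondDiff_prod {n : ℕ} {v : Euc n → ℝ} (hv : AEStronglyMeasurable v) :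
    AEStronglyMeasurable (fun p : Euc n × Euc n => secondDiff v p.1 p.2) (volume.prod volume) := by
  have hadd : AEStronglyMeasurable (fun p : Euc n × Euc n => v (p.1 + p.2)) (volume.prod volume) :=
    (hv.comp_snd (μ := volume)).comp_measurePreserving
      (measurePreserving_prod_add (volume : Measure (Euc n)) (volume : Measure (Euc n)))
  have h2 : MeasurePreserving (fun p : Euc n × Euc n => (p.1, -p.2))
      (volume.prod volume) (volume.prod volume) :=
    (MeasurePreserving.id volume).prod (Measure.measurePreserving_neg volume)
  have hsub : AEStronglyMeasurable (fun p : Euc n × Euc n => v (p.1 - p.2)) (volume.prod volume) := by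
    refine (hadd.comp_measurePreserving h2).congr (Eventually.of_forall fun p => ?_)
    simp [sub_eq_add_neg]
  exact ((hv.comp_fst.const_mul 2).sub hadd).sub hsub

/-- Symmetry of the fractional Laplacian against the torsion profile of a ball. -/
theorem integral_torsion_mul_eq {n : ℕ} [Nontrivial (Euc n)] {α σ R η C M : ℝ} (hα0 : 0 < α)
    (hα2 : α < 2) (hσ : 0 < σ) (hR : 0 < R) (hη : 0 < η) (hC : 0 ≤ C) {v : Euc n → ℝ}
    (hv : MemLAlpha α v) (hM : ∀ x, ‖x‖ ≤ R + η → |v x| ≤ M)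
    (hsd : ∀ x h, ‖x‖ ≤ R → ‖h‖ < η → |secondDiff v x h| ≤ C * ‖h‖ ^ (α + σ)) :
    Integrable (fun x => v x * ∫ h, secondDiff (torsion α R) x h * kern α h) ∧
    ∫ x, torsion α R x * ∫ h, secondDiff v x h * kern α h =
      ∫ x, v x * ∫ h, secondDiff (torsion α R) x h * kern α h := by
  set w : Euc n → ℝ := fun x => |v x / (1 + ‖x‖ ^ ((n : ℝ) + α))| with hw
  have hwi : Integrable w := Integrable.abs hv
  have hw0 : ∀ x, 0 ≤ w x := fun x => abs_nonneg _
  have hτi := integrable_torsion (n := n) hα0 hR.le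
  have hM0 : 0 ≤ M := (abs_nonneg _).trans (hM 0 (by simp; linarith))
  obtain ⟨c, hc0, hc⟩ := exists_kern_le_shift (n := n) hα0 hη hR.le
  have hvw : ∀ x k, k ≤ c * (1 + ‖x‖ ^ ((n : ℝ) + α))⁻¹ → |v x| * k ≤ c * w x := by
    intro x k hk
    have h3 : 0 < 1 + ‖x‖ ^ ((n : ℝ) + α) := by positivity
    refine (mul_le_mul_of_nonneg_left hk (abs_nonneg _)).trans (le_of_eq ?_)
    simp only [hw]; rw [abs_div, abs_of_pos h3]; ring
  have hc' : ∀ y h : Euc n, ‖y‖ ≤ R → η ≤ ‖h‖ →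
      kern α h ≤ c * (1 + ‖y - h‖ ^ ((n : ℝ) + α))⁻¹ := by
    intro y h hy hh
    have := hc y (-h) hy (by rwa [norm_neg])
    rwa [kern_neg, ← sub_eq_add_neg] at this
  have hmk : AEStronglyMeasurable (fun p : Euc n × Euc n => kern α p.2) (volume.prod volume) :=
    ((measurable_kern α).comp measurable_snd).aestronglyMeasurable
  have hmτ : AEStronglyMeasurable (fun p : Euc n × Euc n => torsion α R p.1) (volume.prod volume) :=
    ((measurable_torsion α R).comp measurable_fst).aestronglyMeasurable
  -- The torsion factor confines x to the ball. Short steps use the second difference bound; for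
  -- long steps v(x) is bounded and v(x ± h) is absorbed by the weighted function w.
  have hI1 : Integrable (fun p : Euc n × Euc n => torsion α R p.1 * (secondDiff v p.1 p.2 * kern α p.2))
      (volume.prod volume) := by
    set k1 : Euc n → ℝ := fun h => if ‖h‖ < η then C * ‖h‖ ^ (α + σ) * kern α h else 2 * M * kern α h
      with hk1
    have hk1m : Measurable k1 :=
      Measurable.ite (measurableSet_lt (by fun_prop) measurable_const) (by fun_prop) (by fun_prop)
    have hk1i : Integrable k1 := by
      refine integrable_of_kernel_bound (α := α) (σ := σ) (η := η) (C := max C (2 * M)) hα0 hσ hη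
        hk1m.aestronglyMeasurable ?_ ?_
      · intro h hh
        have hk := kern_nonneg α h
        simp only [hk1, if_pos hh]
        rw [abs_of_nonneg (by positivity)]
        rcases eq_or_ne h 0 with rfl | h0
        · rw [norm_zero, Real.zero_rpow (by positivity), mul_zero, zero_mul]; positivity
        · have hp : 0 < ‖h‖ := norm_pos_iff.2 h0
          rw [kern, mul_assoc, ← Real.rpow_add hp, show α + σ + -((n : ℝ) + α) = σ - n by ring]
          gcongr; exact le_max_left _ _
      · intro h hh
        have hk := kern_nonneg α h
        simp only [hk1, if_neg (not_lt.2 hh)]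
        rw [abs_of_nonneg (by positivity), kern]
        gcongr; exact le_max_right _ _
    have hdom := ((hτi.mul_prod hk1i).add ((integrable_prod_add hτi hwi).const_mul c)).add
      ((integrable_prod_sub hτi hwi).const_mul c)
    refine hdom.mono' (hmτ.mul ((aestronglyMeasurable_secondDiff_prod hv.aestronglyMeasurable).mul hmk))
      (Eventually.of_forall ?_)
    rintro ⟨x, h⟩
    simp only [Pi.add_apply]
    have hτ0 := torsion_nonneg α R x
    have hk := kern_nonneg α h
    rw [Real.norm_eq_abs, abs_mul, abs_of_nonneg hτ0, abs_mul, abs_of_nonneg hk]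
    by_cases hx : ‖x‖ ≤ R
    · have hw1 := hw0 (x + h)
      have hw2 := hw0 (x - h)
      have key : |secondDiff v x h| * kern α h ≤ k1 h + c * w (x + h) + c * w (x - h) := by
        by_cases hh : ‖h‖ < η
        · simp only [hk1, if_pos hh]
          have := mul_le_mul_of_nonneg_right (hsd x h hx hh) hk
          have := mul_nonneg hc0 hw1
          have := mul_nonneg hc0 hw2
          linarith
        · have hh' := not_lt.1 hh
          simp only [hk1, if_neg hh]
          have h1 := hvw (x + h) _ (hc x h hx hh')
          have h2 := hvw (x - h) _ (hc' x h hx hh')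
          have h3 := mul_le_mul_of_nonneg_right (hM x (by linarith)) hk
          have h4 : |secondDiff v x h| ≤ 2 * |v x| + |v (x + h)| + |v (x - h)| := by
            rw [secondDiff]
            refine (abs_sub _ _).trans (add_le_add ((abs_sub _ _).trans ?_) le_rfl)
            rw [abs_mul, abs_two]
          have h5 := mul_le_mul_of_nonneg_right h4 hk
          linarith
      have := mul_le_mul_of_nonneg_left key hτ0
      linarith
    · rw [torsion_eq_zero hα0 hR.le (not_le.1 hx).le]; simp
  -- For |x| ≤ R + η, v is bounded and the integrability of the second differences of the profile
  -- suffices. Farther out, reaching the support of the profile requires |h| ≥ η, and w takes over.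
  have hI2 : Integrable (fun p : Euc n × Euc n => v p.1 * (secondDiff (torsion α R) p.1 p.2 * kern α p.2))
      (volume.prod volume) := by
    have hN := integrable_prod_secondDiff_torsion (n := n) hα0 hα2 hR
    have hdom := ((hN.abs.const_mul M).add ((integrable_prod_add hwi hτi).const_mul c)).add
      ((integrable_prod_sub hwi hτi).const_mul c)
    refine hdom.mono' (hv.aestronglyMeasurable.comp_fst.mul hN.aestronglyMeasurable)
      (Eventually.of_forall ?_)
    rintro ⟨x, h⟩
    simp only [Pi.add_apply]
    have hk := kern_nonneg α h
    have t1 := torsion_nonneg α R (x + h)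
    have t2 := torsion_nonneg α R (x - h)
    have hwx := hw0 x
    rw [Real.norm_eq_abs, abs_mul]
    by_cases hx : ‖x‖ ≤ R + η
    · have := mul_le_mul_of_nonneg_right (hM x hx)
        (abs_nonneg (secondDiff (torsion α R) x h * kern α h))
      have : 0 ≤ c * (w x * torsion α R (x + h)) := by positivity
      have : 0 ≤ c * (w x * torsion α R (x - h)) := by positivity
      linarith
    · have hx' := not_le.1 hx
      rw [abs_mul, abs_of_nonneg hk]
      have h0 := torsion_eq_zero (α := α) (x := x) hα0 hR.le (by linarith)
      have h1 : |secondDiff (torsion α R) x h| ≤ torsion α R (x + h) + torsion α R (x - h) := by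
        have := abs_secondDiff_torsion_le α R x h
        rwa [h0, mul_zero, zero_add] at this
      have h2 : |v x| * (torsion α R (x + h) * kern α h) ≤ c * (w x * torsion α R (x + h)) := by
        by_cases hy : ‖x + h‖ ≤ R
        · have hη' : η ≤ ‖h‖ := by
            have := norm_sub_le (x + h) h; rw [add_sub_cancel_right] at this; linarith
          have h3 := hvw x (kern α h) (by simpa using hc' (x + h) h hy hη')
          have := mul_le_mul_of_nonneg_left h3 t1
          linarith
        · rw [torsion_eq_zero hα0 hR.le (not_le.1 hy).le]; simp
      have h2' : |v x| * (torsion α R (x - h) * kern α h) ≤ c * (w x * torsion α R (x - h)) := by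
        by_cases hy : ‖x - h‖ ≤ R
        · have hη' : η ≤ ‖h‖ := by
            have := norm_add_le (x - h) h; rw [sub_add_cancel] at this; linarith
          have h3 := hvw x (kern α h) (by simpa using hc (x - h) h hy hη')
          have := mul_le_mul_of_nonneg_left h3 t2
          linarith
        · rw [torsion_eq_zero hα0 hR.le (not_le.1 hy).le]; simp
      have h6 := mul_le_mul_of_nonneg_left (mul_le_mul_of_nonneg_right h1 hk) (abs_nonneg (v x))
      have : 0 ≤ M * (|secondDiff (torsion α R) x h| * kern α h) := by positivity
      linarith
  have hL : ∀ x, ∫ h, torsion α R x * (secondDiff v x h * kern α h) =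
      torsion α R x * ∫ h, secondDiff v x h * kern α h := fun x => integral_const_mul _ _
  have hRt : ∀ x, ∫ h, v x * (secondDiff (torsion α R) x h * kern α h) =
      v x * ∫ h, secondDiff (torsion α R) x h * kern α h := fun x => integral_const_mul _ _
  refine ⟨?_, ?_⟩
  · have := hI2.integral_prod_left
    simpa only [hRt] using this
  · have e1 := integral_prod _ hI1
    have e2 := integral_prod _ hI2
    have e1' := integral_prod_symm _ hI1
    have e2' := integral_prod_symm _ hI2
    simp only [hL] at e1
    simp only [hRt] at e2
    -- With h outermost the two sides agree for each fixed h: translation invariance moves the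
    -- shifts from v to the profile, and the singular kernel is only a constant factor.
    rw [← e1, ← e2, e1', e2']
    congr 1
    ext h
    have hτv := hv.integrable_torsion_mul (R := R) hα0 hR.le
    have hva : Integrable (fun x => torsion α R x * v (x + h)) := by
      simpa only [add_comm] using (hv.translate hα0 h).integrable_torsion_mul (R := R) hα0 hR.le
    have hvs : Integrable (fun x => torsion α R x * v (x - h)) := by
      simpa only [neg_add_eq_sub] using
        (hv.translate hα0 (-h)).integrable_torsion_mul (R := R) hα0 hR.le
    have hva' : Integrable (fun x => torsion α R (x + h) * v x) := by
      simpa using hvs.comp_add_right h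
    have hvs' : Integrable (fun x => torsion α R (x - h) * v x) := by
      simpa using hva.comp_sub_right h
    have f1 : ∫ x, torsion α R x * v (x + h) = ∫ x, torsion α R (x - h) * v x := by
      rw [← integral_sub_right_eq_self _ h]; simp
    have f2 : ∫ x, torsion α R x * v (x - h) = ∫ x, torsion α R (x + h) * v x := by
      rw [← integral_add_right_eq_self _ h]; simp
    have g1 : ∀ x, torsion α R x * (secondDiff v x h * kern α h) =
        (2 * (torsion α R x * v x) - torsion α R x * v (x + h) - torsion α R x * v (x - h)) *
          kern α h := fun x => by rw [secondDiff]; ring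
    have g2 : ∀ x, v x * (secondDiff (torsion α R) x h * kern α h) =
        (2 * (torsion α R x * v x) - torsion α R (x + h) * v x - torsion α R (x - h) * v x) *
          kern α h := fun x => by rw [secondDiff]; ring
    simp only [g1, g2]
    rw [integral_mul_const, integral_mul_const, integral_sub _ hvs, integral_sub _ hva,
      integral_sub _ hvs', integral_sub _ hva', f1, f2]
    · ring
    · exact hτv.const_mul 2
    · exact (hτv.const_mul 2).sub hva'
    · exact hτv.const_mul 2
    · exact (hτv.const_mul 2).sub hva

/-! ### The one-dimensional chord identity. -/

/-- Bernoulli's inequality gives the upper bound. Applied to the complementary exponent 1 - γ it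
gives the lower one, since (1+x)^γ (1+x)^(1-γ) = 1 + x. -/
lemma abs_one_add_rpow_sub_le {γ x : ℝ} (hγ0 : 0 < γ) (hγ1 : γ < 1) (hx : |x| ≤ 1 / 2) :
    |(1 + x) ^ γ - 1 - γ * x| ≤ 2 * x ^ 2 := by
  obtain ⟨h1, h2⟩ := abs_le.1 hx
  have hp : 0 < 1 + x := by linarith
  have hu := rpow_one_add_le_one_add_mul_self (s := x) (by linarith) hγ0.le hγ1.le
  have hl := rpow_one_add_le_one_add_mul_self (s := x) (p := 1 - γ) (by linarith) (by linarith)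
    (by linarith)
  have hq : 0 < 1 + (1 - γ) * x := by nlinarith
  have hprod : (1 + x) ^ γ * (1 + x) ^ (1 - γ) = 1 + x := by
    rw [← Real.rpow_add hp]; simp
  have h3 : 1 + x ≤ (1 + x) ^ γ * (1 + (1 - γ) * x) := by
    calc 1 + x = (1 + x) ^ γ * (1 + x) ^ (1 - γ) := hprod.symm
      _ ≤ _ := by gcongr
  have h4 : 1 + γ * x - 2 * x ^ 2 ≤ (1 + x) ^ γ := by
    refine le_of_mul_le_mul_right (le_trans ?_ h3) hq
    have : γ * (1 - γ) ≤ 2 * (1 + (1 - γ) * x) := by nlinarith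
    nlinarith [mul_nonneg (sq_nonneg x) (sub_nonneg.2 this)]
  rw [abs_le]; constructor <;> nlinarith [sq_nonneg x]

/-- Second order cancellation at infinity. -/
lemma tendsto_rpow_cancel {α p q : ℝ} (hα0 : 0 < α) (hα2 : α < 2) :
    Tendsto (fun M : ℝ => 2 * M ^ α - ((M - p) * (M + q)) ^ (α / 2) - ((M + p) * (M - q)) ^ (α / 2))
      atTop (𝓝 0) := by
  set K := 2 * |p * q| + 4 * ((|q - p| + |p * q|) ^ 2) with hK
  have hlim : Tendsto (fun M : ℝ => K * M ^ (-(2 - α))) atTop (𝓝 0) := by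
    simpa using (tendsto_rpow_neg_atTop (by linarith : 0 < 2 - α)).const_mul K
  refine squeeze_zero_norm' ?_ hlim
  filter_upwards [eventually_ge_atTop (1 + 2 * (|q - p| + |p * q|))] with M hM
  have hM1 : 1 ≤ M := by have := abs_nonneg (q - p); have := abs_nonneg (p * q); linarith
  have hM0 : 0 < M := by linarith
  -- Both products have the form M² + eM - pq with e = ±(q - p). Their first-order terms cancel in
  -- the sum, leaving O(M^(α-2)).
  have key : ∀ e : ℝ, |e| = |q - p| → |((M ^ 2 + e * M - p * q) ^ (α / 2)) - M ^ α -
      M ^ α * (α / 2 * (e / M - p * q / M ^ 2))| ≤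
      M ^ α * (2 * ((|q - p| + |p * q|) ^ 2 / M ^ 2)) := by
    intro e he
    set x := e / M - p * q / M ^ 2 with hx
    have hxb : |x| ≤ (|q - p| + |p * q|) / M := by
      calc |x| ≤ |e / M| + |p * q / M ^ 2| := abs_sub _ _
        _ = |q - p| / M + |p * q| / M ^ 2 := by
          rw [abs_div, abs_div, he, abs_of_pos hM0, abs_of_pos (by positivity : 0 < M ^ 2)]
        _ ≤ |q - p| / M + |p * q| / M := by
          gcongr; nlinarith
        _ = _ := by ring
    have hx2 : |x| ≤ 1 / 2 := by
      refine hxb.trans ?_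
      rw [div_le_iff₀ hM0]; linarith
    have hxp : 0 < 1 + x := by have := (abs_le.1 hx2).1; linarith
    have e1 : M ^ 2 + e * M - p * q = M ^ (2 : ℝ) * (1 + x) := by
      rw [hx]; norm_num; field_simp; ring
    rw [e1, Real.mul_rpow (by positivity) hxp.le, ← Real.rpow_mul hM0.le,
      show (2 : ℝ) * (α / 2) = α by ring, show M ^ α * (1 + x) ^ (α / 2) - M ^ α - M ^ α * (α / 2 * x) =
        M ^ α * ((1 + x) ^ (α / 2) - 1 - α / 2 * x) by ring, abs_mul, abs_of_pos (by positivity : 0 < M ^ α)]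
    gcongr
    refine (abs_one_add_rpow_sub_le (by linarith) (by linarith) hx2).trans ?_
    rw [← sq_abs x, ← div_pow]
    gcongr
  have k1 := key (q - p) rfl
  have k2 := key (-(q - p)) (abs_neg _)
  rw [show M ^ 2 + (q - p) * M - p * q = (M - p) * (M + q) by ring] at k1
  rw [show M ^ 2 + -(q - p) * M - p * q = (M + p) * (M - q) by ring] at k2
  have e2 : M ^ (-(2 - α)) = M ^ α / M ^ 2 := by
    rw [neg_sub, Real.rpow_sub hM0]; norm_num
  rw [Real.norm_eq_abs, e2]
  have hMα : 0 < M ^ α := by positivity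
  have hlin : M ^ α * (α / 2 * ((q - p) / M - p * q / M ^ 2)) +
      M ^ α * (α / 2 * (-(q - p) / M - p * q / M ^ 2)) = -(α * (p * q)) * (M ^ α / M ^ 2) := by
    field_simp; ring
  have hr : M ^ α * (2 * ((|q - p| + |p * q|) ^ 2 / M ^ 2)) =
      2 * (|q - p| + |p * q|) ^ 2 * (M ^ α / M ^ 2) := by ring
  rw [hr] at k1 k2
  have hpos : 0 < M ^ α / M ^ 2 := by positivity
  have hb : |α * (p * q) * (M ^ α / M ^ 2)| ≤ 2 * |p * q| * (M ^ α / M ^ 2) := by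
    rw [abs_mul, abs_mul, abs_of_pos hpos, abs_of_pos hα0]
    gcongr
  have hb' := abs_le.1 hb
  have k1' := abs_le.1 k1
  have k2' := abs_le.1 k2
  rw [abs_le, hK]
  constructor <;> linarith [hb'.1, hb'.2, k1'.1, k1'.2, k2'.1, k2'.2]

/-- The part with τ is an exact derivative, and since τ > h > 0 it also dominates the part without
τ. The shift e is what an off-centre point of a chord contributes. -/
lemma integral_centered {α h X : ℝ} (hα0 : 0 < α) (hh : 0 < h) (hX : h ≤ X) (e : ℝ) :
    IntegrableOn (fun τ => (τ ^ 2 - h ^ 2) ^ (α / 2 - 1)) (Ioo h X) ∧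
    IntegrableOn (fun τ => (τ + e) * (τ ^ 2 - h ^ 2) ^ (α / 2 - 1)) (Ioo h X) ∧
    ∫ τ in Ioo h X, (τ + e) * (τ ^ 2 - h ^ 2) ^ (α / 2 - 1) =
      (X ^ 2 - h ^ 2) ^ (α / 2) / α + e * ∫ τ in Ioo h X, (τ ^ 2 - h ^ 2) ^ (α / 2 - 1) := by
  have hpos : ∀ τ ∈ Ioo h X, 0 < τ ^ 2 - h ^ 2 := fun τ hτ => by nlinarith [hτ.1]
  have hc : ContinuousOn (fun τ : ℝ => (τ ^ 2 - h ^ 2) ^ (α / 2) / α) (Icc h X) := by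
    apply Continuous.continuousOn
    exact (Continuous.rpow_const (by fun_prop) (fun x => Or.inr (by positivity))).div_const _
  have hd : ∀ τ ∈ Ioo h X, HasDerivAt (fun τ : ℝ => (τ ^ 2 - h ^ 2) ^ (α / 2) / α)
      (τ * (τ ^ 2 - h ^ 2) ^ (α / 2 - 1)) τ := by
    intro τ hτ
    have h1 : HasDerivAt (fun τ : ℝ => τ ^ 2 - h ^ 2) (2 * τ) τ := by
      simpa using (hasDerivAt_pow 2 τ).sub_const (h ^ 2)
    refine ((h1.rpow_const (p := α / 2) (Or.inl (hpos τ hτ).ne')).div_const α).congr_deriv ?_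
    field_simp
  have hi1 : IntegrableOn (fun τ => τ * (τ ^ 2 - h ^ 2) ^ (α / 2 - 1)) (Ioo h X) := by
    have := intervalIntegral.intervalIntegrable_deriv_of_nonneg (by rwa [uIcc_of_le hX])
      (by rwa [min_eq_left hX, max_eq_right hX])
      (fun τ hτ => by
        rw [min_eq_left hX, max_eq_right hX] at hτ
        have := hpos τ hτ
        have : 0 < τ := hh.trans hτ.1
        positivity)
    rwa [intervalIntegrable_iff_integrableOn_Ioo_of_le hX] at this
  have hi0 : IntegrableOn (fun τ => (τ ^ 2 - h ^ 2) ^ (α / 2 - 1)) (Ioo h X) := by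
    refine (Integrable.const_mul hi1 (h⁻¹)).mono'
      (Measurable.aestronglyMeasurable (by fun_prop)) ?_
    filter_upwards [ae_restrict_mem measurableSet_Ioo] with τ hτ
    have h1 := hpos τ hτ
    rw [Real.norm_of_nonneg (by positivity), ← mul_assoc]
    have : 1 ≤ h⁻¹ * τ := by rw [← div_eq_inv_mul, one_le_div hh]; exact hτ.1.le
    exact le_mul_of_one_le_left (by positivity) this
  have hval : ∫ τ in Ioo h X, τ * (τ ^ 2 - h ^ 2) ^ (α / 2 - 1) = (X ^ 2 - h ^ 2) ^ (α / 2) / α := by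
    rw [← integral_Ioc_eq_integral_Ioo, ← intervalIntegral.integral_of_le hX,
      intervalIntegral.integral_eq_sub_of_hasDerivAt_of_le hX hc hd]
    · simp [Real.zero_rpow (by positivity : α / 2 ≠ 0)]
    · rwa [intervalIntegrable_iff_integrableOn_Ioo_of_le hX]
  have hsplit : ∀ τ, (τ + e) * (τ ^ 2 - h ^ 2) ^ (α / 2 - 1) =
      τ * (τ ^ 2 - h ^ 2) ^ (α / 2 - 1) + e * (τ ^ 2 - h ^ 2) ^ (α / 2 - 1) := fun τ => by ring
  simp_rw [hsplit]
  refine ⟨hi0, Integrable.add hi1 (Integrable.const_mul hi0 e), ?_⟩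
  rw [integral_add hi1 (Integrable.const_mul hi0 e), hval, integral_const_mul]

/-- The singular integral over one half of a chord, computed by inversion. -/
lemma integral_half_chord {α a b M : ℝ} (hα0 : 0 < α) (ha : 0 < a) (hb : 0 < b)
    (hM : a⁻¹ < M) :
    IntegrableOn (fun t => ((a - t) * (b + t)) ^ (α / 2 - 1) * t ^ (-1 - α)) (Ioo M⁻¹ a) ∧
    ∫ t in Ioo M⁻¹ a, ((a - t) * (b + t)) ^ (α / 2 - 1) * t ^ (-1 - α) =
      (a * b) ^ (α / 2 - 1) * (((M - a⁻¹) * (M + b⁻¹)) ^ (α / 2) / α - (b⁻¹ - a⁻¹) / 2 *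
        ∫ τ in Ioo ((a⁻¹ + b⁻¹) / 2) (M + (b⁻¹ - a⁻¹) / 2),
          (τ ^ 2 - ((a⁻¹ + b⁻¹) / 2) ^ 2) ^ (α / 2 - 1)) := by
  set p := a⁻¹ with hp
  set q := b⁻¹ with hq
  have hp0 : 0 < p := by positivity
  have hq0 : 0 < q := by positivity
  set h := (p + q) / 2 with hh
  set m := (q - p) / 2 with hm
  have hM0 : 0 < M := hp0.trans hM
  have hX : h ≤ M + m := by rw [hh, hm]; linarith
  have hspos : ∀ τ ∈ Ioo h (M + m), 0 < τ - m := fun τ hτ => by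
    have := hτ.1; rw [hh] at this; rw [hm]; linarith
  -- Under t = 1/(τ - m) the two linear factors of the chord become τ - m - p and τ - m + q; the
  -- shift m completes the square to τ² - h². The powers of t and the Jacobian then leave exactly
  -- the first power of τ - m.
  have himg : (fun τ : ℝ => (τ - m)⁻¹) '' Ioo h (M + m) = Ioo M⁻¹ a := by
    ext t
    simp only [mem_image, mem_Ioo]
    constructor
    · rintro ⟨τ, hτ, rfl⟩
      have h1 := hspos τ hτ
      refine ⟨inv_strictAnti₀ h1 (by linarith [hτ.2]), ?_⟩
      rw [← inv_inv a]
      refine inv_strictAnti₀ hp0 ?_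
      have := hτ.1; rw [hh] at this; rw [hm]; linarith
    · rintro ⟨h1, h2⟩
      have ht : 0 < t := (inv_pos.2 hM0).trans h1
      refine ⟨t⁻¹ + m, ⟨?_, ?_⟩, by simp⟩
      · have := inv_strictAnti₀ ht h2
        rw [hh, hm]; linarith
      · have := inv_strictAnti₀ (inv_pos.2 hM0) h1
        rw [inv_inv] at this; linarith
  have hd : ∀ τ ∈ Ioo h (M + m), HasDerivWithinAt (fun τ : ℝ => (τ - m)⁻¹)
      (-1 / (τ - m) ^ 2) (Ioo h (M + m)) τ := fun τ hτ =>
    (((hasDerivAt_id τ).sub_const m).inv (hspos τ hτ).ne').hasDerivWithinAt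
  have hinj : InjOn (fun τ : ℝ => (τ - m)⁻¹) (Ioo h (M + m)) := by
    intro x _ y _ hxy
    have := inv_injective hxy
    linarith
  have hpt : ∀ τ ∈ Ioo h (M + m), |-1 / (τ - m) ^ 2| •
      (((a - (τ - m)⁻¹) * (b + (τ - m)⁻¹)) ^ (α / 2 - 1) * ((τ - m)⁻¹) ^ (-1 - α)) =
      (a * b) ^ (α / 2 - 1) * ((τ + -m) * (τ ^ 2 - h ^ 2) ^ (α / 2 - 1)) := by
    intro τ hτ
    have hs := hspos τ hτ
    have hsq : 0 < τ ^ 2 - h ^ 2 := by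
      have h0 : 0 < h := by rw [hh]; positivity
      nlinarith [hτ.1]
    have e1 : (a - (τ - m)⁻¹) * (b + (τ - m)⁻¹) = a * b * (τ ^ 2 - h ^ 2) * (τ - m) ^ (-2 : ℝ) := by
      rw [Real.rpow_neg hs.le]
      have h1 : a * p = 1 := mul_inv_cancel₀ ha.ne'
      have h2 : b * q = 1 := mul_inv_cancel₀ hb.ne'
      have e3 : τ ^ 2 - h ^ 2 = (τ - m - p) * (τ - m + q) := by rw [hh, hm]; ring
      have hss : (τ - m) * (τ - m)⁻¹ = 1 := mul_inv_cancel₀ hs.ne'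
      have f1 : a - (τ - m)⁻¹ = a * (τ - m - p) * (τ - m)⁻¹ := by
        linear_combination (-a) * hss + (τ - m)⁻¹ * h1
      have f2 : b + (τ - m)⁻¹ = b * (τ - m + q) * (τ - m)⁻¹ := by
        linear_combination (-b) * hss - (τ - m)⁻¹ * h2
      rw [e3, f1, f2, Real.rpow_two, ← inv_pow]
      ring
    rw [e1, Real.mul_rpow (by positivity) (by positivity), Real.mul_rpow (by positivity) hsq.le,
      ← Real.rpow_mul hs.le, abs_div, abs_neg, abs_one, abs_of_pos (by positivity : 0 < (τ - m) ^ 2),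
      Real.inv_rpow hs.le, ← Real.rpow_neg hs.le, smul_eq_mul, one_div, ← Real.rpow_natCast,
      ← Real.rpow_neg hs.le]
    have e4 : (τ - m) ^ (-((2 : ℕ) : ℝ)) * (τ - m) ^ (-2 * (α / 2 - 1)) * (τ - m) ^ (-(-1 - α)) =
        τ + -m := by
      rw [← Real.rpow_add hs, ← Real.rpow_add hs]
      rw [show -((2 : ℕ) : ℝ) + -2 * (α / 2 - 1) + -(-1 - α) = 1 by push_cast; ring, Real.rpow_one]
      ring
    rw [← e4]; ring
  obtain ⟨-, i2, i3⟩ := integral_centered hα0 (by rw [hh]; positivity) hX (-m)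
  rw [← himg]
  constructor
  · rw [integrableOn_image_iff_integrableOn_abs_deriv_smul measurableSet_Ioo hd hinj]
    exact IntegrableOn.congr_fun (Integrable.const_mul i2 _) (fun τ hτ => (hpt τ hτ).symm)
      measurableSet_Ioo
  · rw [integral_image_eq_integral_abs_deriv_smul measurableSet_Ioo hd hinj,
      setIntegral_congr_fun measurableSet_Ioo hpt, integral_const_mul, i3,
      show (M + m) ^ 2 - h ^ 2 = (M - p) * (M + q) by rw [hh, hm]; ring]
    ring

/-- `y ↦ y^β` for `y > 0`, extended by `0`. -/
noncomputable def posPow (β y : ℝ) : ℝ := if 0 < y then y ^ β else 0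

lemma posPow_nonneg (β y : ℝ) : 0 ≤ posPow β y := by
  unfold posPow; split_ifs <;> positivity

@[fun_prop]
lemma measurable_posPow (β : ℝ) : Measurable (posPow β) := by
  unfold posPow
  exact Measurable.ite measurableSet_Ioi (by fun_prop) measurable_const

/-- The endpoints stay at distance 2|m| while the integrand decays at infinity, because α/2 - 1 < 0.
-/
lemma tendsto_integral_shift {α h m : ℝ} (hα0 : 0 < α) (hα2 : α < 2) (hh : 0 < h) :
    Tendsto (fun M : ℝ => (∫ τ in Ioo h (M + m), (τ ^ 2 - h ^ 2) ^ (α / 2 - 1)) -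
      ∫ τ in Ioo h (M - m), (τ ^ 2 - h ^ 2) ^ (α / 2 - 1)) atTop (𝓝 0) := by
  have hlim : Tendsto (fun M : ℝ => ((M - |m|) ^ 2 - h ^ 2) ^ (-(1 - α / 2)) * |M + m - (M - m)|)
      atTop (𝓝 0) := by
    have h1 : Tendsto (fun M : ℝ => (M - |m|) ^ 2 - h ^ 2) atTop atTop := by
      refine tendsto_atTop_add_const_right _ _ ?_
      exact (tendsto_pow_atTop two_ne_zero).comp (tendsto_atTop_add_const_right _ _ tendsto_id)
    have h2 := (tendsto_rpow_neg_atTop (by linarith : 0 < 1 - α / 2)).comp h1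
    have h3 : ∀ M : ℝ, |M + m - (M - m)| = |2 * m| := fun M => by congr 1; ring
    simp_rw [h3]
    simpa using h2.mul_const |2 * m|
  refine squeeze_zero_norm' ?_ hlim
  filter_upwards [eventually_gt_atTop (h + |m|)] with M hM
  have hm1 := neg_abs_le m
  have hm2 := le_abs_self m
  have hX : h ≤ M + m := by linarith
  have hY : h ≤ M - m := by linarith
  have iX := (integral_centered hα0 hh hX 0).1
  have iY := (integral_centered hα0 hh hY 0).1
  rw [← integral_Ioc_eq_integral_Ioo, ← integral_Ioc_eq_integral_Ioo,
    ← intervalIntegral.integral_of_le hX, ← intervalIntegral.integral_of_le hY,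
    intervalIntegral.integral_interval_sub_left
      ((intervalIntegrable_iff_integrableOn_Ioo_of_le hX).2 iX)
      ((intervalIntegrable_iff_integrableOn_Ioo_of_le hY).2 iY)]
  refine intervalIntegral.norm_integral_le_of_norm_le_const (fun τ hτ => ?_)
  have hτ' : M - |m| < τ := by
    have := hτ.1
    rcases min_choice (M - m) (M + m) with h | h <;> rw [h] at this <;> linarith
  have h4 : 0 < (M - |m|) ^ 2 - h ^ 2 := by nlinarith
  have h5 : (M - |m|) ^ 2 - h ^ 2 ≤ τ ^ 2 - h ^ 2 := by nlinarith
  rw [Real.norm_of_nonneg (Real.rpow_nonneg (by linarith) _),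
    show -(1 - α / 2) = α / 2 - 1 by ring]
  exact Real.rpow_le_rpow_of_nonpos h4 h5 (by linarith)

lemma setIntegral_posPow_chord {α a b δ : ℝ} (hb : 0 < b) (hδ : 0 < δ) :
    (IntegrableOn (fun t => ((a - t) * (b + t)) ^ (α / 2 - 1) * t ^ (-1 - α)) (Ioo δ a) →
    IntegrableOn (fun t => posPow (α / 2 - 1) ((a - t) * (b + t)) * t ^ (-1 - α)) (Ioi δ)) ∧
    ∫ t in Ioi δ, posPow (α / 2 - 1) ((a - t) * (b + t)) * t ^ (-1 - α) =
      ∫ t in Ioo δ a, ((a - t) * (b + t)) ^ (α / 2 - 1) * t ^ (-1 - α) := by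
  have hpt : ∀ t ∈ Ioi δ, posPow (α / 2 - 1) ((a - t) * (b + t)) * t ^ (-1 - α) =
      (Iio a).indicator (fun t => ((a - t) * (b + t)) ^ (α / 2 - 1) * t ^ (-1 - α)) t := by
    intro t ht
    have ht0 : 0 < t := hδ.trans ht
    by_cases hta : t < a
    · rw [indicator_of_mem (by exact hta), posPow, if_pos (mul_pos (by linarith) (by linarith))]
    · rw [indicator_of_notMem (by exact hta), posPow, if_neg, zero_mul]
      exact not_lt.2 (mul_nonpos_of_nonpos_of_nonneg (by linarith [not_lt.1 hta]) (by linarith))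
  rw [setIntegral_congr_fun measurableSet_Ioi hpt, setIntegral_indicator measurableSet_Iio]
  refine ⟨fun hi => ?_, by rw [Ioi_inter_Iio]⟩
  refine IntegrableOn.congr_fun ?_ (fun t ht => (hpt t ht).symm) measurableSet_Ioi
  rw [IntegrableOn, integrable_indicator_iff measurableSet_Iio, IntegrableOn,
    Measure.restrict_restrict measurableSet_Iio, inter_comm, Ioi_inter_Iio]
  exact hi

/-- The one-dimensional fractional Laplacian of a chord profile vanishes inside the chord. -/
lemma integral_chord_eq_zero {α a b : ℝ} (hα0 : 0 < α) (hα2 : α < 2) (ha : 0 < a) (hb : 0 < b) :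
    ∫ t in Ioi (0 : ℝ), (2 * (a * b) ^ (α / 2 - 1) - posPow (α / 2 - 1) ((a - t) * (b + t)) -
      posPow (α / 2 - 1) ((b - t) * (a + t))) * t ^ (-1 - α) = 0 := by
  set F : ℝ → ℝ := fun t => (2 * (a * b) ^ (α / 2 - 1) - posPow (α / 2 - 1) ((a - t) * (b + t)) -
      posPow (α / 2 - 1) ((b - t) * (a + t))) * t ^ (-1 - α) with hF
  -- Without integrability the value is 0 by convention; with it, the integral is the limit of its
  -- truncations at t > 1/M.
  by_cases hi : IntegrableOn F (Ioi 0)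
  swap
  · exact integral_undef hi
  set p := a⁻¹ with hp
  set q := b⁻¹ with hq
  have hp0 : 0 < p := inv_pos.2 ha
  have hq0 : 0 < q := inv_pos.2 hb
  -- Exchanging a and b for the opposite half of the chord flips the sign of m = (q - p)/2. The
  -- explicit terms then form a second-order cancellation, and the two remaining integrals a
  -- difference with shifted endpoints.
  have hval : ∀ᶠ M in atTop, (a * b) ^ (α / 2 - 1) * ((2 * M ^ α - ((M - p) * (M + q)) ^ (α / 2) -
      ((M + p) * (M - q)) ^ (α / 2)) / α + (q - p) / 2 *
      ((∫ τ in Ioo ((p + q) / 2) (M + (q - p) / 2), (τ ^ 2 - ((p + q) / 2) ^ 2) ^ (α / 2 - 1)) -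
      ∫ τ in Ioo ((p + q) / 2) (M - (q - p) / 2), (τ ^ 2 - ((p + q) / 2) ^ 2) ^ (α / 2 - 1))) =
      ∫ t in Ioi M⁻¹, F t ∂(volume.restrict (Ioi 0)) := by
    filter_upwards [eventually_gt_atTop p, eventually_gt_atTop q] with M hMp hMq
    have hM0 : 0 < M := hp0.trans hMp
    have hδ : 0 < M⁻¹ := inv_pos.2 hM0
    rw [Measure.restrict_restrict measurableSet_Ioi, Ioi_inter_Ioi, max_eq_left hδ.le]
    obtain ⟨i1, v1⟩ := integral_half_chord hα0 ha hb hMp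
    obtain ⟨i2, v2⟩ := integral_half_chord hα0 hb ha hMq
    obtain ⟨j1, w1⟩ := setIntegral_posPow_chord (α := α) (a := a) hb hδ
    obtain ⟨j2, w2⟩ := setIntegral_posPow_chord (α := α) (a := b) ha hδ
    have i0 := integrableOn_Ioi_rpow_of_lt (by linarith : -1 - α < -1) hδ
    have v0 := integral_Ioi_rpow_of_lt (by linarith : -1 - α < -1) hδ
    have hsplit : ∀ t, F t = 2 * (a * b) ^ (α / 2 - 1) * t ^ (-1 - α) -
        posPow (α / 2 - 1) ((a - t) * (b + t)) * t ^ (-1 - α) -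
        posPow (α / 2 - 1) ((b - t) * (a + t)) * t ^ (-1 - α) := fun t => by
      simp only [hF]; ring
    simp_rw [hsplit]
    have i0' := Integrable.const_mul i0 (2 * (a * b) ^ (α / 2 - 1))
    have s1 := integral_sub (i0'.sub (j1 i1)) (j2 i2)
    have s2 := integral_sub i0' (j1 i1)
    simp only [Pi.sub_apply] at s1
    rw [s1, s2, integral_const_mul, v0, w1, w2, v1, v2]
    have e1 : M⁻¹ ^ (-1 - α + 1) = M ^ α := by
      rw [Real.inv_rpow hM0.le, ← Real.rpow_neg hM0.le]; congr 1; ring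
    have e2 : b⁻¹ + a⁻¹ = p + q := add_comm _ _
    have e3 : M + (a⁻¹ - b⁻¹) / 2 = M - (q - p) / 2 := by rw [hp, hq]; ring
    rw [e1, e2, e3, show -1 - α + 1 = -α by ring, mul_comm b a]
    simp only [← hp, ← hq]
    field_simp
    ring
  have hc := aecover_Ioi_of_Ioi (μ := volume) (tendsto_inv_atTop_zero (𝕜 := ℝ))
  have hl := hc.integral_tendsto_of_countably_generated hi
  refine tendsto_nhds_unique hl (Tendsto.congr' hval ?_)
  have t1 := tendsto_rpow_cancel (p := p) (q := q) hα0 hα2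
  have t2 := tendsto_integral_shift (m := (q - p) / 2) hα0 hα2
    (by positivity : 0 < (p + q) / 2)
  simpa using ((t1.div_const α).add (t2.const_mul ((q - p) / 2))).const_mul ((a * b) ^ (α / 2 - 1))

/-! ### Constancy inside the ball. -/

/-- The profile `(ρ² - |x|²)₊^(α/2-1)`. -/
noncomputable def innerKer {n : ℕ} (α ρ : ℝ) (x : Euc n) : ℝ := posPow (α / 2 - 1) (ρ ^ 2 - ‖x‖ ^ 2)

/-- The integral of second differences of the torsion profile. -/
noncomputable def torsionLap {n : ℕ} (α R : ℝ) (x : Euc n) : ℝ :=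
  ∫ h, secondDiff (torsion α R) x h * kern α h

lemma innerKer_nonneg {n : ℕ} (α ρ : ℝ) (x : Euc n) : 0 ≤ innerKer α ρ x := posPow_nonneg _ _

lemma measurable_innerKer {n : ℕ} (α : ℝ) :
    Measurable (fun p : ℝ × Euc n => innerKer α p.1 p.2) := by
  unfold innerKer; fun_prop

/-- On a line through x the profile is a chord profile, and the Jacobian r^(n-1) reduces `kern` to
its one-dimensional form, so each ray contributes zero. -/
lemma integral_secondDiff_innerKer {n : ℕ} [Nontrivial (Euc n)] {α ρ : ℝ} (hα0 : 0 < α)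
    (hα2 : α < 2) {x : Euc n} (hx : ‖x‖ < ρ) :
    ∫ h, secondDiff (innerKer α ρ) x h * kern α h = 0 := by
  have hn := ne_zero_of_nontrivial n
  refine integral_eq_zero_of_rays fun ω hω => ?_
  set d : ℝ := inner ℝ x ω with hd
  have hD : 0 < ρ ^ 2 - ‖x‖ ^ 2 := by nlinarith [norm_nonneg x]
  -- Half the length of the chord through x in direction ω; its ends lie at distances s - d and s +
  -- d from x.
  set s := Real.sqrt (d ^ 2 + (ρ ^ 2 - ‖x‖ ^ 2)) with hs
  have hs2 : s ^ 2 = d ^ 2 + (ρ ^ 2 - ‖x‖ ^ 2) := Real.sq_sqrt (by positivity)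
  have hs0 : 0 ≤ s := Real.sqrt_nonneg _
  have hds : |d| < s := by
    rw [← abs_of_nonneg hs0]
    exact sq_lt_sq.1 (by rw [hs2]; linarith)
  obtain ⟨h1, h2⟩ := abs_lt.1 hds
  refine (setIntegral_congr_fun measurableSet_Ioi fun r hr => ?_).trans
    (integral_chord_eq_zero hα0 hα2 (by linarith : 0 < s - d) (by linarith : 0 < s + d))
  have hr0 : 0 < r := hr
  have e1 : ‖x + r • ω‖ ^ 2 = ‖x‖ ^ 2 + 2 * (r * d) + r ^ 2 := by
    rw [norm_add_sq_real, inner_smul_right, norm_smul, hω, Real.norm_of_nonneg hr0.le]; ring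
  have e2 : ‖x - r • ω‖ ^ 2 = ‖x‖ ^ 2 - 2 * (r * d) + r ^ 2 := by
    rw [norm_sub_sq_real, inner_smul_right, norm_smul, hω, Real.norm_of_nonneg hr0.le]; ring
  have e3 : ‖r • ω‖ = r := by rw [norm_smul, hω, Real.norm_of_nonneg hr0.le, mul_one]
  have f1 : ρ ^ 2 - ‖x + r • ω‖ ^ 2 = (s - d - r) * (s + d + r) := by rw [e1]; linear_combination -hs2
  have f2 : ρ ^ 2 - ‖x - r • ω‖ ^ 2 = (s + d - r) * (s - d + r) := by rw [e2]; linear_combination -hs2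
  have f0 : ρ ^ 2 - ‖x‖ ^ 2 = (s - d) * (s + d) := by linear_combination -hs2
  simp only [secondDiff, innerKer, kern, e3, f1, f2, f0]
  rw [pow_pred_eq hn, mul_left_comm, ← Real.rpow_add hr0]
  rw [show (n : ℝ) - 1 + -((n : ℝ) + α) = -1 - α by ring]
  congr 2
  rw [posPow, if_pos (by rw [← f0]; exact hD)]

/-- The integrand is the ρ-derivative of (ρ² - |z|²)^(α/2). The point z = 0 is excluded only because
`integral_centered` starts from a positive radius. -/
lemma integral_mul_innerKer {n : ℕ} {α R : ℝ} (hα0 : 0 < α) (hR : 0 ≤ R) {z : Euc n} (hz : z ≠ 0) :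
    IntegrableOn (fun ρ => α * ρ * innerKer α ρ z) (Ioc 0 R) ∧
    ∫ ρ in Ioc 0 R, α * ρ * innerKer α ρ z = torsion α R z := by
  have hp : 0 < ‖z‖ := norm_pos_iff.2 hz
  have hpt : ∀ ρ ∈ Ioc 0 R, α * ρ * innerKer α ρ z = (Ioi ‖z‖).indicator
      (fun ρ => α * ((ρ + 0) * (ρ ^ 2 - ‖z‖ ^ 2) ^ (α / 2 - 1))) ρ := by
    intro ρ hρ
    have hρ0 : 0 < ρ := hρ.1
    by_cases h : ‖z‖ < ρ
    · rw [indicator_of_mem (by exact h), innerKer, posPow, if_pos (by nlinarith)]; ring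
    · rw [indicator_of_notMem (by exact h), innerKer, posPow, if_neg (by nlinarith), mul_zero]
  have hset : Ioc 0 R ∩ Ioi ‖z‖ = Ioc ‖z‖ R := by
    ext ρ; simp only [mem_inter_iff, mem_Ioc, mem_Ioi]
    exact ⟨fun h => ⟨h.2, h.1.2⟩, fun h => ⟨⟨hp.trans h.1, h.2⟩, h.1⟩⟩
  have hcase : IntegrableOn (fun ρ => α * ((ρ + 0) * (ρ ^ 2 - ‖z‖ ^ 2) ^ (α / 2 - 1))) (Ioc ‖z‖ R) ∧
      ∫ ρ in Ioc ‖z‖ R, α * ((ρ + 0) * (ρ ^ 2 - ‖z‖ ^ 2) ^ (α / 2 - 1)) = torsion α R z := by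
    rcases le_total ‖z‖ R with h | h
    · obtain ⟨-, h2, h3⟩ := integral_centered hα0 hp h 0
      refine ⟨?_, ?_⟩
      · rw [integrableOn_Ioc_iff_integrableOn_Ioo]; exact Integrable.const_mul h2 α
      · rw [integral_const_mul, integral_Ioc_eq_integral_Ioo, h3, torsion, max_eq_left (by nlinarith)]
        field_simp; ring
    · rw [Ioc_eq_empty (not_lt.2 h), torsion_eq_zero hα0 hR h]; simp
  constructor
  · refine IntegrableOn.congr_fun ?_ (fun ρ hρ => (hpt ρ hρ).symm) measurableSet_Ioc
    rw [IntegrableOn, integrable_indicator_iff measurableSet_Ioi, IntegrableOn,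
      Measure.restrict_restrict measurableSet_Ioi, inter_comm, hset]
    exact hcase.1
  · rw [setIntegral_congr_fun measurableSet_Ioc hpt, setIntegral_indicator measurableSet_Ioi, hset]
    exact hcase.2

lemma integral_mul_innerKer_sub {n : ℕ} {α R R' : ℝ} (hα0 : 0 < α) (hR : 0 ≤ R) (hRR : R ≤ R')
    {z : Euc n} (hz : z ≠ 0) :
    IntegrableOn (fun ρ => α * ρ * innerKer α ρ z) (Ioc R R') ∧
    ∫ ρ in Ioc R R', α * ρ * innerKer α ρ z = torsion α R' z - torsion α R z := by
  obtain ⟨i1, v1⟩ := integral_mul_innerKer hα0 hR hz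
  obtain ⟨i2, v2⟩ := integral_mul_innerKer hα0 (hR.trans hRR) hz
  have i3 := i2.mono_set (Ioc_subset_Ioc_left hR)
  refine ⟨i3, ?_⟩
  rw [← v1, ← v2, ← Ioc_union_Ioc_eq_Ioc hR hRR, setIntegral_union
    (Ioc_disjoint_Ioc_of_le le_rfl) measurableSet_Ioc i1 i3]
  ring

/-- The profile `(ρ² - |x|²)^(α/2-1)` is midpoint convex in the ball. -/
lemma secondDiff_innerKer_nonpos {n : ℕ} {α ρ : ℝ} (hα2 : α < 2) {x h : Euc n}
    (hx : ‖x‖ + ‖h‖ < ρ) : secondDiff (innerKer α ρ) x h ≤ 0 := by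
  have h1 : ‖x + h‖ < ρ := (norm_add_le x h).trans_lt hx
  have h2 : ‖x - h‖ < ρ := (norm_sub_le x h).trans_lt hx
  have hx0 : ‖x‖ < ρ := by linarith [norm_nonneg h]
  have a1 : 0 < ρ ^ 2 - ‖x + h‖ ^ 2 := by nlinarith [norm_nonneg (x + h)]
  have a2 : 0 < ρ ^ 2 - ‖x - h‖ ^ 2 := by nlinarith [norm_nonneg (x - h)]
  have a0 : 0 < ρ ^ 2 - ‖x‖ ^ 2 := by nlinarith [norm_nonneg x]
  have hp := parallelogram_law_with_norm ℝ x h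
  simp only [secondDiff, innerKer, posPow, if_pos a1, if_pos a2, if_pos a0]
  set A := ρ ^ 2 - ‖x + h‖ ^ 2 with hA
  set B := ρ ^ 2 - ‖x - h‖ ^ 2 with hB
  set S := ρ ^ 2 - ‖x‖ ^ 2 with hS
  set β := (α / 2 - 1) / 2 with hβ
  -- The parallelogram law gives A + B ≤ 2S, hence AB ≤ S². Raising to the negative power β and
  -- using 2 A^β B^β ≤ A^(2β) + B^(2β) gives convexity.
  have hAB : A * B ≤ S ^ 2 := by
    have h3 : A + B ≤ 2 * S := by rw [hA, hB, hS]; nlinarith [norm_nonneg h]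
    nlinarith [sq_nonneg (A - B)]
  have h4 : (S ^ 2) ^ β ≤ (A * B) ^ β :=
    Real.rpow_le_rpow_of_nonpos (by positivity) hAB (by rw [hβ]; linarith)
  have e : ∀ y : ℝ, 0 < y → y ^ (α / 2 - 1) = (y ^ β) ^ 2 := fun y hy => by
    rw [← Real.rpow_natCast, ← Real.rpow_mul hy.le]; congr 1; rw [hβ]; push_cast; ring
  have e2 : (S ^ 2) ^ β = S ^ (α / 2 - 1) := by
    rw [← Real.rpow_natCast, ← Real.rpow_mul a0.le]; congr 1; rw [hβ]; push_cast; ring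
  rw [e2, Real.mul_rpow a1.le a2.le] at h4
  rw [e A a1, e B a2]
  nlinarith [sq_nonneg (A ^ β - B ^ β)]

lemma memLAlpha_torsion {n : ℕ} [Nontrivial (Euc n)] {α R : ℝ} (hα0 : 0 < α) (hR : 0 ≤ R) :
    MemLAlpha α (torsion α R : Euc n → ℝ) := by
  refine (integrable_torsion (n := n) hα0 hR).mono' (Measurable.aestronglyMeasurable (by fun_prop))
    (Eventually.of_forall fun x => ?_)
  have h3 : 0 ≤ ‖x‖ ^ ((n : ℝ) + α) := by positivity
  have h4 := torsion_nonneg α R x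
  rw [Real.norm_of_nonneg (by positivity)]
  exact div_le_self h4 (by linarith)

/-- At an interior point the profile is smooth, so its second difference is O(|h|²), and 2 = α + (2
- α) with 2 - α > 0. -/
lemma integrable_secondDiff_torsion_kern {n : ℕ} [Nontrivial (Euc n)] {α R : ℝ} (hα0 : 0 < α)
    (hα2 : α < 2) {x : Euc n} (hx : ‖x‖ < R) :
    Integrable (fun h => secondDiff (torsion α R) x h * kern α h) := by
  have hR : 0 < R := (norm_nonneg x).trans_lt hx
  have hS : 0 < R ^ 2 - ‖x‖ ^ 2 := by nlinarith [norm_nonneg x]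
  set S := R ^ 2 - ‖x‖ ^ 2 with hSdef
  -- For |h| < 1 the relative change of R² - |x|² is at most K|h|; the radius η below keeps it under
  -- 1/2, as `abs_one_add_rpow_sub_le` requires.
  set K := (1 + 2 * ‖x‖) / S with hK
  have hK0 : 0 < K := by positivity
  refine integrable_secondDiff_kern (σ := 2 - α) (η := min 1 (1 / (2 * K)))
    (C := S ^ (α / 2) * (α / S + 4 * K ^ 2)) hα0 (by linarith) (by positivity) (by positivity)
    (memLAlpha_torsion hα0 hR.le) (fun h hh => ?_)
  have hh1 : ‖h‖ < 1 := hh.trans_le (min_le_left _ _)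
  have hh2 : K * ‖h‖ < 1 / 2 := by
    have := hh.trans_le (min_le_right _ _)
    rw [lt_div_iff₀ (by positivity)] at this; linarith
  set d : ℝ := inner ℝ x h with hd
  have hdb : |d| ≤ ‖x‖ * ‖h‖ := abs_real_inner_le_norm x h
  have hy : ∀ e : ℝ, |e| ≤ ‖x‖ * ‖h‖ → |(-‖h‖ ^ 2 - 2 * e) / S| ≤ K * ‖h‖ := by
    intro e he
    rw [abs_div, abs_of_pos hS, hK, div_mul_eq_mul_div]
    gcongr
    calc |-‖h‖ ^ 2 - 2 * e| ≤ |-‖h‖ ^ 2| + |2 * e| := abs_sub _ _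
      _ = ‖h‖ ^ 2 + 2 * |e| := by rw [abs_neg, abs_mul, abs_two, abs_of_nonneg (sq_nonneg _)]
      _ ≤ _ := by nlinarith [norm_nonneg h]
  have key : ∀ (z : Euc n) (e : ℝ), |e| ≤ ‖x‖ * ‖h‖ → ‖z‖ ^ 2 = ‖x‖ ^ 2 + 2 * e + ‖h‖ ^ 2 →
      |torsion α R z - S ^ (α / 2) - S ^ (α / 2) * (α / 2 * ((-‖h‖ ^ 2 - 2 * e) / S))| ≤
        S ^ (α / 2) * (2 * (K * ‖h‖) ^ 2) := by
    intro z e he hz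
    have h1 := hy e he
    set y := (-‖h‖ ^ 2 - 2 * e) / S with hydef
    have h2 : |y| ≤ 1 / 2 := h1.trans hh2.le
    have h3 : 0 < 1 + y := by have := (abs_le.1 h2).1; linarith
    have h4 : R ^ 2 - ‖z‖ ^ 2 = S * (1 + y) := by
      rw [hz, hydef]; field_simp; rw [hSdef]; ring
    rw [torsion, h4, max_eq_left (by positivity), Real.mul_rpow hS.le h3.le,
      show S ^ (α / 2) * (1 + y) ^ (α / 2) - S ^ (α / 2) - S ^ (α / 2) * (α / 2 * y) =
        S ^ (α / 2) * ((1 + y) ^ (α / 2) - 1 - α / 2 * y) by ring, abs_mul,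
      abs_of_pos (by positivity : 0 < S ^ (α / 2))]
    gcongr
    refine (abs_one_add_rpow_sub_le (by linarith) (by linarith) h2).trans ?_
    rw [← sq_abs y]
    gcongr
  have k1 := abs_le.1 (key (x + h) d hdb (by rw [norm_add_sq_real]))
  have k2 := abs_le.1 (key (x - h) (-d) (by rwa [abs_neg]) (by rw [norm_sub_sq_real]; ring))
  have e0 : torsion α R x = S ^ (α / 2) := by rw [torsion, max_eq_left hS.le]
  have e1 : α + (2 - α) = ((2 : ℕ) : ℝ) := by push_cast; ring
  rw [e1, Real.rpow_natCast, secondDiff, e0]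
  have e2 : S ^ (α / 2) * (α / 2 * ((-‖h‖ ^ 2 - 2 * d) / S)) +
      S ^ (α / 2) * (α / 2 * ((-‖h‖ ^ 2 - 2 * -d) / S)) = -(S ^ (α / 2) * (α / S * ‖h‖ ^ 2)) := by
    field_simp; ring
  have e3 : S ^ (α / 2) * (α / S + 4 * K ^ 2) * ‖h‖ ^ 2 = S ^ (α / 2) * (α / S * ‖h‖ ^ 2) +
      2 * (S ^ (α / 2) * (2 * (K * ‖h‖) ^ 2)) := by ring
  have e4 : 0 ≤ S ^ (α / 2) * (α / S * ‖h‖ ^ 2) := by positivity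
  rw [e3, abs_le]
  constructor <;> linarith [k1.1, k1.2, k2.1, k2.2]

/-- The two profiles differ by the superposition of α ρ `innerKer α ρ` over R < ρ ≤ R', and the
singular integral of each layer vanishes at x. The work lies in justifying Fubini. -/
lemma torsionLap_eq_of_lt {n : ℕ} [Nontrivial (Euc n)] {α R R' : ℝ} (hα0 : 0 < α)
    (hα2 : α < 2) {x : Euc n} (hx0 : x ≠ 0) (hx : ‖x‖ < R) (hRR : R ≤ R') :
    torsionLap α R' x = torsionLap α R x := by
  have hR : 0 < R := (norm_nonneg x).trans_lt hx
  set η := R - ‖x‖ with hη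
  have hη0 : 0 < η := by linarith
  have i1 := integrable_secondDiff_torsion_kern hα0 hα2 hx
  have i2 := integrable_secondDiff_torsion_kern hα0 hα2 (hx.trans_le hRR)
  set Ψ : ℝ × Euc n → ℝ := fun p =>
    α * p.1 * (secondDiff (innerKer α p.1) x p.2 * kern α p.2) with hΨ
  have hΨm : Measurable Ψ := by
    have hg := measurable_innerKer (n := n) α
    have m0 : Measurable (fun p : ℝ × Euc n => innerKer α p.1 x) :=
      hg.comp (measurable_fst.prodMk measurable_const)
    have m1 : Measurable (fun p : ℝ × Euc n => innerKer α p.1 (x + p.2)) :=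
      hg.comp (measurable_fst.prodMk (measurable_snd.const_add x))
    have m2 : Measurable (fun p : ℝ × Euc n => innerKer α p.1 (x - p.2)) :=
      hg.comp (measurable_fst.prodMk (measurable_snd.const_sub x))
    exact (measurable_fst.const_mul α).mul ((((m0.const_mul 2).sub m1).sub m2).mul
      ((measurable_kern α).comp measurable_snd))
  have hae : ∀ᵐ h : Euc n, x + h ≠ 0 ∧ x - h ≠ 0 := by
    filter_upwards [Measure.ae_ne volume (-x), Measure.ae_ne volume x] with h h1 h2
    exact ⟨fun h3 => h1 (eq_neg_of_add_eq_zero_right h3), fun h3 => h2 (sub_eq_zero.1 h3).symm⟩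
  have hA : ∀ z : Euc n, z ≠ 0 → _ := fun z hz => integral_mul_innerKer_sub hα0 hR.le hRR hz
  have hform : ∀ (h : Euc n) ρ, Ψ (ρ, h) = (2 * (α * ρ * innerKer α ρ x) -
      α * ρ * innerKer α ρ (x + h) - α * ρ * innerKer α ρ (x - h)) * kern α h := fun h ρ => by
    simp only [hΨ, secondDiff]; ring
  have hint : ∀ h : Euc n, x + h ≠ 0 → x - h ≠ 0 →
      IntegrableOn (fun ρ => Ψ (ρ, h)) (Ioc R R') ∧
      ∫ ρ in Ioc R R', Ψ (ρ, h) = secondDiff (torsion α R') x h * kern α h -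
        secondDiff (torsion α R) x h * kern α h := by
    intro h h1 h2
    obtain ⟨j0, w0⟩ := hA x hx0
    obtain ⟨j1, w1⟩ := hA _ h1
    obtain ⟨j2, w2⟩ := hA _ h2
    have j0' := Integrable.const_mul j0 2
    simp_rw [hform]
    refine ⟨((j0'.sub j1).sub j2).mul_const _, ?_⟩
    have s1 := integral_sub (j0'.sub j1) j2
    have s2 := integral_sub j0' j1
    simp only [Pi.sub_apply] at s1
    rw [integral_mul_const, s1, s2, integral_const_mul, w0, w1, w2]
    simp only [secondDiff]; ring
  have hΨi : Integrable Ψ ((volume.restrict (Ioc R R')).prod volume) := by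
    rw [integrable_prod_iff' hΨm.aestronglyMeasurable]
    refine ⟨by filter_upwards [hae] with h hh using (hint h hh.1 hh.2).1, ?_⟩
    have hfar : Integrable ({h : Euc n | η ≤ ‖h‖}.indicator
        (fun h => 4 * (R' ^ 2) ^ (α / 2) * kern α h)) :=
      ((memLAlpha_const (n := n) hα0 (4 * (R' ^ 2) ^ (α / 2))).integrableOn_kern hα0
        hη0).integrable_indicator (measurableSet_le_norm η)
    have hdom := (i1.abs.add i2.abs).add hfar
    refine hdom.mono' hΨm.aestronglyMeasurable.norm.prod_swap.integral_prod_right' ?_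
    filter_upwards [hae] with h hh
    obtain ⟨hi, hv⟩ := hint h hh.1 hh.2
    simp only [Pi.add_apply]
    rw [Real.norm_of_nonneg (integral_nonneg fun _ => norm_nonneg _)]
    have hk := kern_nonneg α h
    by_cases hhη : η ≤ ‖h‖
    · rw [indicator_of_mem (by exact hhη)]
      obtain ⟨j0, w0⟩ := hA x hx0
      obtain ⟨j1, w1⟩ := hA _ hh.1
      obtain ⟨j2, w2⟩ := hA _ hh.2
      have j3 := ((Integrable.const_mul j0 2).add j1).add j2
      have hle : ∫ ρ in Ioc R R', ‖Ψ (ρ, h)‖ ≤ ∫ ρ in Ioc R R', (2 * (α * ρ * innerKer α ρ x) +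
          α * ρ * innerKer α ρ (x + h) + α * ρ * innerKer α ρ (x - h)) * kern α h := by
        refine setIntegral_mono_on hi.norm (j3.mul_const _) measurableSet_Ioc fun ρ hρ => ?_
        have hρ0 : 0 < ρ := hR.trans hρ.1
        have p0 := mul_nonneg (mul_nonneg hα0.le hρ0.le) (innerKer_nonneg α ρ x)
        have p1 := mul_nonneg (mul_nonneg hα0.le hρ0.le) (innerKer_nonneg α ρ (x + h))
        have p2 := mul_nonneg (mul_nonneg hα0.le hρ0.le) (innerKer_nonneg α ρ (x - h))
        rw [hform, norm_mul, Real.norm_of_nonneg hk, Real.norm_eq_abs]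
        gcongr
        rw [abs_le]; constructor <;> linarith
      refine hle.trans ?_
      have s1 := integral_add ((Integrable.const_mul j0 2).add j1) j2
      have s2 := integral_add (Integrable.const_mul j0 2) j1
      simp only [Pi.add_apply] at s1
      rw [integral_mul_const, s1, s2, integral_const_mul, w0, w1, w2]
      have b0 := torsion_le (R := R') hα0 x
      have b1 := torsion_le (R := R') hα0 (x + h)
      have b2 := torsion_le (R := R') hα0 (x - h)
      have c0 := torsion_nonneg α R x
      have c1 := torsion_nonneg α R (x + h)
      have c2 := torsion_nonneg α R (x - h)
      have : (2 * (torsion α R' x - torsion α R x) + (torsion α R' (x + h) - torsion α R (x + h)) +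
          (torsion α R' (x - h) - torsion α R (x - h))) * kern α h ≤
          4 * (R' ^ 2) ^ (α / 2) * kern α h := by
        gcongr; linarith
      have d1 := abs_nonneg (secondDiff (torsion α R) x h * kern α h)
      have d2 := abs_nonneg (secondDiff (torsion α R') x h * kern α h)
      linarith
    -- For |h| < η the points x ± h stay inside all the balls involved. Convexity of the layers then
    -- fixes the sign of Ψ, so its absolute integral is again a difference of torsion terms.
    · rw [indicator_of_notMem (by exact hhη), add_zero]
      have hneg : ∫ ρ in Ioc R R', ‖Ψ (ρ, h)‖ = ∫ ρ in Ioc R R', -Ψ (ρ, h) := by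
        refine setIntegral_congr_fun measurableSet_Ioc fun ρ hρ => ?_
        have hρ0 : 0 < ρ := hR.trans hρ.1
        have := secondDiff_innerKer_nonpos (x := x) (h := h) hα2
          (show ‖x‖ + ‖h‖ < ρ by linarith [not_le.1 hhη, hρ.1])
        rw [Real.norm_of_nonpos]
        exact mul_nonpos_of_nonneg_of_nonpos (by positivity)
          (mul_nonpos_of_nonpos_of_nonneg this hk)
      rw [hneg, integral_neg, hv]
      have d1 := le_abs_self (secondDiff (torsion α R) x h * kern α h)
      have d2 := neg_abs_le (secondDiff (torsion α R') x h * kern α h)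
      linarith
  have hF := integral_integral_swap (f := fun ρ h => Ψ (ρ, h)) hΨi
  have hzero : ∫ ρ in Ioc R R', ∫ h, Ψ (ρ, h) = 0 := by
    refine (setIntegral_congr_fun measurableSet_Ioc fun ρ hρ => ?_).trans (integral_zero _ _)
    simp only [hΨ]
    rw [integral_const_mul, integral_secondDiff_innerKer hα0 hα2 (hx.trans hρ.1), mul_zero]
  have hdiff : ∫ h, ∫ ρ in Ioc R R', Ψ (ρ, h) = torsionLap α R' x - torsionLap α R x := by
    rw [torsionLap, torsionLap, ← integral_sub i2 i1]
    refine integral_congr_ae ?_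
    filter_upwards [hae] with h hh using (hint h hh.1 hh.2).2
  rw [hdiff, hzero] at hF
  linarith

/-- The profile scales like c^α, the kernel like c^(-n-α) and the measure like c^n, so the total
degree is 0. -/
lemma torsionLap_smul {n : ℕ} {α R c : ℝ} (hc : 0 < c) (x : Euc n) :
    torsionLap α (c * R) (c • x) = torsionLap α R x := by
  have ht : ∀ z : Euc n, torsion α (c * R) (c • z) = c ^ α * torsion α R z := by
    intro z
    rw [torsion, torsion, norm_smul, Real.norm_of_nonneg hc.le,
      show (c * R) ^ 2 - (c * ‖z‖) ^ 2 = c ^ (2 : ℝ) * (R ^ 2 - ‖z‖ ^ 2) by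
        rw [Real.rpow_two]; ring,
      show max (c ^ (2 : ℝ) * (R ^ 2 - ‖z‖ ^ 2)) 0 = c ^ (2 : ℝ) * max (R ^ 2 - ‖z‖ ^ 2) 0 by
        rw [mul_max_of_nonneg _ _ (by positivity), mul_zero],
      Real.mul_rpow (by positivity) (by positivity), ← Real.rpow_mul hc.le]
    congr 2; ring
  have h1 := Measure.integral_comp_smul (volume : Measure (Euc n))
    (fun h => secondDiff (torsion α (c * R)) (c • x) h * kern α h) c
  rw [finrank_euclideanSpace_fin, abs_of_pos (by positivity), smul_eq_mul] at h1
  have h2 : ∀ h : Euc n, secondDiff (torsion α (c * R)) (c • x) (c • h) * kern α (c • h) =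
      (c ^ n)⁻¹ * (secondDiff (torsion α R) x h * kern α h) := by
    intro h
    rw [secondDiff, ← smul_add, ← smul_sub, ht, ht, ht, kern, norm_smul, Real.norm_of_nonneg hc.le,
      Real.mul_rpow hc.le (norm_nonneg _), neg_add, Real.rpow_add hc, Real.rpow_neg hc.le,
      Real.rpow_neg hc.le, Real.rpow_natCast, secondDiff, kern, neg_add]
    have : c ^ α ≠ 0 := by positivity
    field_simp
  simp_rw [h2] at h1
  rw [integral_const_mul] at h1
  exact (mul_left_cancel₀ (by positivity) h1).symm

lemma torsionLap_isometry {n : ℕ} {α R : ℝ} (U : Euc n ≃ₗᵢ[ℝ] Euc n) (x : Euc n) :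
    torsionLap α R (U x) = torsionLap α R x := by
  have ht : ∀ z : Euc n, torsion α R (U z) = torsion α R z := fun z => by simp [torsion]
  rw [torsionLap, torsionLap, ← U.measurePreserving.integral_comp
    U.toHomeomorph.measurableEmbedding]
  simp only [secondDiff, ← map_add, ← map_sub, ht, kern, LinearIsometryEquiv.norm_map]

lemma exists_isometry_map_eq {n : ℕ} {x y : Euc n} (h : ‖x‖ = ‖y‖) :
    ∃ U : Euc n ≃ₗᵢ[ℝ] Euc n, U x = y :=
  ⟨(ℝ ∙ (x - y))ᗮ.reflection, Submodule.reflection_sub h⟩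

/-- The torsion profile has constant fractional Laplacian inside its ball. -/
lemma exists_torsionLap_eq_const (n : ℕ) [Nontrivial (Euc n)] {α : ℝ} (hα0 : 0 < α)
    (hα2 : α < 2) : ∃ K : ℝ, ∀ (R : ℝ) (x : Euc n), x ≠ 0 → ‖x‖ < R → torsionLap α R x = K := by
  obtain ⟨e, he⟩ := exists_norm_eq (Euc n) (show (0 : ℝ) ≤ 1 / 2 by norm_num)
  refine ⟨torsionLap α 1 e, fun R x hx0 hxR => ?_⟩
  have hr : 0 < ‖x‖ := norm_pos_iff.2 hx0
  -- Replacing R by 2|x| puts every point at relative radius 1/2, so a dilation and a rotation carry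
  -- it to e.
  have h1 : torsionLap α R x = torsionLap α (2 * ‖x‖) x := by
    rcases le_total R (2 * ‖x‖) with h | h
    · exact (torsionLap_eq_of_lt hα0 hα2 hx0 hxR h).symm
    · exact torsionLap_eq_of_lt hα0 hα2 hx0 (by linarith) h
  have h2 := torsionLap_smul (α := α) (R := 1) (by positivity : 0 < 2 * ‖x‖) ((2 * ‖x‖)⁻¹ • x)
  rw [mul_one, smul_inv_smul₀ (by positivity)] at h2
  obtain ⟨U, hU⟩ := exists_isometry_map_eq (x := e) (y := (2 * ‖x‖)⁻¹ • x) (by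
    rw [norm_smul, Real.norm_of_nonneg (by positivity), he]; field_simp)
  rw [h1, h2, ← hU, torsionLap_isometry]

/-! ### The potential of the inner profile outside its ball. -/

lemma lintegral_smul_eq {E : Type*} [NormedAddCommGroup E] [NormedSpace ℝ E] [MeasurableSpace E]
    [BorelSpace E] [FiniteDimensional ℝ E] (μ : Measure E) [μ.IsAddHaarMeasure] {f : E → ENNReal}
    (hf : Measurable f) {c : ℝ} (hc : 0 < c) :
    ∫⁻ x, f x ∂μ = ENNReal.ofReal (c ^ Module.finrank ℝ E) * ∫⁻ x, f (c • x) ∂μ := by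
  have h1 := Measure.map_addHaar_smul μ hc.ne'
  have h2 : ∫⁻ x, f (c • x) ∂μ = ∫⁻ x, f x ∂(Measure.map (c • ·) μ) :=
    (lintegral_map hf (measurable_const_smul c)).symm
  rw [h2, h1, lintegral_smul_measure, smul_eq_mul, ← mul_assoc, ← ENNReal.ofReal_mul (by positivity),
    abs_of_pos (by positivity), mul_inv_cancel₀ (by positivity), ENNReal.ofReal_one, one_mul]

lemma posPow_mul {β k : ℝ} (hk : 0 < k) (y : ℝ) : posPow β (k * y) = k ^ β * posPow β y := by
  unfold posPow
  by_cases hy : 0 < y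
  · rw [if_pos hy, if_pos (by positivity), Real.mul_rpow hk.le hy.le]
  · rw [if_neg hy, if_neg (fun h => hy (pos_of_mul_pos_right h hk.le)), mul_zero]

lemma posPow_of_nonpos {β y : ℝ} (hy : y ≤ 0) : posPow β y = 0 := by
  rw [posPow, if_neg (not_lt.2 hy)]

/-- First moment of a symmetric chord profile. -/
lemma lintegral_mul_posPow_centered {β s₀ h : ℝ} (hh : 0 < h) (hs : h < s₀) :
    ∫⁻ σ, ENNReal.ofReal (σ * posPow β (h ^ 2 - (σ - s₀) ^ 2)) =
      ENNReal.ofReal (s₀ * h ^ (2 * β + 1)) * ∫⁻ τ : ℝ, ENNReal.ofReal (posPow β (1 - τ ^ 2)) := by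
  have e1 : ∫⁻ σ, ENNReal.ofReal (σ * posPow β (h ^ 2 - (σ - s₀) ^ 2)) =
      ∫⁻ τ, ENNReal.ofReal ((s₀ + τ) * posPow β (h ^ 2 - τ ^ 2)) := by
    rw [← lintegral_add_left_eq_self _ s₀]; simp
  have e2 : ∫⁻ τ, ENNReal.ofReal ((s₀ + τ) * posPow β (h ^ 2 - τ ^ 2)) =
      ∫⁻ τ, ENNReal.ofReal ((s₀ - τ) * posPow β (h ^ 2 - τ ^ 2)) := by
    rw [← lintegral_neg_eq_self]; simp [sub_eq_add_neg]
  have hm : Measurable fun τ : ℝ => ENNReal.ofReal ((s₀ + τ) * posPow β (h ^ 2 - τ ^ 2)) := by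
    fun_prop
  -- Adding the reflected integral removes τ. Since h < s₀, both s₀ + τ and s₀ - τ are positive on
  -- the support, so `ENNReal.ofReal` truncates nothing.
  have e3 : 2 * ∫⁻ τ, ENNReal.ofReal ((s₀ + τ) * posPow β (h ^ 2 - τ ^ 2)) =
      2 * (ENNReal.ofReal s₀ * ∫⁻ τ : ℝ, ENNReal.ofReal (posPow β (h ^ 2 - τ ^ 2))) := by
    rw [two_mul]
    nth_rw 2 [e2]
    rw [← lintegral_add_left hm, ← lintegral_const_mul _ (by fun_prop), ← lintegral_const_mul _ (by fun_prop)]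
    congr 1; ext τ
    have hs0 : 0 < s₀ := hh.trans hs
    by_cases hτ : 0 < h ^ 2 - τ ^ 2
    · have h3 : |τ| < h := by rw [← abs_of_pos hh]; exact sq_lt_sq.1 (by linarith)
      obtain ⟨h1, h2⟩ := abs_lt.1 h3
      have hp := posPow_nonneg β (h ^ 2 - τ ^ 2)
      rw [← ENNReal.ofReal_add (mul_nonneg (by linarith) hp) (mul_nonneg (by linarith) hp),
        ← ENNReal.ofReal_mul hs0.le, ← ENNReal.ofReal_ofNat 2, ← ENNReal.ofReal_mul (by norm_num)]
      congr 1; ring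
    · rw [posPow_of_nonpos (not_lt.1 hτ)]; simp
  have e4 := (ENNReal.mul_right_inj two_ne_zero ENNReal.ofNat_ne_top).1 e3
  rw [e1, e4, lintegral_smul_eq volume (by fun_prop) hh, Module.finrank_self, pow_one]
  have e5 : ∀ τ : ℝ, ENNReal.ofReal (posPow β (h ^ 2 - (h • τ) ^ 2)) =
      ENNReal.ofReal ((h ^ 2) ^ β) * ENNReal.ofReal (posPow β (1 - τ ^ 2)) := by
    intro τ
    rw [← ENNReal.ofReal_mul (by positivity), ← posPow_mul (by positivity), smul_eq_mul]
    congr 2; ring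
  simp_rw [e5]
  rw [lintegral_const_mul _ (by fun_prop), ← mul_assoc, ← mul_assoc, mul_assoc (ENNReal.ofReal s₀),
    ← ENNReal.ofReal_mul hh.le, ← ENNReal.ofReal_mul (hh.trans hs).le]
  congr 3
  rw [← Real.rpow_natCast, ← Real.rpow_mul hh.le, mul_comm h, ← Real.rpow_add_one hh.ne']
  norm_num

lemma image_inv_Ioi : (fun x : ℝ => x⁻¹) '' Ioi 0 = Ioi 0 := by
  ext t
  simp only [mem_image, mem_Ioi]
  exact ⟨fun ⟨x, hx, h⟩ => h ▸ inv_pos.2 hx, fun h => ⟨t⁻¹, inv_pos.2 h, inv_inv t⟩⟩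

/-- The integral of a chord profile along a ray from an exterior point. -/
lemma lintegral_exterior_chord {α D e : ℝ} (hD : 0 < D) (he : 0 < e) :
    ∫⁻ t in Ioi (0 : ℝ), ENNReal.ofReal (t ^ (-1 - α) * posPow (α / 2 - 1) (-D + 2 * e * t - t ^ 2)) =
      ENNReal.ofReal (e * D ^ (-α / 2 - 1) * posPow ((α - 1) / 2) (e ^ 2 - D)) *
        ∫⁻ τ : ℝ, ENNReal.ofReal (posPow (α / 2 - 1) (1 - τ ^ 2)) := by
  have hd : ∀ x ∈ Ioi (0 : ℝ), HasDerivWithinAt (fun x : ℝ => x⁻¹) (-(x ^ 2)⁻¹) (Ioi 0) x :=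
    fun x hx => (hasDerivAt_inv (ne_of_gt hx)).hasDerivWithinAt
  -- Under σ = 1/t the chord becomes an interval centred at e/D, and the powers of t together with
  -- the Jacobian leave the first power of σ. What remains is a first moment.
  have e1 : ∫⁻ t in Ioi (0 : ℝ),
      ENNReal.ofReal (t ^ (-1 - α) * posPow (α / 2 - 1) (-D + 2 * e * t - t ^ 2)) =
      ∫⁻ σ in Ioi (0 : ℝ), ENNReal.ofReal (D ^ (α / 2 - 1)) *
        ENNReal.ofReal (σ * posPow (α / 2 - 1) ((e ^ 2 - D) / D ^ 2 - (σ - e / D) ^ 2)) := by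
    conv_lhs => rw [← image_inv_Ioi]
    rw [lintegral_image_eq_lintegral_abs_deriv_mul measurableSet_Ioi hd inv_injective.injOn]
    refine setLIntegral_congr_fun measurableSet_Ioi fun σ hσ => ?_
    have hσ0 : 0 < σ := hσ
    rw [← ENNReal.ofReal_mul (abs_nonneg _), ← ENNReal.ofReal_mul (by positivity)]
    congr 1
    have f1 : -D + 2 * e * σ⁻¹ - σ⁻¹ ^ 2 =
        σ ^ (-2 : ℝ) * (D * ((e ^ 2 - D) / D ^ 2 - (σ - e / D) ^ 2)) := by
      rw [Real.rpow_neg hσ0.le, Real.rpow_two]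
      field_simp; ring
    rw [f1, posPow_mul (by positivity), posPow_mul hD, ← Real.rpow_mul hσ0.le, abs_neg,
      abs_of_pos (by positivity), Real.inv_rpow hσ0.le, ← Real.rpow_neg hσ0.le]
    have f2 : (σ ^ 2)⁻¹ * σ ^ (-(-1 - α)) * σ ^ (-2 * (α / 2 - 1)) = σ := by
      rw [← Real.rpow_two, ← Real.rpow_neg hσ0.le, ← Real.rpow_add hσ0, ← Real.rpow_add hσ0]
      rw [show -2 + -(-1 - α) + -2 * (α / 2 - 1) = 1 by ring, Real.rpow_one]
    linear_combination (D ^ (α / 2 - 1) *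
      posPow (α / 2 - 1) ((e ^ 2 - D) / D ^ 2 - (σ - e / D) ^ 2)) * f2
  rw [e1, lintegral_const_mul _ (by fun_prop)]
  by_cases hE : 0 < e ^ 2 - D
  · set h := Real.sqrt ((e ^ 2 - D) / D ^ 2) with hh
    have hh0 : 0 < h := Real.sqrt_pos.2 (by positivity)
    have hh2 : h ^ 2 = (e ^ 2 - D) / D ^ 2 := Real.sq_sqrt (by positivity)
    have hlt : h < e / D := by
      refine lt_of_pow_lt_pow_left₀ 2 (by positivity) ?_
      rw [hh2, div_pow]; gcongr; linarith
    have e2 : ∫⁻ σ in Ioi (0 : ℝ), ENNReal.ofReal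
        (σ * posPow (α / 2 - 1) ((e ^ 2 - D) / D ^ 2 - (σ - e / D) ^ 2)) =
        ∫⁻ σ, ENNReal.ofReal (σ * posPow (α / 2 - 1) (h ^ 2 - (σ - e / D) ^ 2)) := by
      rw [hh2, ← lintegral_indicator measurableSet_Ioi]
      congr 1; ext σ
      by_cases hσ : 0 < σ
      · rw [indicator_of_mem (by exact hσ)]
      · rw [indicator_of_notMem (by exact hσ), ENNReal.ofReal_of_nonpos]
        exact mul_nonpos_of_nonpos_of_nonneg (not_lt.1 hσ) (posPow_nonneg _ _)
    rw [e2, lintegral_mul_posPow_centered hh0 hlt, ← mul_assoc, ← ENNReal.ofReal_mul (by positivity)]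
    congr 2
    have e3 : h ^ (2 * (α / 2 - 1) + 1) = (e ^ 2 - D) ^ ((α - 1) / 2) / D ^ (α - 1) := by
      have : h ^ (2 * (α / 2 - 1) + 1) = (h ^ 2) ^ ((α - 1) / 2) := by
        rw [← Real.rpow_natCast, ← Real.rpow_mul hh0.le]; congr 1; push_cast; ring
      rw [this, hh2, Real.div_rpow hE.le (by positivity), ← Real.rpow_natCast D, ← Real.rpow_mul hD.le]
      congr 2; push_cast; ring
    have e4 : D ^ (-α / 2 - 1) = D ^ (α / 2 - 1) / D / D ^ (α - 1) := by
      rw [← Real.rpow_sub_one hD.ne', ← Real.rpow_sub hD]; congr 1; ring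
    rw [e3, e4, posPow, if_pos hE]
    field_simp
  · have hE' := not_lt.1 hE
    rw [posPow_of_nonpos hE', mul_zero, ENNReal.ofReal_zero, zero_mul]
    have : ∀ σ : ℝ, posPow (α / 2 - 1) ((e ^ 2 - D) / D ^ 2 - (σ - e / D) ^ 2) = 0 := fun σ =>
      posPow_of_nonpos (by
        have := div_nonpos_of_nonpos_of_nonneg hE' (sq_nonneg D)
        nlinarith [sq_nonneg (σ - e / D)])
    simp [this]

lemma lintegral_euc_succ {m : ℕ} {G : ℝ → ℝ → ENNReal} (hG : Measurable (Function.uncurry G)) :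
    ∫⁻ v : Euc (m + 1), G (v 0) ‖v‖ = ∫⁻ y : Euc m, ∫⁻ s, G s √(s ^ 2 + ‖y‖ ^ 2) := by
  have h1 : ∫⁻ v : Euc (m + 1), G (v 0) ‖v‖ =
      ∫⁻ f : Fin (m + 1) → ℝ, G (f 0) ‖(WithLp.toLp 2 f : Euc (m + 1))‖ :=
    ((PiLp.volume_preserving_toLp (Fin (m + 1))).lintegral_comp
      (f := fun v : Euc (m + 1) => G (v 0) ‖v‖)
      (hG.comp (f := fun v : Euc (m + 1) => (v 0, ‖v‖)) (by fun_prop))).symm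
  have h2 : ∫⁻ f : Fin (m + 1) → ℝ, G (f 0) ‖(WithLp.toLp 2 f : Euc (m + 1))‖ =
      ∫⁻ p : ℝ × (Fin m → ℝ), G p.1 √(p.1 ^ 2 + ‖(WithLp.toLp 2 p.2 : Euc m)‖ ^ 2) := by
    rw [← (volume_preserving_piFinSuccAbove (fun _ : Fin (m + 1) => ℝ) 0).lintegral_comp
      (f := fun p : ℝ × (Fin m → ℝ) => G p.1 √(p.1 ^ 2 + ‖(WithLp.toLp 2 p.2 : Euc m)‖ ^ 2))
      (hG.comp (f := fun p : ℝ × (Fin m → ℝ) => (p.1, √(p.1 ^ 2 + ‖(WithLp.toLp 2 p.2 : Euc m)‖ ^ 2)))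
        (by fun_prop))]
    refine lintegral_congr fun f => ?_
    rw [EuclideanSpace.norm_eq, EuclideanSpace.real_norm_sq_eq]
    congr 2
    rw [Fin.sum_univ_succ]
    simp [MeasurableEquiv.piFinSuccAbove, Fin.insertNthEquiv, Fin.tail]
  rw [h1, h2, Measure.volume_eq_prod, lintegral_prod_symm _ (by exact (hG.comp
    (f := fun p : ℝ × (Fin m → ℝ) => (p.1, √(p.1 ^ 2 + ‖(WithLp.toLp 2 p.2 : Euc m)‖ ^ 2)))
    (by fun_prop)).aemeasurable)]
  exact (PiLp.volume_preserving_toLp (Fin m)).lintegral_comp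
    (f := fun y : Euc m => ∫⁻ s, G s √(s ^ 2 + ‖y‖ ^ 2))
    (Measurable.lintegral_prod_right' (f := fun p : Euc m × ℝ => G p.2 √(p.2 ^ 2 + ‖p.1‖ ^ 2))
      (hG.comp (f := fun p : Euc m × ℝ => (p.2, √(p.2 ^ 2 + ‖p.1‖ ^ 2))) (by fun_prop)))

/-- Substitution s = √(t² - a²). For t ≤ a the root is 0 and division by zero gives the factor 0, so
the range of t need not depend on a; this permits the later exchange of integrals. -/
lemma lintegral_sqrt_add_sq {G : ℝ → ℝ → ENNReal} {a : ℝ} (ha : 0 ≤ a) :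
    ∫⁻ s in Ioi 0, G s √(s ^ 2 + a ^ 2) =
      ∫⁻ t in Ioi 0, ENNReal.ofReal (t / √(t ^ 2 - a ^ 2)) * G √(t ^ 2 - a ^ 2) t := by
  have hpos : ∀ t ∈ Ioi a, 0 < t ^ 2 - a ^ 2 := fun t ht => by
    have : a < t := ht
    nlinarith
  have him : (fun t => √(t ^ 2 - a ^ 2)) '' Ioi a = Ioi 0 := by
    ext s
    simp only [mem_image, mem_Ioi]
    constructor
    · rintro ⟨t, ht, rfl⟩
      exact Real.sqrt_pos.2 (hpos t ht)
    · intro hs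
      refine ⟨√(s ^ 2 + a ^ 2), Real.lt_sqrt_of_sq_lt (by nlinarith), ?_⟩
      rw [Real.sq_sqrt (by positivity), add_sub_cancel_right, Real.sqrt_sq hs.le]
  have hinj : InjOn (fun t => √(t ^ 2 - a ^ 2)) (Ioi a) := by
    intro s hs t ht h
    have h2 : s ^ 2 - a ^ 2 = t ^ 2 - a ^ 2 := by
      rw [← Real.sq_sqrt (hpos s hs).le, ← Real.sq_sqrt (hpos t ht).le]
      exact congrArg (· ^ 2) h
    have hs' : 0 ≤ s := ha.trans (le_of_lt hs)
    have ht' : 0 ≤ t := ha.trans (le_of_lt ht)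
    exact (sq_eq_sq₀ hs' ht').1 (by linarith)
  have hd : ∀ t ∈ Ioi a, HasDerivWithinAt (fun t => √(t ^ 2 - a ^ 2)) (t / √(t ^ 2 - a ^ 2))
      (Ioi a) t := by
    intro t ht
    have h := (((hasDerivAt_id t).pow 2).sub_const (a ^ 2)).sqrt (by simpa using (hpos t ht).ne')
    refine (h.congr_deriv ?_).hasDerivWithinAt
    simp only [id, Pi.pow_apply]
    have := (Real.sqrt_pos.2 (hpos t ht)).ne'
    field_simp
    simp
  conv_lhs => rw [← him]
  rw [lintegral_image_eq_lintegral_abs_deriv_mul measurableSet_Ioi hd hinj]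
  have hsub : Ioi a ⊆ Ioi 0 := Ioi_subset_Ioi ha
  have e : ∀ f : ℝ → ENNReal, ∫⁻ t in Ioi a, f t = ∫⁻ t in Ioi 0, (Ioi a).indicator f t := by
    intro f
    rw [lintegral_indicator measurableSet_Ioi, Measure.restrict_restrict measurableSet_Ioi,
      inter_eq_self_of_subset_left hsub]
  rw [e]
  symm
  refine setLIntegral_congr_fun measurableSet_Ioi fun t ht => ?_
  have ht0 : 0 < t := ht
  by_cases h : t ∈ Ioi a
  · have h0 : 0 < t := hsub h
    simp only [indicator_of_mem h]
    rw [abs_of_nonneg (by positivity), Real.sq_sqrt (hpos t h).le, sub_add_cancel, Real.sqrt_sq h0.le]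
  · have : t ^ 2 - a ^ 2 ≤ 0 := by
      have h' : ¬ a < t := h
      nlinarith [not_lt.1 h']
    simp only [indicator_of_notMem h]
    simp [Real.sqrt_eq_zero_of_nonpos this]

/-- Polar coordinates on a half-space, with a direction recorded by its component w orthogonal to
the axis: the surface measure is dw / √(1 - |w|²). Points with |w| ≥ 1 drop out through division by
zero. -/
lemma lintegral_half_space_rays {m : ℕ} {G : ℝ → ℝ → ENNReal}
    (hG : Measurable (Function.uncurry G)) :
    ∫⁻ y : Euc m, ∫⁻ s in Ioi 0, G s √(s ^ 2 + ‖y‖ ^ 2) =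
      ∫⁻ w : Euc m, ∫⁻ t in Ioi 0,
        ENNReal.ofReal (t ^ m / √(1 - ‖w‖ ^ 2)) * G (t * √(1 - ‖w‖ ^ 2)) t := by
  simp_rw [fun y : Euc m => lintegral_sqrt_add_sq (G := G) (norm_nonneg y)]
  have hm1 : Measurable (Function.uncurry fun (y : Euc m) (t : ℝ) =>
      ENNReal.ofReal (t / √(t ^ 2 - ‖y‖ ^ 2)) * G √(t ^ 2 - ‖y‖ ^ 2) t) :=
    Measurable.mul (by fun_prop)
      (hG.comp (g := Function.uncurry G) (f := fun p : Euc m × ℝ => (√(p.2 ^ 2 - ‖p.1‖ ^ 2), p.2))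
        (by fun_prop))
  have hm2 : Measurable (Function.uncurry fun (y : Euc m) (t : ℝ) =>
      ENNReal.ofReal (t ^ m / √(1 - ‖y‖ ^ 2)) * G (t * √(1 - ‖y‖ ^ 2)) t) :=
    Measurable.mul (by fun_prop)
      (hG.comp (g := Function.uncurry G) (f := fun p : Euc m × ℝ => (p.2 * √(1 - ‖p.1‖ ^ 2), p.2))
        (by fun_prop))
  rw [lintegral_lintegral_swap hm1.aemeasurable, lintegral_lintegral_swap hm2.aemeasurable]
  refine setLIntegral_congr_fun measurableSet_Ioi fun t ht => ?_
  have ht0 : 0 < t := ht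
  have hmt : Measurable fun y : Euc m =>
      ENNReal.ofReal (t / √(t ^ 2 - ‖y‖ ^ 2)) * G √(t ^ 2 - ‖y‖ ^ 2) t :=
    hm1.comp (measurable_id.prodMk measurable_const)
  rw [lintegral_smul_eq volume hmt ht0, finrank_euclideanSpace_fin,
    ← lintegral_const_mul _ (by exact hmt.comp (measurable_const_smul t))]
  refine lintegral_congr fun w => ?_
  have e : √(t ^ 2 - ‖t • w‖ ^ 2) = t * √(1 - ‖w‖ ^ 2) := by
    rw [norm_smul, Real.norm_of_nonneg ht0.le,
      show t ^ 2 - (t * ‖w‖) ^ 2 = t ^ 2 * (1 - ‖w‖ ^ 2) by ring, Real.sqrt_mul (by positivity),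
      Real.sqrt_sq ht0.le]
  simp only [e, ← mul_assoc]
  rw [← ENNReal.ofReal_mul (by positivity)]
  congr 2
  rw [← mul_div_assoc, mul_comm t √_, mul_div_mul_right _ _ ht0.ne']

/-- The Riesz-type potential of the profile `(ρ² - ‖x‖²)₊ ^ (α/2 - 1)` outside the ball. -/
lemma exists_lintegral_innerKer_kern (n : ℕ) [Nontrivial (Euc n)] (α : ℝ) :
    ∃ κ : ENNReal, ∀ (ρ : ℝ) (z : Euc n), 0 < ρ → ρ < ‖z‖ →
      ∫⁻ x, ENNReal.ofReal (innerKer α ρ x * kern α (x - z)) =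
        ENNReal.ofReal (‖z‖ * (ρ / ‖z‖) ^ (n - 1) * ρ ^ (α - 1) *
          (‖z‖ ^ 2 - ρ ^ 2) ^ (-α / 2 - 1)) * κ := by
  obtain ⟨m, rfl⟩ := Nat.exists_eq_succ_of_ne_zero (ne_zero_of_nontrivial n)
  -- The mass of the unit chord profile times an integral over directions. Its finiteness is not
  -- needed here; `exists_torsionLap_exterior` deduces it.
  refine ⟨(∫⁻ τ : ℝ, ENNReal.ofReal (posPow (α / 2 - 1) (1 - τ ^ 2))) *
    ∫⁻ w : Euc m, ENNReal.ofReal (posPow ((α - 1) / 2) (1 - ‖w‖ ^ 2)), fun ρ z hρ hz => ?_⟩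
  set r := ‖z‖ with hr
  have hr0 : 0 < r := hρ.trans hz
  set D := r ^ 2 - ρ ^ 2 with hD
  have hD0 : 0 < D := by rw [hD]; nlinarith
  -- After a rotation, the ball as seen from the exterior point lies in the half-space of positive
  -- first coordinate.
  set z₀ : Euc (m + 1) := EuclideanSpace.single 0 (-r) with hz₀
  obtain ⟨U, hU⟩ := exists_isometry_map_eq (x := z₀) (y := z) (by simp [hz₀, hr0.le, ← hr])
  have h1 : ∫⁻ x, ENNReal.ofReal (innerKer α ρ x * kern α (x - z)) =
      ∫⁻ x, ENNReal.ofReal (innerKer α ρ x * kern α (x - z₀)) := by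
    have hm : Measurable fun x => ENNReal.ofReal (innerKer α ρ x * kern α (x - z)) := by
      unfold innerKer; fun_prop
    rw [← U.measurePreserving.lintegral_comp hm]
    simp [innerKer, kern, ← hU, ← map_sub]
  set G : ℝ → ℝ → ENNReal := fun s t => ENNReal.ofReal
    (posPow (α / 2 - 1) (-D + 2 * r * s - t ^ 2) * t ^ (-(((m + 1 : ℕ) : ℝ) + α))) with hGdef
  have hG : Measurable (Function.uncurry G) := by unfold Function.uncurry; fun_prop
  have h2 : ∫⁻ x, ENNReal.ofReal (innerKer α ρ x * kern α (x - z₀)) =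
      ∫⁻ v : Euc (m + 1), G (v 0) ‖v‖ := by
    rw [← lintegral_add_right_eq_self _ z₀]
    refine lintegral_congr fun v => ?_
    simp only [hGdef, innerKer, kern, add_sub_cancel_right]
    congr 3
    have : inner ℝ v z₀ = -r * v 0 := by simp [hz₀, EuclideanSpace.inner_single_right]
    have h' : ‖z₀‖ = r := by simp [hz₀, hr0.le]
    rw [norm_add_sq_real, this, h', hD]
    ring
  have h3 : ∀ y : Euc m, ∫⁻ s, G s √(s ^ 2 + ‖y‖ ^ 2) = ∫⁻ s in Ioi 0, G s √(s ^ 2 + ‖y‖ ^ 2) := by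
    intro y
    rw [← lintegral_indicator measurableSet_Ioi]
    refine lintegral_congr fun s => ?_
    by_cases hs : 0 < s
    · rw [indicator_of_mem (by exact hs)]
    · rw [indicator_of_notMem (by exact hs)]
      simp only [hGdef]
      rw [posPow_of_nonpos, zero_mul, ENNReal.ofReal_zero]
      nlinarith [sq_nonneg √(s ^ 2 + ‖y‖ ^ 2), mul_nonneg hr0.le (neg_nonneg.2 (not_lt.1 hs))]
  -- On each ray the exterior chord formula applies with e = r √(1 - |w|²), whose root cancels the
  -- surface density. The remaining function of w is a power supported in |w| < ρ/r, so rescaling by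
  -- ρ/r extracts all dependence on ρ and r.
  have h4 : ∀ w : Euc m, ∫⁻ t in Ioi 0,
        ENNReal.ofReal (t ^ m / √(1 - ‖w‖ ^ 2)) * G (t * √(1 - ‖w‖ ^ 2)) t =
      ENNReal.ofReal (r * D ^ (-α / 2 - 1)) *
        (ENNReal.ofReal (posPow ((α - 1) / 2) (ρ ^ 2 - r ^ 2 * ‖w‖ ^ 2)) *
        ∫⁻ τ : ℝ, ENNReal.ofReal (posPow (α / 2 - 1) (1 - τ ^ 2))) := by
    intro w
    set c := √(1 - ‖w‖ ^ 2) with hc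
    by_cases hw : 0 < 1 - ‖w‖ ^ 2
    · have hc0 : 0 < c := Real.sqrt_pos.2 hw
      have hcc : c ^ 2 = 1 - ‖w‖ ^ 2 := Real.sq_sqrt hw.le
      have e1 : ∫⁻ t in Ioi 0, ENNReal.ofReal (t ^ m / c) * G (t * c) t =
          ENNReal.ofReal (1 / c) * ∫⁻ t in Ioi (0 : ℝ), ENNReal.ofReal
            (t ^ (-1 - α) * posPow (α / 2 - 1) (-D + 2 * (r * c) * t - t ^ 2)) := by
        rw [← lintegral_const_mul _ (by fun_prop)]
        refine setLIntegral_congr_fun measurableSet_Ioi fun t ht => ?_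
        have ht0 : 0 < t := ht
        simp only [hGdef]
        rw [← ENNReal.ofReal_mul (by positivity), ← ENNReal.ofReal_mul (by positivity)]
        have : t ^ m * t ^ (-(((m + 1 : ℕ) : ℝ) + α)) = t ^ (-1 - α) := by
          rw [← Real.rpow_natCast, ← Real.rpow_add ht0]; congr 1; push_cast; ring
        rw [← this, show 2 * r * (t * c) = 2 * (r * c) * t by ring]
        congr 1; ring
      rw [e1, lintegral_exterior_chord hD0 (mul_pos hr0 hc0), ← mul_assoc, ← mul_assoc,
        ← ENNReal.ofReal_mul (by positivity), ← ENNReal.ofReal_mul (by positivity)]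
      congr 2
      rw [show (r * c) ^ 2 - D = ρ ^ 2 - r ^ 2 * ‖w‖ ^ 2 by rw [mul_pow, hcc, hD]; ring]
      field_simp
    · have : c = 0 := Real.sqrt_eq_zero_of_nonpos (not_lt.1 hw)
      rw [this, posPow_of_nonpos (y := ρ ^ 2 - r ^ 2 * ‖w‖ ^ 2)]
      · simp
      · nlinarith [not_lt.1 hw, sq_nonneg r]
  rw [h1, h2, lintegral_euc_succ hG]
  simp_rw [h3]
  rw [lintegral_half_space_rays hG]
  simp_rw [h4]
  rw [lintegral_const_mul _ (by fun_prop), lintegral_mul_const _ (by fun_prop),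
    lintegral_smul_eq volume (c := ρ / r) (by fun_prop) (by positivity), finrank_euclideanSpace_fin]
  have h5 : ∀ w : Euc m, ENNReal.ofReal (posPow ((α - 1) / 2) (ρ ^ 2 - r ^ 2 * ‖(ρ / r) • w‖ ^ 2)) =
      ENNReal.ofReal (ρ ^ (α - 1)) * ENNReal.ofReal (posPow ((α - 1) / 2) (1 - ‖w‖ ^ 2)) := by
    intro w
    have : ρ ^ 2 - r ^ 2 * ‖(ρ / r) • w‖ ^ 2 = ρ ^ 2 * (1 - ‖w‖ ^ 2) := by
      rw [norm_smul, Real.norm_of_nonneg (by positivity)]; field_simp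
    rw [this, posPow_mul (by positivity), ← ENNReal.ofReal_mul (by positivity)]
    congr 2
    rw [← Real.rpow_natCast, ← Real.rpow_mul hρ.le]; congr 1; push_cast; ring
  simp_rw [h5]
  rw [lintegral_const_mul _ (by fun_prop)]
  have h6 : r * (ρ / r) ^ (m + 1 - 1) * ρ ^ (α - 1) * D ^ (-α / 2 - 1) =
    (r * D ^ (-α / 2 - 1)) * ((ρ / r) ^ m * ρ ^ (α - 1)) := by
    rw [Nat.add_sub_cancel]; ring
  rw [h6, ENNReal.ofReal_mul (p := r * D ^ (-α / 2 - 1)) (by positivity),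
    ENNReal.ofReal_mul (p := (ρ / r) ^ m) (by positivity)]
  ring

/-! ### The torsion profile outside its ball. -/

/-- The average of `outerKer` over the radii below `R`, with density `n ρ ^ (n - 1)`. -/
noncomputable def outerMean {n : ℕ} (α R : ℝ) (x : Euc n) : ℝ :=
  n * ∫ ρ in Ioc 0 R, ρ ^ (n - 1) * outerKer α ρ x

/-- The ρ-derivative of ρ^n times the exterior kernel is the stated density plus n ρ^(n-1) times
that kernel, because r² = (r² - ρ²) + ρ². The boundary term at 0 vanishes. -/
lemma integral_exterior_density {n : ℕ} (hn : n ≠ 0) {α R r : ℝ} (hα : 0 < α) (hR : 0 < R)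
    (hr : R < r) :
    IntegrableOn (fun ρ => α * ρ * (r * (ρ / r) ^ (n - 1) * ρ ^ (α - 1) *
      (r ^ 2 - ρ ^ 2) ^ (-α / 2 - 1))) (Ioc 0 R) ∧
    ∫ ρ in Ioc 0 R, α * ρ * (r * (ρ / r) ^ (n - 1) * ρ ^ (α - 1) *
      (r ^ 2 - ρ ^ 2) ^ (-α / 2 - 1)) =
    R ^ n * (R ^ α / (r ^ n * (r ^ 2 - R ^ 2) ^ (α / 2))) -
      n * ∫ ρ in Ioc 0 R, ρ ^ (n - 1) * (ρ ^ α / (r ^ n * (r ^ 2 - ρ ^ 2) ^ (α / 2))) := by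
  have hr0 : 0 < r := hR.trans hr
  have hpos : ∀ ρ ∈ Icc 0 R, 0 < r ^ 2 - ρ ^ 2 := fun ρ hρ => by nlinarith [hρ.1, hρ.2]
  set F : ℝ → ℝ := fun ρ => ρ ^ n * (ρ ^ α / (r ^ n * (r ^ 2 - ρ ^ 2) ^ (α / 2))) with hF
  set G : ℝ → ℝ := fun ρ => α * (ρ ^ α * (r * (ρ / r) ^ (n - 1) *
      (r ^ 2 - ρ ^ 2) ^ (-α / 2 - 1))) with hG
  set H : ℝ → ℝ := fun ρ => ρ ^ (n - 1) * (ρ ^ α / (r ^ n * (r ^ 2 - ρ ^ 2) ^ (α / 2))) with hH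
  have hden : ContinuousOn (fun ρ : ℝ => ρ ^ α / (r ^ n * (r ^ 2 - ρ ^ 2) ^ (α / 2))) (Icc 0 R) := by
    refine ContinuousOn.div (fun ρ _ => (Real.continuousAt_rpow_const _ _ (Or.inr hα.le)).continuousWithinAt)
      ?_ fun ρ hρ => ?_
    · exact continuousOn_const.mul (ContinuousOn.rpow_const (by fun_prop) fun ρ hρ => Or.inl (hpos ρ hρ).ne')
    · have := hpos ρ hρ; positivity
  have hFc : ContinuousOn F (Icc 0 R) := (by fun_prop : ContinuousOn (fun ρ : ℝ => ρ ^ n) _).mul hden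
  have hHc : ContinuousOn H (Icc 0 R) := (by fun_prop : ContinuousOn (fun ρ : ℝ => ρ ^ (n-1)) _).mul hden
  have hGc : ContinuousOn G (Icc 0 R) := by
    refine continuousOn_const.mul (ContinuousOn.mul
      (fun ρ _ => (Real.continuousAt_rpow_const _ _ (Or.inr hα.le)).continuousWithinAt) (ContinuousOn.mul (by fun_prop) ?_))
    exact ContinuousOn.rpow_const (by fun_prop) fun ρ hρ => Or.inl (hpos ρ hρ).ne'
  have hd : ∀ ρ ∈ Ioo 0 R, HasDerivAt F (G ρ + n * H ρ) ρ := by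
    intro ρ hρ
    have hρ0 : 0 < ρ := hρ.1
    have hp := hpos ρ ⟨hρ.1.le, hρ.2.le⟩
    have d1 : HasDerivAt (fun ρ : ℝ => r ^ 2 - ρ ^ 2) (-(2 * ρ)) ρ := by
      simpa using ((hasDerivAt_id ρ).pow 2).const_sub (r ^ 2)
    have d2 := d1.rpow_const (p := -(α / 2)) (Or.inl hp.ne')
    have d3 := (hasDerivAt_pow n ρ).mul (((Real.hasDerivAt_rpow_const (p := α) (Or.inl hρ0.ne')).mul d2).const_mul
      (r ^ n)⁻¹)
    have hFeq : F =ᶠ[𝓝 ρ] ((fun x : ℝ => x ^ n) * fun x => (r ^ n)⁻¹ *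
        ((fun x : ℝ => x ^ α) * fun x : ℝ => (r ^ 2 - x ^ 2) ^ (-(α / 2))) x) := by
      filter_upwards [Ioo_mem_nhds hρ.1 hρ.2] with x hx
      have hpx := hpos x ⟨hx.1.le, hx.2.le⟩
      simp only [hF, Pi.mul_apply]
      rw [Real.rpow_neg hpx.le]
      field_simp
    refine (d3.congr_of_eventuallyEq hFeq).congr_deriv ?_
    simp only [Pi.mul_apply, hG, hH]
    set S := r ^ 2 - ρ ^ 2 with hS
    have e1 : S ^ (-α / 2 - 1) = S ^ (-(α / 2)) / S := by
      rw [← Real.rpow_sub_one hp.ne']; congr 1; ring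
    have e2 : S ^ (-(α / 2) - 1) = S ^ (-(α / 2)) / S := Real.rpow_sub_one hp.ne' _
    have e3 : ρ ^ (α - 1) = ρ ^ α / ρ := Real.rpow_sub_one hρ0.ne' _
    have e4 : S ^ (α / 2) = (S ^ (-(α / 2)))⁻¹ := by rw [Real.rpow_neg hp.le, inv_inv]
    have hQ : 0 < S ^ (-(α / 2)) := by positivity
    rw [e1, e2, e3, e4]
    obtain ⟨m, rfl⟩ := Nat.exists_eq_succ_of_ne_zero hn
    simp only [Nat.succ_eq_add_one, Nat.add_sub_cancel, div_pow]
    have hSr : r ^ 2 = S + ρ ^ 2 := by rw [hS]; ring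
    field_simp
    linear_combination (-(ρ ^ m * ρ * α * r ^ m)) * hSr
  have hGi : IntegrableOn G (Ioc 0 R) := (hGc.integrableOn_Icc).mono_set Ioc_subset_Icc_self
  have hHi : IntegrableOn H (Ioc 0 R) := (hHc.integrableOn_Icc).mono_set Ioc_subset_Icc_self
  have hGH : EqOn (fun ρ => α * ρ * (r * (ρ / r) ^ (n - 1) * ρ ^ (α - 1) *
      (r ^ 2 - ρ ^ 2) ^ (-α / 2 - 1))) G (Ioc 0 R) := by
    intro ρ hρ
    simp only [hG]
    rw [Real.rpow_sub_one hρ.1.ne']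
    have := hρ.1.ne'
    field_simp
  refine ⟨hGi.congr_fun hGH.symm measurableSet_Ioc, ?_⟩
  rw [setIntegral_congr_fun measurableSet_Ioc hGH]
  have hF := intervalIntegral.integral_eq_sub_of_hasDerivAt_of_le hR.le hFc hd
    ((intervalIntegrable_iff_integrableOn_Ioc_of_le hR.le).2 (hGi.add (Integrable.const_mul hHi (n : ℝ))))
  rw [intervalIntegral.integral_of_le hR.le, integral_add hGi (Integrable.const_mul hHi (n : ℝ)),
    integral_const_mul (n : ℝ) H] at hF
  have hF0 : F 0 = 0 := by simp [F, hn]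
  have hFR : F R = R ^ n * (R ^ α / (r ^ n * (r ^ 2 - R ^ 2) ^ (α / 2))) := rfl
  rw [hF0] at hF
  linarith

lemma integrable_torsion_mul_kern {n : ℕ} [Nontrivial (Euc n)] {α R : ℝ} (hα : 0 < α) (hR : 0 < R)
    {x : Euc n} (hx : R < ‖x‖) : Integrable (fun z => torsion α R z * kern α (z - x)) := by
  refine ((integrable_torsion hα hR.le).mul_const ((‖x‖ - R) ^ (-((n : ℝ) + α)))).mono'
    (Measurable.aestronglyMeasurable (by fun_prop)) (Eventually.of_forall fun z => ?_)
  rw [Real.norm_of_nonneg (mul_nonneg (torsion_nonneg _ _ _) (kern_nonneg _ _))]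
  by_cases hz : R ≤ ‖z‖
  · rw [torsion_eq_zero hα hR.le hz]; simp
  · refine mul_le_mul_of_nonneg_left ?_ (torsion_nonneg _ _ _)
    refine Real.rpow_le_rpow_of_nonpos (by linarith) ?_ ?_
    · have := norm_sub_norm_le x z
      rw [norm_sub_rev z x]; linarith
    · have : (0:ℝ) ≤ n := by positivity
      linarith

/-- Outside the ball the central term is zero, and the two shifted terms agree because the kernel is
even. -/
lemma torsionLap_exterior_eq {n : ℕ} [Nontrivial (Euc n)] {α R : ℝ} (hα : 0 < α) (hR : 0 < R)
    {x : Euc n} (hx : R < ‖x‖) :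
    torsionLap α R x = -2 * ∫ z, torsion α R z * kern α (z - x) := by
  have hi := integrable_torsion_mul_kern hα hR hx
  have i1 : Integrable (fun h => torsion α R (x + h) * kern α h) := by
    simpa only [add_sub_cancel_left] using hi.comp_add_left x
  have i2 : Integrable (fun h => torsion α R (x - h) * kern α h) := by
    simpa [sub_eq_add_neg, kern_neg] using i1.comp_neg
  have v1 : ∫ h, torsion α R (x + h) * kern α h = ∫ z, torsion α R z * kern α (z - x) := by
    simpa using integral_add_left_eq_self (fun z => torsion α R z * kern α (z - x)) x
  have v2 : ∫ h, torsion α R (x - h) * kern α h = ∫ z, torsion α R z * kern α (z - x) := by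
    rw [← v1, ← integral_neg_eq_self]; simp [kern_neg]
  have h0 : ∀ h, secondDiff (torsion α R) x h * kern α h =
      -(torsion α R (x + h) * kern α h + torsion α R (x - h) * kern α h) := fun h => by
    rw [secondDiff, torsion_eq_zero hα hR.le hx.le]; ring
  rw [torsionLap]
  simp_rw [h0]
  rw [integral_neg, integral_add i1 i2, v1, v2]
  ring

lemma outerMean_of_lt {n : ℕ} {α R : ℝ} {x : Euc n} (hx : R < ‖x‖) :
    outerMean α R x = n * ∫ ρ in Ioc 0 R, ρ ^ (n - 1) *
      (ρ ^ α / (‖x‖ ^ n * (‖x‖ ^ 2 - ρ ^ 2) ^ (α / 2))) := by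
  unfold outerMean
  congr 1
  refine setIntegral_congr_fun measurableSet_Ioc fun ρ hρ => ?_
  simp only [outerKer, if_pos (hρ.2.trans_lt hx)]

/-- Outside its ball, the torsion profile has an explicit fractional Laplacian, up to a positive
factor. -/
lemma exists_torsionLap_exterior (n : ℕ) [Nontrivial (Euc n)] {α : ℝ} (hα0 : 0 < α) :
    ∃ C : ℝ, 0 < C ∧ ∀ (R : ℝ) (x : Euc n), 0 < R → R < ‖x‖ →
      torsionLap α R x = C * (outerMean α R x - R ^ n * outerKer α R x) := by
  have hn := ne_zero_of_nontrivial n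
  obtain ⟨κ, hκ⟩ := exists_lintegral_innerKer_kern n α
  have key : ∀ (R : ℝ) (x : Euc n), 0 < R → R < ‖x‖ →
      ENNReal.ofReal (∫ z, torsion α R z * kern α (z - x)) =
        ENNReal.ofReal (R ^ n * outerKer α R x - outerMean α R x) * κ := by
    intro R x hR hx
    have hi := integrable_torsion_mul_kern hα0 hR hx
    obtain ⟨j1, j2⟩ := integral_exterior_density hn hα0 hR hx
    rw [ofReal_integral_eq_lintegral_ofReal hi (Eventually.of_forall fun z =>
      mul_nonneg (torsion_nonneg _ _ _) (kern_nonneg _ _))]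
    have e1 : ∫⁻ z, ENNReal.ofReal (torsion α R z * kern α (z - x)) =
        ∫⁻ z, ∫⁻ ρ in Ioc 0 R, ENNReal.ofReal (α * ρ) *
          ENNReal.ofReal (innerKer α ρ z * kern α (z - x)) := by
      refine lintegral_congr_ae ?_
      filter_upwards [Measure.ae_ne volume (0 : Euc n)] with z hz
      obtain ⟨k1, k2⟩ := integral_mul_innerKer hα0 hR.le hz
      rw [← k2, mul_comm, ENNReal.ofReal_mul (kern_nonneg _ _),
        ofReal_integral_eq_lintegral_ofReal k1 ((ae_restrict_mem measurableSet_Ioc).mono fun ρ hρ =>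
          mul_nonneg (mul_nonneg hα0.le hρ.1.le) (innerKer_nonneg _ _ _)),
        ← lintegral_const_mul' _ _ ENNReal.ofReal_ne_top]
      refine setLIntegral_congr_fun measurableSet_Ioc fun ρ hρ => ?_
      have := mul_nonneg hα0.le hρ.1.le
      rw [← ENNReal.ofReal_mul (kern_nonneg _ _), ← ENNReal.ofReal_mul this]
      congr 1; ring
    have hm : Measurable (Function.uncurry fun (z : Euc n) (ρ : ℝ) => ENNReal.ofReal (α * ρ) *
          ENNReal.ofReal (innerKer α ρ z * kern α (z - x))) := by
      unfold innerKer Function.uncurry; fun_prop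
    rw [e1, lintegral_lintegral_swap hm.aemeasurable, outerMean_of_lt hx, outerKer, if_pos hx, ← j2,
      ofReal_integral_eq_lintegral_ofReal j1 ((ae_restrict_mem measurableSet_Ioc).mono fun ρ hρ => ?_),
      ← lintegral_mul_const _ (by fun_prop)]
    · refine setLIntegral_congr_fun measurableSet_Ioc fun ρ hρ => ?_
      have h1 : Measurable fun z => ENNReal.ofReal (innerKer α ρ z * kern α (z - x)) := by
        unfold innerKer; fun_prop
      rw [lintegral_const_mul _ h1, hκ ρ x hρ.1 (hρ.2.trans_lt hx), ← mul_assoc,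
        ← ENNReal.ofReal_mul (mul_nonneg hα0.le hρ.1.le)]
    · have := hρ.1
      have h2 : 0 ≤ ‖x‖ ^ 2 - ρ ^ 2 := by nlinarith [hρ.2, norm_nonneg x]
      simp only [Pi.zero_apply]
      positivity
  have hpos : ∀ (R : ℝ) (x : Euc n), 0 < R → R < ‖x‖ →
      0 < ∫ z, torsion α R z * kern α (z - x) := by
    intro R x hR hx
    rw [integral_pos_iff_support_of_nonneg (fun z =>
      mul_nonneg (torsion_nonneg _ _ _) (kern_nonneg _ _)) (integrable_torsion_mul_kern hα0 hR hx)]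
    refine (Metric.measure_ball_pos volume (0 : Euc n) hR).trans_le (measure_mono fun z hz => ?_)
    have hz' : ‖z‖ < R := by simpa using hz
    have h1 : 0 < R ^ 2 - ‖z‖ ^ 2 := by nlinarith [norm_nonneg z]
    have h2 : 0 < ‖z - x‖ := norm_pos_iff.2 (sub_ne_zero.2 fun h => by rw [h] at hz'; linarith)
    have h3 : 0 < torsion α R z := by
      rw [torsion, max_eq_left h1.le]; positivity
    exact (mul_pos h3 (by unfold kern; positivity)).ne'
  obtain ⟨e, he⟩ := exists_norm_eq (Euc n) (show (0 : ℝ) ≤ 2 by norm_num)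
  -- Positivity of the bracket is inherited from the potential: otherwise the right-hand side of
  -- `key` would be zero.
  have hJ : ∀ (R : ℝ) (x : Euc n), 0 < R → R < ‖x‖ →
      0 < R ^ n * outerKer α R x - outerMean α R x := by
    intro R x hR hx
    by_contra h
    have := key R x hR hx
    rw [ENNReal.ofReal_of_nonpos (not_lt.1 h), zero_mul, ENNReal.ofReal_eq_zero] at this
    exact absurd (hpos R x hR hx) (not_lt.2 this)
  -- The constant is never evaluated: a finite positive potential at a single exterior point forces
  -- 0 < κ < ∞.
  have hκt : κ ≠ ⊤ := by
    intro h
    have := key 1 e one_pos (by rw [he]; norm_num)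
    rw [h, ENNReal.mul_top (by simpa using hJ 1 e one_pos (by rw [he]; norm_num))] at this
    exact ENNReal.ofReal_ne_top this
  have key' : ∀ (R : ℝ) (x : Euc n), 0 < R → R < ‖x‖ →
      ∫ z, torsion α R z * kern α (z - x) =
        (R ^ n * outerKer α R x - outerMean α R x) * κ.toReal := by
    intro R x hR hx
    have := congrArg ENNReal.toReal (key R x hR hx)
    rwa [ENNReal.toReal_mul, ENNReal.toReal_ofReal (hpos R x hR hx).le,
      ENNReal.toReal_ofReal (hJ R x hR hx).le] at this
  have hκ0 : 0 < κ.toReal := by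
    have h1 := hpos 1 e one_pos (by rw [he]; norm_num)
    rw [key' 1 e one_pos (by rw [he]; norm_num)] at h1
    exact pos_of_mul_pos_right h1 (hJ 1 e one_pos (by rw [he]; norm_num)).le
  refine ⟨2 * κ.toReal, by positivity, fun R x hR hx => ?_⟩
  rw [torsionLap_exterior_eq hα0 hR hx, key' R x hR hx]
  ring

/-- Only radii ρ < |x| contribute, and the substitution ρ = |x| s removes every power of |x|. -/
lemma exists_outerMean_eq_const (n : ℕ) (α : ℝ) : ∃ c : ℝ, ∀ (R : ℝ) (x : Euc n), x ≠ 0 →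
    ‖x‖ ≤ R → outerMean α R x = c := by
  refine ⟨n * ∫ s in Ioc (0 : ℝ) 1, s ^ (n - 1) *
    if s < 1 then s ^ α / (1 - s ^ 2) ^ (α / 2) else 0, fun R x hx hR => ?_⟩
  have hr : 0 < ‖x‖ := norm_pos_iff.2 hx
  have hn : n ≠ 0 := by
    rintro rfl
    exact hx (Subsingleton.elim _ _)
  set r := ‖x‖ with hrdef
  unfold outerMean
  congr 1
  have h1 : ∫ ρ in Ioc 0 R, ρ ^ (n - 1) * outerKer α ρ x =
      ∫ ρ in Ioc 0 r, ρ ^ (n - 1) * outerKer α ρ x := by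
    refine setIntegral_eq_of_subset_of_forall_sdiff_eq_zero measurableSet_Ioc
      (Ioc_subset_Ioc_right hR) fun ρ hρ => ?_
    have : ¬ ρ < ‖x‖ := fun h => hρ.2 ⟨hρ.1.1, h.le⟩
    rw [outerKer, if_neg this, mul_zero]
  rw [h1, ← intervalIntegral.integral_of_le hr.le, ← intervalIntegral.integral_of_le zero_le_one]
  have h2 := intervalIntegral.mul_integral_comp_mul_left (a := 0) (b := 1)
    (f := fun ρ => ρ ^ (n - 1) * outerKer α ρ x) r
  rw [mul_zero, mul_one] at h2
  rw [← h2, ← intervalIntegral.integral_const_mul]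
  refine intervalIntegral.integral_congr fun s hs => ?_
  rw [uIcc_of_le zero_le_one] at hs
  simp only [outerKer, ← hrdef]
  by_cases h : s < 1
  · have h0 : 0 < 1 - s ^ 2 := by nlinarith [hs.1]
    rw [if_pos (by nlinarith), if_pos h, Real.mul_rpow hr.le hs.1,
      show r ^ 2 - (r * s) ^ 2 = r ^ 2 * (1 - s ^ 2) by ring, Real.mul_rpow (by positivity) h0.le,
      ← Real.rpow_natCast r 2, ← Real.rpow_mul hr.le]
    obtain ⟨m, rfl⟩ := Nat.exists_eq_succ_of_ne_zero hn
    simp only [Nat.succ_eq_add_one, Nat.add_sub_cancel, mul_pow]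
    rw [show ((2 : ℕ) : ℝ) * (α / 2) = α by push_cast; ring]
    field_simp
    ring
  · rw [if_neg (by nlinarith), if_neg h]; simp

/-! ### Volume means and the limit at the centre. -/

lemma integral_pow_pred {n : ℕ} (hn : n ≠ 0) {R : ℝ} (hR : 0 ≤ R) :
    IntegrableOn (fun ρ : ℝ => ρ ^ (n - 1)) (Ioc 0 R) ∧
      n * ∫ ρ in Ioc 0 R, ρ ^ (n - 1) = R ^ n := by
  refine ⟨((by fun_prop : Continuous fun ρ : ℝ => ρ ^ (n - 1)).integrableOn_Icc).mono_set
    Ioc_subset_Icc_self, ?_⟩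
  rw [← intervalIntegral.integral_of_le hR, integral_pow]
  obtain ⟨m, rfl⟩ := Nat.exists_eq_succ_of_ne_zero hn
  simp
  field_simp

/-- A function dominated by its own volume means is dominated by its limit at the centre. -/
lemma le_of_forall_pow_mul_le_integral {n : ℕ} (hn : n ≠ 0) {A : ℝ → ℝ} {a B R₀ : ℝ} (hR₀ : 0 < R₀)
    (hB : ∀ R, 0 < R → R ≤ R₀ → A R ≤ B) (hlim : Tendsto A (𝓝[>] 0) (𝓝 a))
    (hint : ∀ R, 0 < R → R ≤ R₀ → IntegrableOn (fun ρ => ρ ^ (n - 1) * A ρ) (Ioc 0 R))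
    (hA : ∀ R, 0 < R → R ≤ R₀ → R ^ n * A R ≤ n * ∫ ρ in Ioc 0 R, ρ ^ (n - 1) * A ρ) :
    A R₀ ≤ a := by
  refine le_of_forall_pos_le_add fun e he => ?_
  obtain ⟨d, hd, hdA⟩ := Metric.nhdsWithin_basis_ball.mem_iff.1
    (hlim.eventually (eventually_le_nhds (lt_add_of_pos_right a he)))
  set r := min (d / 2) R₀ with hr
  have hr0 : 0 < r := lt_min (by positivity) hR₀
  have hrR : r ≤ R₀ := min_le_right _ _
  have hAr : ∀ R, 0 < R → R ≤ r → A R ≤ a + e := by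
    intro R h0 h1
    refine hdA ⟨?_, h0⟩
    have : r ≤ d / 2 := min_le_left _ _
    rw [Metric.mem_ball, Real.dist_0_eq_abs, abs_of_pos h0]
    linarith
  have hbdd : BddAbove (A '' Ioc 0 R₀) := ⟨B, by
    rintro _ ⟨R, hR, rfl⟩
    exact hB R hR.1 hR.2⟩
  -- If the supremum m exceeded a + e, the radii below r, where A ≤ a + e, would lower every mean.
  set m := sSup (A '' Ioc 0 R₀) with hm
  have hAm : ∀ R, 0 < R → R ≤ R₀ → A R ≤ m := fun R h0 h1 =>
    le_csSup hbdd ⟨R, ⟨h0, h1⟩, rfl⟩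
  refine (hAm R₀ hR₀ le_rfl).trans ?_
  by_contra! hlt
  -- The loss in the mean over (0, R] is (r/R)^n (m - (a + e)), which is smallest at R = R₀; so A
  -- stays below m - δ throughout, contradicting the choice of m.
  set δ := (r / R₀) ^ n * (m - (a + e)) with hδ
  have hδ0 : 0 < δ := mul_pos (by positivity) (by linarith)
  have hθ : (r / R₀) ^ n ≤ 1 := pow_le_one₀ (by positivity) ((div_le_one hR₀).2 hrR)
  have hle : m ≤ m - δ := by
    refine csSup_le ⟨_, ⟨R₀, ⟨hR₀, le_rfl⟩, rfl⟩⟩ ?_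
    rintro _ ⟨R, ⟨h0, h1⟩, rfl⟩
    rcases le_total R r with h | h
    · refine (hAr R h0 h).trans ?_
      rw [hδ]
      nlinarith
    · obtain ⟨i1, v1⟩ := integral_pow_pred hn h0.le
      obtain ⟨i2, v2⟩ := integral_pow_pred hn hr0.le
      have i3 : IntegrableOn ((Ioc 0 r).indicator fun ρ : ℝ => ρ ^ (n - 1)) (Ioc 0 R) :=
        i1.indicator measurableSet_Ioc
      have v3 : ∫ ρ in Ioc 0 R, (Ioc 0 r).indicator (fun ρ : ℝ => ρ ^ (n - 1)) ρ =
          ∫ ρ in Ioc 0 r, ρ ^ (n - 1) := by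
        rw [setIntegral_indicator measurableSet_Ioc,
          inter_eq_self_of_subset_right (Ioc_subset_Ioc_right h)]
      have hmono : ∫ ρ in Ioc 0 R, ρ ^ (n - 1) * A ρ ≤ ∫ ρ in Ioc 0 R,
          (m * ρ ^ (n - 1) - (m - (a + e)) * (Ioc 0 r).indicator (fun ρ : ℝ => ρ ^ (n - 1)) ρ) := by
        refine setIntegral_mono_on (hint R h0 h1)
          ((Integrable.const_mul i1 m).sub (Integrable.const_mul i3 _)) measurableSet_Ioc
          fun ρ hρ => ?_
        have hp : 0 ≤ ρ ^ (n - 1) := pow_nonneg hρ.1.le _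
        by_cases hρr : ρ ≤ r
        · rw [indicator_of_mem (show ρ ∈ Ioc 0 r from ⟨hρ.1, hρr⟩)]
          nlinarith [hAr ρ hρ.1 hρr]
        · rw [indicator_of_notMem (show ρ ∉ Ioc 0 r from fun h => hρr h.2)]
          nlinarith [hAm ρ hρ.1 (hρ.2.trans h1)]
      rw [integral_sub (Integrable.const_mul i1 m) (Integrable.const_mul i3 _),
        integral_const_mul, integral_const_mul, v3] at hmono
      have h3 := (hA R h0 h1).trans (mul_le_mul_of_nonneg_left hmono (Nat.cast_nonneg n))
      have h4 : R ^ n * A R ≤ R ^ n * m - r ^ n * (m - (a + e)) := by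
        rw [← v1, ← v2]; rw [← v1] at h3; linarith
      have hRn : 0 < R ^ n := by positivity
      have h5 : R ^ n * δ ≤ r ^ n * (m - (a + e)) := by
        rw [hδ, ← mul_assoc, div_pow, mul_div_assoc']
        refine mul_le_mul_of_nonneg_right ?_ (by linarith)
        rw [div_le_iff₀ (by positivity), mul_comm]
        gcongr
      have h6 : R ^ n * A R ≤ R ^ n * (m - δ) := by rw [mul_sub]; linarith
      exact le_of_mul_le_mul_left h6 hRn
  linarith

/-- Fubini in ρ, justified by the bound of `MemLAlpha.integrable_mul_outerKer`, which is uniform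
over 0 < ρ ≤ R. -/
lemma MemLAlpha.integral_mul_outerMean {n : ℕ} [Nontrivial (Euc n)] {α R R₀ η M : ℝ}
    (hα0 : 0 < α) (hα2 : α < 2) (hR : 0 < R) (hR0 : R ≤ R₀) (hη : 0 < η) {v : Euc n → ℝ}
    (hv : MemLAlpha α v) (hM : ∀ x, ‖x‖ ≤ R₀ + η → |v x| ≤ M) :
    Integrable (fun x => v x * outerMean α R x) ∧
    IntegrableOn (fun ρ => ρ ^ (n - 1) * ∫ x : Euc n, v x * outerKer α ρ x) (Ioc 0 R) ∧
    ∫ x, v x * outerMean α R x =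
      n * ∫ ρ in Ioc 0 R, ρ ^ (n - 1) * ∫ x : Euc n, v x * outerKer α ρ x := by
  set F : Euc n × ℝ → ℝ := fun p => p.2 ^ (n - 1) * (v p.1 * outerKer α p.2 p.1) with hF
  have hFm : AEStronglyMeasurable F (volume.prod (volume.restrict (Ioc 0 R))) := by
    refine (Measurable.aestronglyMeasurable (by fun_prop)).mul
      ((hv.aestronglyMeasurable.comp_fst).mul ?_)
    exact ((measurable_outerKer_uncurry α).comp measurable_swap).aestronglyMeasurable
  set L := (1 - (R₀ / (R₀ + η)) ^ 2) ^ (-(α / 2)) *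
    ∫ x in {x : Euc n | R₀ + η ≤ ‖x‖}, |v x * kern α x| with hL
  set K := M / outerConst n α + R ^ α * L with hK
  have hFi : Integrable F (volume.prod (volume.restrict (Ioc 0 R))) := by
    rw [integrable_prod_iff' hFm]
    constructor
    · filter_upwards [ae_restrict_mem measurableSet_Ioc] with ρ hρ
      exact (hv.integrable_mul_outerKer hα0 hα2 hρ.1 (hρ.2.trans hR0) hη hM).1.const_mul (ρ ^ (n - 1))
    · have : Integrable (fun _ : ℝ => R ^ (n - 1) * K) (volume.restrict (Ioc 0 R)) :=
        integrable_const _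
      refine this.mono' hFm.norm.prod_swap.integral_prod_right' ?_
      filter_upwards [ae_restrict_mem measurableSet_Ioc] with ρ hρ
      have h1 := (hv.integrable_mul_outerKer hα0 hα2 hρ.1 (hρ.2.trans hR0) hη hM).2
      have h0 : 0 ≤ ∫ x : Euc n, |v x * outerKer α ρ x| := integral_nonneg fun x => abs_nonneg _
      have hρ0 := hρ.1.le
      have e1 : ∫ x, ‖F (x, ρ)‖ = ρ ^ (n - 1) * ∫ x : Euc n, |v x * outerKer α ρ x| := by
        rw [← integral_const_mul]
        refine integral_congr_ae (Eventually.of_forall fun x => ?_)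
        simp only [hF, Real.norm_eq_abs]
        rw [abs_mul, abs_of_nonneg (by positivity : 0 ≤ ρ ^ (n - 1))]
      change ‖∫ x, ‖F (x, ρ)‖‖ ≤ _
      rw [e1, Real.norm_of_nonneg (by positivity)]
      have hR' := hR.le
      have h2 : ρ ^ (n - 1) ≤ R ^ (n - 1) := by gcongr; exact hρ.2
      have h3 : ρ ^ α ≤ R ^ α := by gcongr; exact hρ.2
      refine mul_le_mul h2 (h1.trans ?_) h0 (by positivity)
      refine add_le_add le_rfl (mul_le_mul_of_nonneg_right h3 ?_)
      refine mul_nonneg (Real.rpow_nonneg ?_ _) (integral_nonneg fun x => abs_nonneg _)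
      have : (R₀ / (R₀ + η)) ^ 2 ≤ 1 := by
        have h0 : 0 < R₀ := hR.trans_le hR0
        exact pow_le_one₀ (by positivity) ((div_le_one (by positivity)).2 (by linarith))
      linarith
  have e1 : ∀ x, ∫ ρ in Ioc 0 R, F (x, ρ) = v x * ∫ ρ in Ioc 0 R, ρ ^ (n - 1) * outerKer α ρ x := by
    intro x
    rw [← integral_const_mul]
    refine integral_congr_ae (Eventually.of_forall fun ρ => ?_)
    simp only [hF]; ring
  have e2 : ∀ ρ, ∫ x, F (x, ρ) = ρ ^ (n - 1) * ∫ x : Euc n, v x * outerKer α ρ x := by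
    intro ρ
    rw [← integral_const_mul]
  have i1 := hFi.integral_prod_left
  have i2 := hFi.integral_prod_right
  have hsw := integral_integral_swap (f := fun x ρ => F (x, ρ)) hFi
  simp_rw [e1, e2] at i1 i2 hsw
  have e3 : ∀ x, v x * outerMean α R x =
      n * (v x * ∫ ρ in Ioc 0 R, ρ ^ (n - 1) * outerKer α ρ x) := fun x => by
    unfold outerMean; ring
  simp_rw [e3]
  exact ⟨i1.const_mul _, i2, by rw [integral_const_mul, hsw]⟩

/-! ### The formula for the torsion profile and the mean value inequality. -/

/-- The fractional Laplacian of the torsion profile. -/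
lemma exists_torsionLap_eq (n : ℕ) [Nontrivial (Euc n)] {α : ℝ} (hα0 : 0 < α) (hα2 : α < 2) :
    ∃ C : ℝ, 0 < C ∧ ∀ (R : ℝ), 0 < R → ∀ᵐ x : Euc n,
      torsionLap α R x = C * (outerMean α R x - R ^ n * outerKer α R x) := by
  have hn := ne_zero_of_nontrivial n
  obtain ⟨C, hC, hext⟩ := exists_torsionLap_exterior n hα0
  obtain ⟨K, hK⟩ := exists_torsionLap_eq_const n hα0 hα2
  obtain ⟨c, hc⟩ := exists_outerMean_eq_const n α
  refine ⟨C, hC, fun R hR => ?_⟩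
  have hbase : ∀ᵐ x : Euc n, torsionLap α R x =
      C * (outerMean α R x - R ^ n * outerKer α R x) +
        (Metric.ball 0 R).indicator (fun _ => K - C * c) x := by
    have hs : ∀ᵐ x : Euc n, x ∉ Metric.sphere (0 : Euc n) R :=
      measure_eq_zero_iff_ae_notMem.1 (Measure.addHaar_sphere volume 0 R)
    filter_upwards [Measure.ae_ne volume (0 : Euc n), hs] with x hx hxR
    rcases lt_trichotomy ‖x‖ R with h | h | h
    · rw [hK R x hx h, hc R x hx h.le, outerKer, if_neg (not_lt.2 h.le),
        indicator_of_mem (by simpa using h)]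
      ring
    · exact absurd (by simpa using h) hxR
    · rw [hext R x hR h, indicator_of_notMem (by simpa using h.le), add_zero]
  obtain ⟨q1, q2⟩ := integral_outerKer (n := n) hα0 hα2 hR
  obtain ⟨m1, m2, m3⟩ := (memLAlpha_const (n := n) hα0 1).integral_mul_outerMean hα0 hα2 hR le_rfl
    one_pos (M := 1) (fun x _ => by simp)
  obtain ⟨p1, p2⟩ := integral_torsion_mul_eq (n := n) (α := α) (σ := 1) (R := R) (η := 1) (C := 0)
    (M := 1) (v := fun _ => 1) hα0 hα2 one_pos hR one_pos le_rfl (memLAlpha_const hα0 1)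
    (fun x _ => by simp) (fun x h _ _ => by norm_num [secondDiff])
  -- Symmetry tested against the constant 1, whose second differences vanish.
  have hzero : ∫ x : Euc n, torsionLap α R x = 0 := by
    have : ∀ x h : Euc n, secondDiff (fun _ : Euc n => (1 : ℝ)) x h = 0 := fun x h => by
      simp only [secondDiff]; norm_num
    simp only [this, zero_mul, integral_zero, mul_zero, one_mul] at p2
    exact p2.symm
  -- The mass of `outerKer` is the same for all radii, and the weights n ρ^(n-1) integrate to R^n.
  have hmean : ∫ x : Euc n, outerMean α R x = R ^ n * ∫ x : Euc n, outerKer α R x := by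
    have hk := outerConst_pos (n := n) hα0 hα2
    have hq : ∀ ρ, 0 < ρ → ∫ x : Euc n, outerKer α ρ x = (outerConst n α)⁻¹ := fun ρ hρ =>
      eq_inv_of_mul_eq_one_right (integral_outerKer (n := n) hα0 hα2 hρ).2
    simp only [one_mul] at m3
    rw [m3, hq R hR, ← (integral_pow_pred hn hR.le).2, mul_assoc, ← integral_mul_const]
    congr 1
    refine setIntegral_congr_fun measurableSet_Ioc fun ρ hρ => ?_
    simp only [hq ρ hρ.1]
  simp only [one_mul] at m1
  have hi : Integrable ((Metric.ball (0 : Euc n) R).indicator fun _ => K - C * c) :=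
    (integrable_indicator_iff Metric.isOpen_ball.measurableSet).2
      (integrableOn_const (measure_ball_lt_top.ne))
  -- Integrating `hbase` leaves only (K - C c) times the volume of the ball.
  have hKc : K - C * c = 0 := by
    have h1 := integral_congr_ae hbase
    have hi2 : Integrable fun x : Euc n => C * (outerMean α R x - R ^ n * outerKer α R x) :=
      (m1.sub (q1.const_mul _)).const_mul _
    rw [hzero, integral_add hi2 hi, integral_const_mul, integral_sub m1 (q1.const_mul _), integral_const_mul, hmean, sub_self, mul_zero, zero_add,
      integral_indicator Metric.isOpen_ball.measurableSet, setIntegral_const, smul_eq_mul] at h1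
    have h2 : volume.real (Metric.ball (0 : Euc n) R) ≠ 0 :=
      (ENNReal.toReal_pos (Metric.measure_ball_pos volume 0 hR).ne' measure_ball_lt_top.ne).ne'
    exact (mul_eq_zero.1 h1.symm).resolve_left h2
  filter_upwards [hbase] with x hx
  rw [hx, hKc]
  simp

/-- The nonlocal mean value inequality for supersolutions, at the centre of the ball. -/
lemma fracAverage_le_of_integral_secondDiff_nonneg {n : ℕ} [Nontrivial (Euc n)]
    {α σ R₀ η C M : ℝ} (hα0 : 0 < α) (hα2 : α < 2) (hσ : 0 < σ) (hR₀ : 0 < R₀) (hη : 0 < η)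
    (hC : 0 ≤ C) {v : Euc n → ℝ} (hv : MemLAlpha α v) (hcont : ContinuousAt v 0)
    (hM : ∀ x, ‖x‖ ≤ R₀ + η → |v x| ≤ M)
    (hsd : ∀ x h, ‖x‖ ≤ R₀ → ‖h‖ < η → |secondDiff v x h| ≤ C * ‖h‖ ^ (α + σ))
    (hS : ∀ x, ‖x‖ ≤ R₀ → 0 ≤ ∫ h, secondDiff v x h * kern α h) :
    fracAverage α v 0 R₀ ≤ v 0 := by
  have hn := ne_zero_of_nontrivial n
  obtain ⟨C', hC', hT⟩ := exists_torsionLap_eq n hα0 hα2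
  have hk := outerConst_pos (n := n) hα0 hα2
  have hA : ∀ R, 0 < R → R ≤ R₀ →
      fracAverage α v 0 R = outerConst n α * ∫ x, v x * outerKer α R x := fun R h0 h1 =>
    (fracAverage_eq h0 (hv.integrable_mul_outerKer hα0 hα2 h0 h1 hη hM).1).2.2
  have hAint : ∀ R, 0 < R → R ≤ R₀ → EqOn (fun ρ => ρ ^ (n - 1) * fracAverage α v 0 ρ)
      (fun ρ => outerConst n α * (ρ ^ (n - 1) * ∫ x, v x * outerKer α ρ x)) (Ioc 0 R) := by
    intro R h0 h1 ρ hρ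
    simp only [hA ρ hρ.1 (hρ.2.trans h1)]
    ring
  obtain ⟨K, hK⟩ := abs_fracAverage_sub_le hα0 hα2 hη hv 0 (R₀ := R₀) (M := M) (by simpa using hM)
  refine le_of_forall_pow_mul_le_integral hn hR₀ (B := M + |K| * R₀ ^ α) ?_
    (tendsto_fracAverage hα0 hα2 hv hcont) ?_ ?_
  · intro R h0 h1
    have h2 := hK R h0 h1
    rw [sub_zero] at h2
    have h3 : R ^ α ≤ R₀ ^ α := by gcongr
    have h4 : K * R ^ α ≤ |K| * R₀ ^ α :=
      mul_le_mul (le_abs_self K) h3 (by positivity) (abs_nonneg K)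
    linarith [le_abs_self (fracAverage α v 0 R)]
  · intro R h0 h1
    refine IntegrableOn.congr_fun ?_ (hAint R h0 h1).symm measurableSet_Ioc
    exact Integrable.const_mul (hv.integral_mul_outerMean hα0 hα2 h0 h1 hη hM).2.1 _
  · intro R h0 h1
    obtain ⟨i1, -, v1⟩ := hv.integral_mul_outerMean hα0 hα2 h0 h1 hη hM
    have i2 := (hv.integrable_mul_outerKer hα0 hα2 h0 h1 hη hM).1
    obtain ⟨-, p2⟩ := integral_torsion_mul_eq hα0 hα2 hσ h0 hη hC hv
      (fun x hx => hM x (by linarith)) (fun x h hx => hsd x h (hx.trans h1))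
    -- The profile vanishes off the ball, so the sign of the singular integral is used only where it
    -- is assumed.
    have hpos : 0 ≤ ∫ x, torsion α R x * ∫ h, secondDiff v x h * kern α h := by
      refine integral_nonneg fun x => ?_
      by_cases hx : R ≤ ‖x‖
      · simp [torsion_eq_zero hα0 h0.le hx]
      · exact mul_nonneg (torsion_nonneg _ _ _) (hS x (by linarith))
    have h2 : ∫ x, v x * ∫ h, secondDiff (torsion α R) x h * kern α h =
        C' * ((∫ x, v x * outerMean α R x) - R ^ n * ∫ x, v x * outerKer α R x) := by
      rw [← integral_const_mul (R ^ n), ← integral_sub i1 (i2.const_mul _), ← integral_const_mul]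
      refine integral_congr_ae ?_
      filter_upwards [hT R h0] with x hx
      rw [torsionLap] at hx
      rw [hx]; ring
    rw [p2, h2, v1] at hpos
    have h3 := nonneg_of_mul_nonneg_right hpos hC'
    rw [setIntegral_congr_fun measurableSet_Ioc (hAint R h0 h1), integral_const_mul, hA R h0 h1]
    have := mul_nonneg hk.le h3
    linarith

/-! ### Hölder regularity and second differences. -/

lemma dist_iteratedFDeriv_zero {E : Type*} [NormedAddCommGroup E] [NormedSpace ℝ E] (u : E → ℝ)
    (x y : E) : dist (iteratedFDeriv ℝ 0 u x) (iteratedFDeriv ℝ 0 u y) = dist (u x) (u y) := by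
  rw [iteratedFDeriv_zero_eq_comp]
  exact LinearIsometryEquiv.dist_map _ _ _

lemma dist_fderiv_le {E : Type*} [NormedAddCommGroup E] [NormedSpace ℝ E] (u : E → ℝ)
    (x y : E) : dist (fderiv ℝ u x) (fderiv ℝ u y) ≤
      dist (iteratedFDeriv ℝ 1 u x) (iteratedFDeriv ℝ 1 u y) := by
  rw [dist_eq_norm, dist_eq_norm]
  refine ContinuousLinearMap.opNorm_le_bound _ (norm_nonneg _) fun h => ?_
  have := (iteratedFDeriv ℝ 1 u x - iteratedFDeriv ℝ 1 u y).le_opNorm fun _ => h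
  simpa [iteratedFDeriv_one_apply] using this

lemma secondDiff_le_of_holder {n : ℕ} {γ C : ℝ} {K : Set (Euc n)} {u : Euc n → ℝ} {x h : Euc n}
    (hu : ∀ z ∈ K, ∀ w ∈ K, |u z - u w| ≤ C * ‖z - w‖ ^ γ) (hx : x ∈ K) (hp : x + h ∈ K)
    (hm : x - h ∈ K) : |secondDiff u x h| ≤ 2 * C * ‖h‖ ^ γ := by
  have h1 := hu x hx _ hp
  have h2 := hu x hx _ hm
  rw [show x - (x + h) = -h by abel, norm_neg] at h1
  rw [show x - (x - h) = h by abel] at h2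
  have : secondDiff u x h = (u x - u (x + h)) + (u x - u (x - h)) := by unfold secondDiff; ring
  rw [this]
  refine (abs_add_le _ _).trans ?_
  linarith

/-- Mean value inequality for t ↦ `secondDiff u x (t • h)`: it vanishes at t = 0, and its derivative
compares the gradient of u at two points at distance 2t|h|. -/
lemma secondDiff_le_of_holder_fderiv {n : ℕ} {γ C : ℝ} (hγ : 0 < γ) (hC : 0 ≤ C) {K : Set (Euc n)}
    (hK : Convex ℝ K) {u : Euc n → ℝ} {x h : Euc n} (hd : ∀ z ∈ K, DifferentiableAt ℝ u z)
    (hu : ∀ z ∈ K, ∀ w ∈ K, ‖fderiv ℝ u z - fderiv ℝ u w‖ ≤ C * ‖z - w‖ ^ γ) (hp : x + h ∈ K)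
    (hm : x - h ∈ K) : |secondDiff u x h| ≤ C * 2 ^ γ * ‖h‖ ^ (1 + γ) := by
  have hx : x ∈ K := by
    have := hK hp hm (show (0 : ℝ) ≤ 1 / 2 by norm_num) (show (0 : ℝ) ≤ 1 / 2 by norm_num) (by norm_num)
    convert this using 1
    module
  have hpt : ∀ t ∈ Icc (0 : ℝ) 1, x + t • h ∈ K := fun t ht => by
    have := hK.add_smul_mem hx hp ht
    exact this
  have hmt : ∀ t ∈ Icc (0 : ℝ) 1, x - t • h ∈ K := fun t ht => by
    have := hK.add_smul_mem (y := -h) hx (by rwa [← sub_eq_add_neg]) ht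
    rwa [smul_neg, ← sub_eq_add_neg] at this
  set φ : ℝ → ℝ := fun t => secondDiff u x (t • h) with hφ
  have hder : ∀ t ∈ Icc (0 : ℝ) 1, HasDerivWithinAt φ
      (-(fderiv ℝ u (x + t • h) - fderiv ℝ u (x - t • h)) h) (Icc 0 1) t := by
    intro t ht
    have l1 : HasDerivAt (fun t : ℝ => x + t • h) h t := by
      simpa using ((hasDerivAt_id t).smul_const h).const_add x
    have l2 : HasDerivAt (fun t : ℝ => x - t • h) (-h) t := by
      simpa using ((hasDerivAt_id t).smul_const h).const_sub x
    have d1 := ((hd _ (hpt t ht)).hasFDerivAt.comp_hasDerivAt t l1)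
    have d2 := ((hd _ (hmt t ht)).hasFDerivAt.comp_hasDerivAt t l2)
    have := ((d1.const_sub (2 * u x)).sub d2).hasDerivWithinAt (s := Icc 0 1)
    refine this.congr_deriv ?_
    rw [sub_apply, map_neg]
    ring
  have hb := norm_image_sub_le_of_norm_deriv_le_segment_01' (C := C * 2 ^ γ * ‖h‖ ^ (1 + γ)) hder
    (fun t ht => by
      have ht' : t ∈ Icc (0 : ℝ) 1 := Ico_subset_Icc_self ht
      rw [norm_neg]
      refine (ContinuousLinearMap.le_opNorm _ _).trans ?_
      have h1 := hu _ (hpt t ht') _ (hmt t ht')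
      have h2 : ‖x + t • h - (x - t • h)‖ ≤ 2 * ‖h‖ := by
        rw [show x + t • h - (x - t • h) = (2 * t) • h by module, norm_smul,
          Real.norm_of_nonneg (by linarith [ht.1])]
        have := mul_le_mul_of_nonneg_right ht'.2 (norm_nonneg h)
        linarith
      have h3 : ‖x + t • h - (x - t • h)‖ ^ γ ≤ 2 ^ γ * ‖h‖ ^ γ := by
        rw [← Real.mul_rpow (by norm_num) (norm_nonneg h)]
        gcongr
      rcases eq_or_ne ‖h‖ 0 with h0 | h0
      · rw [h0, mul_zero]; positivity
      have h4 : ‖h‖ ^ (1 + γ) = ‖h‖ ^ γ * ‖h‖ := by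
        rw [add_comm, Real.rpow_add_one h0]
      rw [h4]
      calc _ ≤ (C * (2 ^ γ * ‖h‖ ^ γ)) * ‖h‖ := by gcongr; exact h1.trans (by gcongr)
        _ = _ := by ring)
  have h0 : φ 0 = 0 := by simp [hφ, secondDiff]; ring
  rw [h0, sub_zero] at hb
  simpa [hφ] using hb

/-- Local Hölder regularity of order `α + ε` bounds second differences. -/
lemma MemHolderLoc.exists_secondDiff_le {n : ℕ} {α ε : ℝ} (hα0 : 0 < α) (hα2 : α < 2) (hε : 0 < ε)
    {Ω : Set (Euc n)} (hΩ : IsOpen Ω) {u : Euc n → ℝ}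
    (hreg : MemHolderLoc ⌊α⌋₊ (Int.fract α + ε) Ω u) {y : Euc n} {R : ℝ} (hR : 0 ≤ R)
    (hyR : Metric.closedBall y R ⊆ Ω) :
    ∃ η C M : ℝ, 0 < η ∧ 0 ≤ C ∧
      (∀ x h, ‖x - y‖ ≤ R → ‖h‖ < η → |secondDiff u x h| ≤ C * ‖h‖ ^ (α + ε)) ∧
      (∀ x, ‖x - y‖ ≤ R + η → |u x| ≤ M) ∧ ContinuousAt u y := by
  obtain ⟨hu, hH⟩ := hreg
  -- A slightly larger closed ball still lies in Ω, so x and x ± h all stay in one compact convex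
  -- set.
  obtain ⟨η, hη, hηΩ⟩ := (isCompact_closedBall y R).exists_cthickening_subset_open hΩ hyR
  rw [cthickening_closedBall hη.le hR, add_comm] at hηΩ
  set K := Metric.closedBall y (R + η) with hK
  have hKc : IsCompact K := isCompact_closedBall _ _
  obtain ⟨M, hM⟩ := hKc.exists_bound_of_continuousOn (hu.continuousOn.mono hηΩ)
  obtain ⟨C, hC⟩ := hH K hηΩ hKc
  have hγ : 0 < Int.fract α + ε := by linarith [Int.fract_nonneg α]
  have hyΩ : y ∈ Ω := hηΩ (Metric.mem_closedBall_self (by linarith))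
  have hmem : ∀ x h : Euc n, ‖x - y‖ ≤ R → ‖h‖ < η → x ∈ K ∧ x + h ∈ K ∧ x - h ∈ K := by
    intro x h hx hh
    simp only [hK, mem_closedBall_iff_norm]
    refine ⟨by linarith, ?_, ?_⟩
    · rw [add_sub_right_comm]; exact (norm_add_le _ _).trans (by linarith)
    · rw [sub_right_comm]; exact (norm_sub_le _ _).trans (by linarith)
  have hfl : (⌊α⌋₊ : ℝ) + Int.fract α = α := by
    rw [natCast_floor_eq_intCast_floor hα0.le, Int.floor_add_fract]
  have hlt : ⌊α⌋₊ < 2 := (Nat.floor_lt hα0.le).2 (by exact_mod_cast hα2)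
  have hCd : ∀ z ∈ K, ∀ w ∈ K, dist (iteratedFDeriv ℝ ⌊α⌋₊ u z) (iteratedFDeriv ℝ ⌊α⌋₊ u w) ≤
      C * ‖z - w‖ ^ (Int.fract α + ε) := by
    intro z hz w hw
    have := hC.dist_le hz hw
    rwa [Real.coe_toNNReal _ hγ.le, dist_eq_norm z w] at this
  have hbd : ∀ x, ‖x - y‖ ≤ R + η → |u x| ≤ M := fun x hx => hM x (mem_closedBall_iff_norm.2 hx)
  have hcont : ContinuousAt u y := hu.continuousOn.continuousAt (hΩ.mem_nhds hyΩ)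
  generalize hk : ⌊α⌋₊ = k at *
  -- For α < 1 the Hölder bound on u itself suffices; for 1 ≤ α < 2 the gradient supplies the extra
  -- order. The value α = 1 belongs to the second case, with fractional part 0.
  obtain rfl | rfl : k = 0 ∨ k = 1 := by omega
  · refine ⟨η, 2 * C, M, hη, by positivity, fun x h hx hh => ?_, hbd, hcont⟩
    obtain ⟨m1, m2, m3⟩ := hmem x h hx hh
    have he : α + ε = Int.fract α + ε := by rw [Nat.cast_zero, zero_add] at hfl; rw [hfl]
    rw [he]
    refine secondDiff_le_of_holder (K := K) (fun z hz w hw => ?_) m1 m2 m3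
    have := hCd z hz w hw
    rwa [dist_iteratedFDeriv_zero, Real.dist_eq] at this
  · refine ⟨η, C * 2 ^ (Int.fract α + ε), M, hη, by positivity, fun x h hx hh => ?_, hbd, hcont⟩
    obtain ⟨m1, m2, m3⟩ := hmem x h hx hh
    have he : α + ε = 1 + (Int.fract α + ε) := by rw [Nat.cast_one] at hfl; linarith
    rw [he]
    refine secondDiff_le_of_holder_fderiv hγ C.2 (convex_closedBall y _) (fun z hz => ?_)
      (fun z hz w hw => ?_) m2 m3
    · exact (hu.differentiableOn (by norm_num)).differentiableAt (hΩ.mem_nhds (hηΩ hz))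
    · rw [← dist_eq_norm]
      exact (dist_fderiv_le u z w).trans (hCd z hz w hw)

/-! ### Assembly. -/

lemma fracLaplacianConst_pos {n : ℕ} {α : ℝ} (hα0 : 0 < α) (hα2 : α < 2) :
    0 < fracLaplacianConst n α := by
  have h1 := Real.Gamma_pos_of_pos (show 0 < ((n : ℝ) + α) / 2 by positivity)
  have h2 := Real.Gamma_pos_of_pos (show 0 < 1 - α / 2 by linarith)
  have := Real.pi_pos
  unfold fracLaplacianConst
  positivity

lemma fracAverage_translate {n : ℕ} (α : ℝ) (u : Euc n → ℝ) (y : Euc n) (R : ℝ) :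
    fracAverage α (fun x => u (y + x)) 0 R = fracAverage α u y R := by
  simp [fracAverage, averageIntegrand, sphericalAverage]

lemma fracAverage_neg {n : ℕ} (α : ℝ) (u : Euc n → ℝ) (y : Euc n) (R : ℝ) :
    fracAverage α (fun x => -u x) y R = -fracAverage α u y R := by
  simp [fracAverage, averageIntegrand, sphericalAverage, average_neg, integral_neg]

lemma secondDiff_translate {n : ℕ} (u : Euc n → ℝ) (y x h : Euc n) :
    secondDiff (fun x => u (y + x)) x h = secondDiff u (y + x) h := by
  simp [secondDiff, add_assoc, add_sub_assoc]

lemma secondDiff_neg_apply {n : ℕ} (u : Euc n → ℝ) (x h : Euc n) :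
    secondDiff (fun x => -u x) x h = -secondDiff u x h := by
  simp only [secondDiff]; ring

theorem theoremA1 (n : ℕ) (hn : 1 ≤ n) (α ε : ℝ) (hα0 : 0 < α) (hα2 : α < 2)
    (hε : 0 < ε) (hε1 : Int.fract α + ε ≤ 1)
    (Ω : Set (Euc n)) (hΩ : IsOpen Ω) (u : Euc n → ℝ)
    (hreg : MemHolderLoc ⌊α⌋₊ (Int.fract α + ε) Ω u) (hint : MemLAlpha α u) :
    -- the principal value exists in `Ω` and the averages are honest integrals
    (∀ x ∈ Ω, Tendsto (truncFracLaplacian α u x) (𝓝[>] 0) (𝓝 (fracLaplacian α u x))) ∧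
    (∀ (y : Euc n) (R : ℝ), 0 < R → Metric.closedBall y R ⊆ Ω →
      (∀ᵐ r ∂(volume.restrict (Ioi R)),
        Integrable (fun ω : Metric.sphere (0 : Euc n) 1 => u (y + r • (ω : Euc n)))
          (volume : Measure (Euc n)).toSphere) ∧
      IntegrableOn (averageIntegrand α u y R) (Ioi R)) ∧
    -- supersolutions
    ((∀ x ∈ Ω, 0 ≤ fracLaplacian α u x) →
      ∀ (y : Euc n) (R : ℝ), 0 < R → Metric.closedBall y R ⊆ Ω → fracAverage α u y R ≤ u y) ∧
    -- subsolutions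
    ((∀ x ∈ Ω, fracLaplacian α u x ≤ 0) →
      ∀ (y : Euc n) (R : ℝ), 0 < R → Metric.closedBall y R ⊆ Ω → u y ≤ fracAverage α u y R) ∧
    -- characterization of `α`-harmonic functions
    ((∀ x ∈ Ω, fracLaplacian α u x = 0) ↔
      ∀ (y : Euc n) (R : ℝ), 0 < R → Metric.closedBall y R ⊆ Ω → u y = fracAverage α u y R) := by
  have : Nontrivial (Euc n) := Module.nontrivial_of_finrank_pos (R := ℝ)
    (by rw [finrank_euclideanSpace_fin]; omega)
  have hc := fracLaplacianConst_pos (n := n) hα0 hα2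
  have hlim : ∀ x ∈ Ω, Tendsto (truncFracLaplacian α u x) (𝓝[>] 0)
      (𝓝 (fracLaplacianConst n α / 2 * ∫ h, secondDiff u x h * kern α h)) := by
    intro x hx
    -- Radius 0 is allowed: the closed ball is then the single point x.
    obtain ⟨η, C, -, hη, hC, hsd, -⟩ := hreg.exists_secondDiff_le hα0 hα2 hε hΩ (y := x) le_rfl
      (by simpa using hx)
    exact tendsto_truncFracLaplacian hα0 hε hη hC hint fun h hh => hsd x h (by simp) hh
  have hval : ∀ x ∈ Ω, fracLaplacian α u x =
      fracLaplacianConst n α / 2 * ∫ h, secondDiff u x h * kern α h := fun x hx =>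
    (hlim x hx).limUnder_eq
  have hsuper : (∀ x ∈ Ω, 0 ≤ fracLaplacian α u x) →
      ∀ (y : Euc n) (R : ℝ), 0 < R → Metric.closedBall y R ⊆ Ω → fracAverage α u y R ≤ u y := by
    intro h0 y R hR hy
    obtain ⟨η, C, M, hη, hC, hsd, hM, hcont⟩ := hreg.exists_secondDiff_le hα0 hα2 hε hΩ hR.le hy
    have := fracAverage_le_of_integral_secondDiff_nonneg hα0 hα2 hε hR hη hC
      (hint.translate hα0 y) (hcont.comp_of_eq (by fun_prop) (add_zero y))
      (fun x hx => hM _ (by simpa using hx))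
      (fun x h hx hh => by rw [secondDiff_translate]; exact hsd _ h (by simpa using hx) hh)
      (fun x hx => by
        simp_rw [secondDiff_translate]
        have hx' : y + x ∈ Ω := hy (by simpa using hx)
        have h1 := h0 _ hx'
        rw [hval _ hx'] at h1
        exact nonneg_of_mul_nonneg_right h1 (by positivity))
    simpa [fracAverage_translate] using this
  have hsub : (∀ x ∈ Ω, fracLaplacian α u x ≤ 0) →
      ∀ (y : Euc n) (R : ℝ), 0 < R → Metric.closedBall y R ⊆ Ω → u y ≤ fracAverage α u y R := by
    intro h0 y R hR hy
    obtain ⟨η, C, M, hη, hC, hsd, hM, hcont⟩ := hreg.exists_secondDiff_le hα0 hα2 hε hΩ hR.le hy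
    -- Subsolutions are handled by applying the supersolution inequality to -u.
    have hneg : MemLAlpha α fun x => -u (y + x) := by
      simpa [MemLAlpha, neg_div] using (hint.translate hα0 y).neg
    have := fracAverage_le_of_integral_secondDiff_nonneg hα0 hα2 hε hR hη hC hneg
      (hcont.comp_of_eq (by fun_prop) (add_zero y)).neg
      (fun x hx => by rw [abs_neg]; exact hM _ (by simpa using hx))
      (fun x h hx hh => by
        rw [secondDiff_neg_apply, abs_neg, secondDiff_translate]
        exact hsd _ h (by simpa using hx) hh)
      (fun x hx => by
        simp_rw [secondDiff_neg_apply, secondDiff_translate, neg_mul]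
        rw [integral_neg, neg_nonneg]
        have hx' : y + x ∈ Ω := hy (by simpa using hx)
        have h1 := h0 _ hx'
        rw [hval _ hx'] at h1
        exact nonpos_of_mul_nonpos_right h1 (by positivity))
    rw [fracAverage_neg (u := fun x => u (y + x)), fracAverage_translate, add_zero] at this
    linarith
  refine ⟨fun x hx => (hval x hx).symm ▸ hlim x hx, fun y R hR hy => ?_, hsuper, hsub,
    fun h0 y R hR hy => le_antisymm (hsub (fun x hx => (h0 x hx).le) y R hR hy)
      (hsuper (fun x hx => (h0 x hx).ge) y R hR hy), fun hA x hx => ?_⟩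
  · obtain ⟨η, C, M, hη, -, -, hM, -⟩ := hreg.exists_secondDiff_le hα0 hα2 hε hΩ hR.le hy
    obtain ⟨h1, h2, -⟩ := fracAverage_eq hR ((hint.translate hα0 y).integrable_mul_outerKer hα0 hα2
      hR le_rfl hη (fun x hx => hM _ (by simpa using hx))).1
    refine ⟨h1, h2.congr_fun (fun r _ => ?_) measurableSet_Ioi⟩
    simp [averageIntegrand, sphericalAverage]
  -- The converse uses only the small balls centred at x.
  · obtain ⟨R₁, hR₁, hball⟩ := Metric.isOpen_iff.1 hΩ x hx
    obtain ⟨η, C, M, hη, hC, hsd, hM, -⟩ := hreg.exists_secondDiff_le hα0 hα2 hε hΩ (y := x) le_rfl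
      (by simpa using hx)
    have := integral_secondDiff_eq_zero_of_fracAverage hα0 hα2 hε hη hC hR₁
      (hint.translate hα0 x) (fun z hz => hM _ (by simpa using hz))
      (fun h hh => by rw [secondDiff_translate]; exact hsd _ h (by simp) hh)
      (fun R h0 h1 => by
        rw [fracAverage_translate, add_zero]
        exact hA x R h0 ((Metric.closedBall_subset_ball h1).trans hball))
    simp_rw [secondDiff_translate, add_zero] at this
    rw [hval x hx, this, mul_zero]
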